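/- Let $\alpha\in[0,1)$, let $k\ge 4$ be an integer, and let $f_0\in H^k(\mathbb R^2)\cap L^1(\mathbb R^2)$ be real-valued (elements of $H^k(\mathbb R^2)$ are identified with their continuous representatives) with a constant sign: either $f_0(x)\le 0$ for all $x\in\mathbb R^2$, or $f_0(x)\ge 0$ for all $x\in\mathbb R^2$. Let $T>0$ and let $f$ be a solution on $[0,T]$ of the generalised $\alpha$-Muskat problem in the stable regime \[ \partial_t f(x,t)=\mathrm{PV}\int_{\mathbb R^2}\frac{(\nabla f(x,t)-\nabla f(x-y,t))\cdot y}{\big[|y|^2+(f(x,t)-f(x-y,t))^2\big]^{\frac{3+\alpha}{2}}}\,dy,\qquad f(x,0)=f_0(x), \] that is, $f\in C([0,T];H^k(\mathbb R^2))$, and the equation holds for every $x\in\mathbb R^2$ and $t\in[0,T]$ (with one-sided time derivatives at the end points), where $\mathrm{PV}\int_{\mathbb R^2}$ is the limit of $\int_{\varepsilon<|y|<R}$ as $\varepsilon\to0^+$ and $R\to\infty$. (In particular this covers solutions in $C^1([0,T];H^k(\mathbb R^2))$.) Then for all $t\in[0,T]$, \[ \|f(\cdot,t)\|_{L^\infty}\le\frac{\|f_0\|_{L^\infty}}{\big[1+C\,t\big]^{\frac{2}{1+\alpha}}},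 \] where $C=C(\|f_0\|_{L^\infty},\|f_0\|_{L^1},\alpha)>0$ is a constant that depends only on $\|f_0\|_{L^\infty}$, $\|f_0\|_{L^1}$ and $\alpha$. -/

import Mathlib

open MeasureTheory Filter Topology
open scoped ENNReal FourierTransform Gradient

noncomputable section

namespace Muskat

/-- The plane `ℝ²` with its Euclidean norm. -/
abbrev Plane : Type := EuclideanSpace ℝ (Fin 2)

/-- The Sobolev norm `‖u‖_{H^k} = (‖u‖_{L²}² + ‖Λ^k u‖_{L²}²)^{1/2}` of a real function on the
plane, where `Λ = (-Δ)^{1/2}`. By Plancherel `‖Λ^k u‖_{L²}² = ∫ (2π|ξ|)^{2k} |û(ξ)|² dξ`, with `û`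
the `L²` Fourier transform in the normalization `û(ξ) = ∫ e^{-2πi x·ξ} u(x) dx`.
The value is `∞` when `u` is not in `L²` or `Λ^k u` is not. -/
def hkNorm (k : ℕ) (u : Plane → ℝ) : ℝ≥0∞ :=
  open Classical in
  if h : MemLp (fun x => (u x : ℂ)) 2 (volume : Measure Plane) then
    ((eLpNorm u 2 volume) ^ 2 +
      ∫⁻ ξ : Plane, ENNReal.ofReal ((2 * Real.pi * ‖ξ‖) ^ (2 * k)) *
        ‖(𝓕 (h.toLp (fun x => (u x : ℂ))) : Lp ℂ 2 (volume : Measure Plane)) ξ‖ₑ ^ 2)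
      ^ (1 / 2 : ℝ)
  else ∞

/-- `u ∈ H^k(ℝ²)`. As `H^k(ℝ²)` embeds into the continuous functions for `k ≥ 2`, an element of
`H^k(ℝ²)` is identified with its continuous representative. -/
def MemHk (k : ℕ) (u : Plane → ℝ) : Prop :=
  Continuous u ∧ hkNorm k u < ∞

/-- The integrand of the contour equation at the point `x`, as a function of `y`:
`(∇u(x) - ∇u(x - y)) · y / (|y|² + (u(x) - u(x - y))²)^{(3+α)/2}`. -/
def contourKernel (α : ℝ) (u : Plane → ℝ) (x y : Plane) : ℝ :=
  inner ℝ (∇ u x - ∇ u (x - y)) y /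
    (‖y‖ ^ 2 + (u x - u (x - y)) ^ 2) ^ ((3 + α) / 2)

/-- `PV ∫_{ℝ²} g(y) dy = v`: the integrals of `g` over the annuli `ε < |y| < R` exist and converge
to `v` as `ε → 0⁺` and `R → ∞`. -/
def HasPrincipalValue (g : Plane → ℝ) (v : ℝ) : Prop :=
  (∀ ε R : ℝ, 0 < ε → IntegrableOn g {y | ε < ‖y‖ ∧ ‖y‖ < R}) ∧
  Tendsto (fun p : ℝ × ℝ => ∫ y in {y : Plane | p.1 < ‖y‖ ∧ ‖y‖ < p.2}, g y)
    (𝓝[>] (0 : ℝ) ×ˢ atTop) (𝓝 v)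

/-- `f` is a solution on `[0, T]`, in the class `C([0,T]; H^k(ℝ²))`, of the contour equation
`∂ₜ f(x,t) = PV ∫ (∇f(x,t) - ∇f(x-y,t)) · y / (|y|² + (f(x,t) - f(x-y,t))²)^{(3+α)/2} dy`
with `f(·,0) = f₀`. The equation holds for all `x` and all `t ∈ [0, T]` (one-sided time
derivatives at the end points). -/
structure IsSolution (α : ℝ) (k : ℕ) (T : ℝ) (f₀ : Plane → ℝ) (f : ℝ → Plane → ℝ) : Prop where
  mem_hk : ∀ t ∈ Set.Icc 0 T, MemHk k (f t)
  continuous_hk : ∀ t ∈ Set.Icc 0 T,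
    Tendsto (fun s => hkNorm k (fun x => f s x - f t x)) (𝓝[Set.Icc 0 T] t) (𝓝 0)
  initial : f 0 = f₀
  equation : ∀ t ∈ Set.Icc 0 T, ∀ x : Plane, ∃ v : ℝ,
    HasPrincipalValue (contourKernel α (f t) x) v ∧
    HasDerivWithinAt (fun s => f s x) v (Set.Icc 0 T) t

end Muskat

end

open MeasureTheory Filter Topology
open scoped ENNReal FourierTransform Gradient

noncomputable section

namespace Muskat

open SchwartzMap in
/-- On `L¹ ∩ L²` the `L²` inverse Fourier transform is given by the Fourier integral. -/
theorem fourierInv_Lp_ae_eq (g : Lp ℂ 2 (volume : Measure Plane)) (hg : Integrable g) :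
    ((𝓕⁻ g : Lp ℂ 2 (volume : Measure Plane)) : Plane → ℂ) =ᵐ[volume]
      𝓕⁻ (g : Plane → ℂ) := by
  have hcont : Continuous (𝓕⁻ (g : Plane → ℂ)) := by
    have h : (𝓕⁻ (g : Plane → ℂ)) = fun x => 𝓕 (g : Plane → ℂ) (-x) := by
      ext x; exact Real.fourierInv_eq_fourier_neg _ _
    rw [h]
    exact (VectorFourier.fourierIntegral_continuous Real.continuous_fourierChar
      (by exact continuous_inner) hg).comp continuous_neg
  refine ae_eq_of_integral_contDiff_smul_eq
    ((Lp.memLp _).locallyIntegrable (by norm_num)) hcont.locallyIntegrable ?_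
  intro φ hφ hφc
  have hg₁ : HasCompactSupport (Complex.ofRealCLM ∘ φ) := hφc.comp_left rfl
  have hg₂ : ContDiff ℝ ((⊤ : ℕ∞) : WithTop ℕ∞) (Complex.ofRealCLM ∘ φ) := by fun_prop
  set ψ : 𝓢(Plane, ℂ) := hg₁.toSchwartzMap hg₂ with hψ
  have hψφ : ∀ x, ψ x = (φ x : ℂ) := fun x => by simp [hψ]
  have h1 := congrArg (fun D => D ψ) (Lp.fourierInv_toTemperedDistribution_eq g)
  simp only [TemperedDistribution.fourierInv_apply, Lp.toTemperedDistribution_apply] at h1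
  have h2 : ∫ x, φ x • (𝓕⁻ g : Lp ℂ 2 (volume : Measure Plane)) x =
      ∫ x, ψ x • (𝓕⁻ g : Lp ℂ 2 (volume : Measure Plane)) x := by
    refine integral_congr_ae (.of_forall fun x => ?_)
    simp [hψφ]
  rw [h2, ← h1]
  have h3 : ∫ x, φ x • (𝓕⁻ (g : Plane → ℂ)) x = ∫ x, ψ (-x) • (𝓕 (g : Plane → ℂ)) x := by
    rw [← integral_neg_eq_self]
    refine integral_congr_ae (.of_forall fun x => ?_)
    simp [hψφ, Real.fourierInv_eq_fourier_neg]
  rw [h3]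
  have h4 := VectorFourier.integral_fourierIntegral_smul_eq_flip (μ := (volume : Measure Plane))
    (ν := (volume : Measure Plane)) (f := fun x => ψ (-x)) (g := (g : Plane → ℂ))
    (L := innerₗ Plane) Real.continuous_fourierChar (by exact continuous_inner)
    ψ.integrable.comp_neg hg
  rw [flip_innerₗ] at h4
  refine Eq.trans ?_ h4
  refine integral_congr_ae (.of_forall fun x => ?_)
  simp only
  congr 1
  rw [SchwartzMap.fourierInv_coe, Real.fourierInv_eq_fourier_comp_neg]
  rfl

/-- Plancherel's identity for the Fourier integral on `L¹ ∩ L²`. -/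
theorem eLpNorm_fourierInv {g : Plane → ℂ} (hg : Integrable g) (hg2 : MemLp g 2) :
    MemLp (𝓕⁻ g) 2 ∧ eLpNorm (𝓕⁻ g) 2 volume = eLpNorm g 2 volume := by
  have hae : (hg2.toLp g : Plane → ℂ) =ᵐ[volume] g := hg2.coeFn_toLp
  have hint : Integrable (hg2.toLp g : Plane → ℂ) := hg.congr hae.symm
  have h := fourierInv_Lp_ae_eq (hg2.toLp g) hint
  have h' : 𝓕⁻ (hg2.toLp g : Plane → ℂ) = 𝓕⁻ g := by
    ext x; exact Real.fourierInv_congr_ae hae x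
  rw [h'] at h
  refine ⟨(Lp.memLp _).ae_eq h, ?_⟩
  rw [← eLpNorm_congr_ae h, ← Lp.enorm_def, ← eLpNorm_congr_ae hae, ← Lp.enorm_def]
  have : ‖(𝓕⁻ (hg2.toLp g) : Lp ℂ 2 (volume : Measure Plane))‖ = ‖hg2.toLp g‖ :=
    (Lp.fourierTransformₗᵢ Plane ℂ).symm.norm_map _
  rw [← ofReal_norm, this, ofReal_norm]

/-- The symbol `2πi ⟨ξ, v⟩` applied to `g`. -/
def derivSymbol (v : Plane) (g : Plane → ℂ) (ξ : Plane) : ℂ :=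
  (2 * Real.pi * Complex.I * (inner ℝ ξ v : ℝ)) * g ξ

theorem norm_derivSymbol_le (v : Plane) (g : Plane → ℂ) (ξ : Plane) :
    ‖derivSymbol v g ξ‖ ≤ 2 * Real.pi * ‖v‖ * (‖ξ‖ * ‖g ξ‖) := by
  have h := abs_real_inner_le_norm ξ v
  rw [derivSymbol, norm_mul, norm_mul, norm_mul, norm_mul]
  simp only [Complex.norm_I, Complex.norm_real, Complex.norm_ofNat, Real.norm_eq_abs,
    abs_of_pos Real.pi_pos, mul_one]
  calc 2 * Real.pi * |inner ℝ ξ v| * ‖g ξ‖ ≤ 2 * Real.pi * (‖ξ‖ * ‖v‖) * ‖g ξ‖ := by gcongr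
    _ = _ := by ring

theorem aestronglyMeasurable_derivSymbol {g : Plane → ℂ} (v : Plane)
    (hg : AEStronglyMeasurable g volume) : AEStronglyMeasurable (derivSymbol v g) volume := by
  unfold derivSymbol
  refine AEStronglyMeasurable.mul ?_ hg
  exact (by fun_prop : Continuous fun ξ : Plane =>
    (2 * Real.pi * Complex.I * (inner ℝ ξ v : ℝ) : ℂ)).aestronglyMeasurable

theorem integrable_derivSymbol {g : Plane → ℂ} (v : Plane) (hg : AEStronglyMeasurable g volume)
    (hg1 : Integrable fun ξ => ‖ξ‖ * ‖g ξ‖) : Integrable (derivSymbol v g) :=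
  (hg1.const_mul (2 * Real.pi * ‖v‖)).mono' (aestronglyMeasurable_derivSymbol v hg)
    (.of_forall (norm_derivSymbol_le v g))

theorem norm_fourierInv_le (g : Plane → ℂ) (x : Plane) : ‖𝓕⁻ g x‖ ≤ ∫ ξ, ‖g ξ‖ := by
  rw [Real.fourierInv_eq]
  refine (norm_integral_le_integral_norm _).trans (le_of_eq ?_)
  simp

theorem hasFDerivAt_fourierInv {g : Plane → ℂ} (hg : Integrable g)
    (hg1 : Integrable fun ξ => ‖ξ‖ * ‖g ξ‖) (x : Plane) :
    ∃ D : Plane →L[ℝ] ℂ, HasFDerivAt (𝓕⁻ g) D x ∧ ∀ v, D v = 𝓕⁻ (derivSymbol v g) x := by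
  have h := (Real.hasFDerivAt_fourier hg hg1 (-x)).comp x (hasFDerivAt_id x).neg
  have he : 𝓕 g ∘ (fun y => -y) = 𝓕⁻ g := by
    ext y; exact (Real.fourierInv_eq_fourier_neg g y).symm
  refine ⟨_, he ▸ h, fun v => ?_⟩
  have hint : Integrable (VectorFourier.fourierSMulRight (innerSL ℝ) g) := by
    refine (hg1.const_mul (2 * Real.pi * ‖innerSL ℝ (E := Plane)‖)).mono'
      hg.1.fourierSMulRight (.of_forall fun ξ => ?_)
    refine (VectorFourier.norm_fourierSMulRight_le (innerSL ℝ) g ξ).trans (le_of_eq (by ring))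
  have h2 := Real.fourier_continuousLinearMap_apply
    (f := VectorFourier.fourierSMulRight (innerSL ℝ) g)
    (a := v) (v := -x) hint
  simp only [ContinuousLinearMap.comp_apply, neg_apply,
    ContinuousLinearMap.id_apply, map_neg]
  rw [h2, Real.fourier_eq, Real.fourierInv_eq, ← integral_neg]
  refine integral_congr_ae (.of_forall fun ξ => ?_)
  simp only [derivSymbol, VectorFourier.fourierSMulRight_apply, Circle.smul_def, smul_eq_mul,
    inner_neg_right, neg_neg, neg_mul, mul_neg, Complex.real_smul]
  erw [innerSL_apply_apply]
  ring

theorem norm_fourierInv_sub_le {g : Plane → ℂ} (hg : Integrable g)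
    (hg1 : Integrable fun ξ => ‖ξ‖ * ‖g ξ‖) (x y : Plane) :
    ‖𝓕⁻ g x - 𝓕⁻ g y‖ ≤ 2 * Real.pi * (∫ ξ, ‖ξ‖ * ‖g ξ‖) * ‖x - y‖ := by
  choose D hD hDv using hasFDerivAt_fourierInv hg hg1
  have hnn : 0 ≤ ∫ ξ, ‖ξ‖ * ‖g ξ‖ := integral_nonneg fun _ => by positivity
  refine Convex.norm_image_sub_le_of_norm_hasFDerivWithin_le (f' := D)
    (fun z _ => (hD z).hasFDerivWithinAt) (fun z _ => ?_) convex_univ (Set.mem_univ y)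
    (Set.mem_univ x)
  refine ContinuousLinearMap.opNorm_le_bound _ (by positivity) fun v => ?_
  rw [hDv]
  refine (norm_fourierInv_le _ _).trans ?_
  calc ∫ ξ, ‖derivSymbol v g ξ‖ ≤ ∫ ξ, 2 * Real.pi * ‖v‖ * (‖ξ‖ * ‖g ξ‖) :=
        integral_mono (integrable_derivSymbol v hg.1 hg1).norm (hg1.const_mul _)
          (norm_derivSymbol_le v g)
    _ = _ := by rw [integral_const_mul]; ring

theorem fourierInv_sub_translate {g : Plane → ℂ} (hg : Integrable g) (x y : Plane) :
    𝓕⁻ g x - 𝓕⁻ g (x - y) =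
      𝓕⁻ (fun ξ => (1 - (Real.fourierChar (-(inner ℝ ξ y)) : ℂ)) * g ξ) x := by
  have hi : ∀ z : Plane, Integrable fun ξ => Real.fourierChar (inner ℝ ξ z) • g ξ := fun z => by
    have := (Real.fourierIntegral_convergent_iff (μ := volume) (f := g) (-z)).2 hg
    simpa using this
  rw [Real.fourierInv_eq, Real.fourierInv_eq, Real.fourierInv_eq, ← integral_sub (hi x) (hi _)]
  refine integral_congr_ae (.of_forall fun ξ => ?_)
  simp only [sub_eq_add_neg, inner_add_right, inner_neg_right, AddChar.map_add_eq_mul,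
    Circle.smul_def,
    Circle.coe_mul, smul_eq_mul]
  ring

theorem norm_one_sub_fourierChar_le (t : ℝ) :
    ‖(1 - (Real.fourierChar t : ℂ))‖ ≤ 2 * Real.pi * |t| := by
  have h := Convex.norm_image_sub_le_of_norm_hasDerivWithin_le (s := Set.univ) (𝕜 := ℝ)
    (f := fun s : ℝ => (Real.fourierChar s : ℂ)) (C := 2 * Real.pi)
    (fun s _ => (Real.hasDerivAt_fourierChar s).hasDerivWithinAt)
    (fun s _ => by simp [abs_of_pos Real.pi_pos, Circle.norm_coe]) convex_univ (Set.mem_univ t)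
    (Set.mem_univ (0:ℝ))
  simpa using h

theorem tendsto_fourierInv_cocompact (g : Plane → ℂ) :
    Tendsto (𝓕⁻ g) (cocompact Plane) (𝓝 0) := by
  have h := tendsto_integral_exp_inner_smul_cocompact (V := Plane) (fun ξ => g (-ξ))
  rw [Real.fourierInv_eq_fourier_comp_neg]
  exact h

theorem hkNorm_sq {k : ℕ} {u : Plane → ℝ} (h : MemLp (fun x => (u x : ℂ)) 2 volume) :
    hkNorm k u ^ 2 = eLpNorm u 2 volume ^ 2 +
      ∫⁻ ξ : Plane, ENNReal.ofReal ((2 * Real.pi * ‖ξ‖) ^ (2 * k)) *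
        ‖(𝓕 (h.toLp (fun x => (u x : ℂ))) : Lp ℂ 2 (volume : Measure Plane)) ξ‖ₑ ^ 2 := by
  rw [hkNorm, dif_pos h, ← ENNReal.rpow_natCast, ← ENNReal.rpow_mul]
  norm_num

theorem MemHk.memLp_complex {k : ℕ} {u : Plane → ℝ} (h : MemHk k u) :
    MemLp (fun x => (u x : ℂ)) 2 (volume : Measure Plane) := by
  by_contra hc
  have := h.2
  rw [hkNorm, dif_neg hc] at this
  exact lt_irrefl _ this

theorem sobolev_weight_le {k : ℕ} (hk : 4 ≤ k) {r : ℝ} (hr : 0 ≤ r) :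
    (1 + r ^ 2) ^ 4 ≤ 16 * (1 + (2 * Real.pi * r) ^ (2 * k)) := by
  rcases le_total r 1 with h | h
  · have h2 : r ^ 2 ≤ 1 := by nlinarith
    have h3 : (1 + r ^ 2) ^ 4 ≤ (1 + 1) ^ 4 := by gcongr
    have h4 : 0 ≤ (2 * Real.pi * r) ^ (2 * k) := by positivity
    nlinarith
  · have h2 : 1 ≤ r ^ 2 := by nlinarith
    have h3 : (1 + r ^ 2) ^ 4 ≤ (r ^ 2 + r ^ 2) ^ 4 := by gcongr
    have h4 : r ≤ 2 * Real.pi * r := by nlinarith [Real.pi_gt_three]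
    have h5 : r ^ 8 ≤ (2 * Real.pi * r) ^ (2 * k) :=
      (pow_le_pow_right₀ h (by omega)).trans (pow_le_pow_left₀ hr h4 _)
    nlinarith

theorem integrable_japanese_two : Integrable fun ξ : Plane => ((1 + ‖ξ‖ ^ 2) ^ 2)⁻¹ := by
  have h := integrable_rpow_neg_one_add_norm_sq (E := Plane) (r := 4) (μ := volume)
    (by simp [Plane]; norm_num)
  refine h.congr (.of_forall fun ξ => ?_)
  have : (0:ℝ) < 1 + ‖ξ‖ ^ 2 := by positivity
  simp only
  rw [show (-4 / 2 : ℝ) = -((2 : ℕ) : ℝ) by norm_num, Real.rpow_neg this.le, Real.rpow_natCast]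

/-- `(∫ (1 + |ξ|²)⁻²)^{1/2}`, the constant of the Sobolev embedding. -/
def sobolevConst : ℝ := (∫ ξ : Plane, ((1 + ‖ξ‖ ^ 2) ^ 2)⁻¹) ^ (1 / 2 : ℝ)

theorem sobolevConst_nonneg : 0 ≤ sobolevConst :=
  Real.rpow_nonneg (integral_nonneg fun _ => by positivity) _

theorem lintegral_weight_le {W : ℝ≥0∞} {g : Plane → ℂ} (hg : AEStronglyMeasurable g volume)
    (hW : ∫⁻ ξ, ENNReal.ofReal ((1 + ‖ξ‖ ^ 2) ^ 4) * ‖g ξ‖ₑ ^ 2 ≤ W ^ 2) :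
    ∫⁻ ξ, ENNReal.ofReal (1 + ‖ξ‖ ^ 2) * ‖g ξ‖ₑ ≤ W * ENNReal.ofReal sobolevConst := by
  have hpos : ∀ ξ : Plane, (0:ℝ) < 1 + ‖ξ‖ ^ 2 := fun ξ => by positivity
  have h := ENNReal.lintegral_mul_le_Lp_mul_Lq (μ := (volume : Measure Plane))
    (p := 2) (q := 2) ⟨by norm_num, by norm_num, by norm_num⟩
    (f := fun ξ => ENNReal.ofReal ((1 + ‖ξ‖ ^ 2) ^ 2) * ‖g ξ‖ₑ)
    (g := fun ξ => ENNReal.ofReal (1 + ‖ξ‖ ^ 2)⁻¹)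
    (by
      refine AEMeasurable.mul (Measurable.aemeasurable ?_) hg.enorm
      fun_prop)
    (Measurable.aemeasurable (by fun_prop))
  have h1 : ∫⁻ ξ, ENNReal.ofReal (1 + ‖ξ‖ ^ 2) * ‖g ξ‖ₑ = ∫⁻ ξ : Plane,
      ((fun ξ : Plane => ENNReal.ofReal ((1 + ‖ξ‖ ^ 2) ^ 2) * ‖g ξ‖ₑ) *
        (fun ξ : Plane => ENNReal.ofReal (1 + ‖ξ‖ ^ 2)⁻¹) : Plane → ℝ≥0∞) ξ := by
    refine lintegral_congr fun ξ => ?_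
    simp only [Pi.mul_apply]
    rw [mul_right_comm, ← ENNReal.ofReal_mul (by positivity)]
    congr 2
    field_simp
  rw [h1]
  refine h.trans (mul_le_mul' ?_ ?_)
  · have h2 : ∫⁻ ξ : Plane, (ENNReal.ofReal ((1 + ‖ξ‖ ^ 2) ^ 2) * ‖g ξ‖ₑ) ^ (2:ℝ) ≤ W ^ (2:ℝ) := by
      refine le_trans (le_of_eq (lintegral_congr fun ξ => ?_)) (hW.trans (le_of_eq ?_))
      · rw [ENNReal.mul_rpow_of_nonneg _ _ (by norm_num), ENNReal.rpow_ofNat, ENNReal.rpow_ofNat,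
          ← ENNReal.ofReal_pow (by positivity)]
        congr 2
        ring
      · rw [ENNReal.rpow_ofNat]
    calc _ ≤ (W ^ (2:ℝ)) ^ (1 / 2 : ℝ) := by gcongr
      _ = W := by rw [← ENNReal.rpow_mul]; norm_num
  · rw [sobolevConst, ← ENNReal.ofReal_rpow_of_nonneg (integral_nonneg fun _ => by positivity)
      (by norm_num), ofReal_integral_eq_lintegral_ofReal integrable_japanese_two
      (.of_forall fun _ => by positivity)]
    refine le_of_eq ?_
    congr 1
    refine lintegral_congr fun ξ => ?_
    rw [ENNReal.rpow_ofNat, ← ENNReal.ofReal_pow (by have := hpos ξ; positivity), inv_pow]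

/-- A function in `H^k`, `k ≥ 4`, is the inverse Fourier integral of an integrable function. -/
theorem MemHk.exists_symbol {k : ℕ} (hk : 4 ≤ k) {u : Plane → ℝ} (hu : MemHk k u) :
    ∃ g : Plane → ℂ, MemLp g 2 ∧ (∀ x, (u x : ℂ) = 𝓕⁻ g x) ∧
      Integrable (fun ξ => (1 + ‖ξ‖ ^ 2) * ‖g ξ‖) ∧
      ∫ ξ, (1 + ‖ξ‖ ^ 2) * ‖g ξ‖ ≤ 4 * sobolevConst * (hkNorm k u).toReal ∧
      Integrable (fun ξ => (1 + ‖ξ‖ ^ 2) * ‖g ξ‖ ^ 2) ∧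
      ∫ ξ, (1 + ‖ξ‖ ^ 2) * ‖g ξ‖ ^ 2 ≤ 16 * (hkNorm k u).toReal ^ 2 := by
  have h := hu.memLp_complex
  set G : Lp ℂ 2 (volume : Measure Plane) := 𝓕 (h.toLp (fun x => (u x : ℂ))) with hG
  have hG2 : MemLp (G : Plane → ℂ) 2 := Lp.memLp G
  have hGm : AEStronglyMeasurable (G : Plane → ℂ) volume := hG2.1
  have hsq : ∫⁻ ξ, ‖G ξ‖ₑ ^ 2 = eLpNorm u 2 volume ^ 2 := by
    have e1 : eLpNorm (G : Plane → ℂ) 2 volume = eLpNorm u 2 volume := by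
      rw [← Lp.enorm_def, ← ofReal_norm, hG, Lp.norm_fourier_eq, ofReal_norm, Lp.enorm_def,
        eLpNorm_congr_ae h.coeFn_toLp]
      exact eLpNorm_congr_norm_ae (.of_forall fun x => by simp)
    rw [← e1, eLpNorm_eq_lintegral_rpow_enorm_toReal (by norm_num) (by norm_num),
      ← ENNReal.rpow_natCast, ← ENNReal.rpow_mul]
    norm_num
  have hW : ∫⁻ ξ, ENNReal.ofReal ((1 + ‖ξ‖ ^ 2) ^ 4) * ‖G ξ‖ₑ ^ 2 ≤ (4 * hkNorm k u) ^ 2 := by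
    rw [mul_pow, hkNorm_sq h, ← hsq, ← lintegral_add_left' (hGm.enorm.pow_const 2),
      ← lintegral_const_mul' _ _ (by norm_num)]
    refine lintegral_mono fun ξ => ?_
    have hw := sobolev_weight_le hk (norm_nonneg ξ)
    calc _ ≤ ENNReal.ofReal (16 * (1 + (2 * Real.pi * ‖ξ‖) ^ (2 * k))) * ‖G ξ‖ₑ ^ 2 := by gcongr
      _ = _ := by
        rw [ENNReal.ofReal_mul (by norm_num), ENNReal.ofReal_add (by norm_num) (by positivity)]
        norm_num
        ring
  have hfin : hkNorm k u ≠ ∞ := hu.2.ne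
  have hL1 := lintegral_weight_le hGm hW
  have hL1' : ∫⁻ ξ, ENNReal.ofReal ((1 + ‖ξ‖ ^ 2) * ‖G ξ‖) ≤
      4 * hkNorm k u * ENNReal.ofReal sobolevConst := by
    refine le_trans (le_of_eq (lintegral_congr fun ξ => ?_)) hL1
    rw [ENNReal.ofReal_mul (by positivity), ofReal_norm]
  have hL2' : ∫⁻ ξ, ENNReal.ofReal ((1 + ‖ξ‖ ^ 2) * ‖G ξ‖ ^ 2) ≤ (4 * hkNorm k u) ^ 2 := by
    refine le_trans (lintegral_mono fun ξ => ?_) hW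
    rw [ENNReal.ofReal_mul (by positivity), ENNReal.ofReal_pow (norm_nonneg _), ofReal_norm]
    gcongr
    exact le_self_pow₀ (by nlinarith [sq_nonneg ‖ξ‖]) (by norm_num)
  have key : ∀ (F : Plane → ℝ) (B : ℝ≥0∞), AEStronglyMeasurable F volume → (∀ ξ, 0 ≤ F ξ) →
      B ≠ ∞ → ∫⁻ ξ, ENNReal.ofReal (F ξ) ≤ B → Integrable F ∧ ∫ ξ, F ξ ≤ B.toReal := by
    intro F B hF h0 hB hle
    refine ⟨⟨hF, ?_⟩, ?_⟩
    · rw [hasFiniteIntegral_iff_ofReal (.of_forall h0)]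
      exact hle.trans_lt hB.lt_top
    · rw [integral_eq_lintegral_of_nonneg_ae (.of_forall h0) hF]
      exact ENNReal.toReal_mono hB hle
  obtain ⟨i1, b1⟩ := key (fun ξ => (1 + ‖ξ‖ ^ 2) * ‖G ξ‖) _
    ((by fun_prop : Continuous fun ξ : Plane => 1 + ‖ξ‖ ^ 2).aestronglyMeasurable.mul hGm.norm)
    (fun ξ => by positivity) (by finiteness) hL1'
  obtain ⟨i2, b2⟩ := key (fun ξ => (1 + ‖ξ‖ ^ 2) * ‖G ξ‖ ^ 2) _
    ((by fun_prop : Continuous fun ξ : Plane => 1 + ‖ξ‖ ^ 2).aestronglyMeasurable.mul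
      (hGm.norm.pow 2))
    (fun ξ => by positivity) (by finiteness) hL2'
  have hint : Integrable (G : Plane → ℂ) := by
    refine i1.mono' hGm (.of_forall fun ξ => ?_)
    nlinarith [norm_nonneg (G ξ), mul_nonneg (sq_nonneg ‖ξ‖) (norm_nonneg (G ξ))]
  refine ⟨G, hG2, ?_, i1, b1.trans (le_of_eq ?_), i2, b2.trans (le_of_eq ?_)⟩
  · have e := fourierInv_Lp_ae_eq G hint
    have e2 : (𝓕⁻ G : Lp ℂ 2 (volume : Measure Plane)) = h.toLp (fun x => (u x : ℂ)) := by
      rw [hG]; exact FourierTransform.fourierInv_fourier_eq _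
    rw [e2] at e
    have e3 := h.coeFn_toLp.symm.trans e
    have hc : Continuous (𝓕⁻ (G : Plane → ℂ)) := by
      rw [Real.fourierInv_eq_fourier_comp_neg]
      exact VectorFourier.fourierIntegral_continuous Real.continuous_fourierChar
        (by exact continuous_inner) hint.comp_neg
    have := (Continuous.ae_eq_iff_eq volume (by have := hu.1; fun_prop) hc).1 e3
    exact fun x => congrFun this x
  · rw [ENNReal.toReal_mul, ENNReal.toReal_mul, ENNReal.toReal_ofReal sobolevConst_nonneg]
    norm_num
    ring
  · rw [ENNReal.toReal_pow, ENNReal.toReal_mul]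
    norm_num
    ring

/-- Quantitative regularity and decay of a function on the plane, with one constant `N`. -/
structure Profile (N : ℝ) (u : Plane → ℝ) : Prop where
  hasGradientAt : ∀ x, HasGradientAt u (∇ u x) x
  abs_le : ∀ x, |u x| ≤ N
  norm_grad_le : ∀ x, ‖∇ u x‖ ≤ N
  grad_lipschitz : ∀ x y, ‖∇ u x - ∇ u y‖ ≤ N * ‖x - y‖
  integrable_sq : Integrable fun x => u x ^ 2
  integral_sq_le : ∫ x, u x ^ 2 ≤ N
  integrable_grad_sq : Integrable fun x => ‖∇ u x‖ ^ 2
  integral_grad_sq_le : ∫ x, ‖∇ u x‖ ^ 2 ≤ N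
  integral_shift_sq_le : ∀ y, ∫ x, (u x - u (x - y)) ^ 2 ≤ N * ‖y‖ ^ 2
  vanish : Tendsto u (cocompact Plane) (𝓝 0)

theorem integral_norm_sq_fourierInv {g : Plane → ℂ} (hg : Integrable g) (hg2 : MemLp g 2) :
    Integrable (fun x => ‖𝓕⁻ g x‖ ^ 2) ∧ ∫ x, ‖𝓕⁻ g x‖ ^ 2 = ∫ ξ, ‖g ξ‖ ^ 2 := by
  obtain ⟨h1, h2⟩ := eLpNorm_fourierInv hg hg2
  refine ⟨h1.integrable_norm_pow (by norm_num), ?_⟩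
  have e : ∀ F : Plane → ℂ, MemLp F 2 volume →
      ∫ x, ‖F x‖ ^ 2 = (eLpNorm F 2 volume).toReal ^ 2 := by
    intro F hF
    rw [hF.eLpNorm_eq_integral_rpow_norm (by norm_num) (by norm_num), ENNReal.toReal_ofReal
      (Real.rpow_nonneg (integral_nonneg fun _ => by positivity) _), ← Real.rpow_natCast,
      ← Real.rpow_mul (integral_nonneg fun _ => by positivity)]
    norm_num
  rw [e _ h1, e _ hg2, h2]

theorem MemHk.gradient_fourier {u : Plane → ℝ} {g : Plane → ℂ}
    (hug : ∀ x, (u x : ℂ) = 𝓕⁻ g x) (hg : Integrable g)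
    (hg1 : Integrable fun ξ => ‖ξ‖ * ‖g ξ‖) (x : Plane) :
    HasGradientAt u (∇ u x) x ∧ ∀ v, inner ℝ (∇ u x) v = (𝓕⁻ (derivSymbol v g) x).re := by
  obtain ⟨D, hD, hDv⟩ := hasFDerivAt_fourierInv hg hg1 x
  have hu : u = fun x => Complex.reCLM (𝓕⁻ g x) := by ext x; simp [← hug]
  have h1 : HasFDerivAt u (Complex.reCLM ∘L D) x := by
    rw [hu]; exact Complex.reCLM.hasFDerivAt.comp x hD
  have h2 : HasGradientAt u (∇ u x) x := h1.differentiableAt.hasGradientAt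
  refine ⟨h2, fun v => ?_⟩
  have h3 := h1.unique h2.hasFDerivAt
  have h4 := congrArg (fun L => L v) h3
  simp only [ContinuousLinearMap.comp_apply, hDv, InnerProductSpace.toDual_apply_apply] at h4
  rw [← h4]; rfl

theorem norm_le_of_abs_inner_le {a : Plane} {B : ℝ} (hB : 0 ≤ B)
    (h : ∀ v, |inner ℝ a v| ≤ B * ‖v‖) : ‖a‖ ≤ B := by
  rcases eq_or_ne a 0 with rfl | ha
  · simpa using hB
  · have h1 := h a
    rw [real_inner_self_eq_norm_sq, abs_of_nonneg (by positivity)] at h1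
    have h2 : 0 < ‖a‖ := norm_pos_iff.2 ha
    nlinarith

theorem continuous_one_sub_fourierChar (y : Plane) :
    Continuous fun ξ : Plane => (1 - (Real.fourierChar (-(inner ℝ ξ y)) : ℂ)) := by
  have h : Continuous fun ξ : Plane => -(inner ℝ ξ y : ℝ) := by fun_prop
  exact continuous_const.sub
    (continuous_subtype_val.comp (Real.continuous_fourierChar.comp h))

set_option maxHeartbeats 400000 in
/-- Every `u ∈ H^k(ℝ²)` with `k ≥ 4` has the regularity recorded in `Profile`. -/
theorem exists_profile_const : ∃ C : ℝ, 0 < C ∧ ∀ k : ℕ, 4 ≤ k → ∀ u : Plane → ℝ, MemHk k u →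
    (∀ x, |u x| ≤ C * (hkNorm k u).toReal) ∧
      ∀ H : ℝ, (hkNorm k u).toReal ≤ H → Profile (C * (H + H ^ 2)) u := by
  refine ⟨160 * sobolevConst + 1280, by linarith [sobolevConst_nonneg], fun k hk u hu => ?_⟩
  obtain ⟨g, hg2, hug, i1, b1, i2, b2⟩ := hu.exists_symbol hk
  set H₀ := (hkNorm k u).toReal with hH₀
  have hH₀n : 0 ≤ H₀ := ENNReal.toReal_nonneg
  have hc := sobolevConst_nonneg
  set S₁ := ∫ ξ, (1 + ‖ξ‖ ^ 2) * ‖g ξ‖ with hS₁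
  set S₂ := ∫ ξ, (1 + ‖ξ‖ ^ 2) * ‖g ξ‖ ^ 2 with hS₂
  have hS₁n : 0 ≤ S₁ := integral_nonneg fun _ => by positivity
  have hS₂n : 0 ≤ S₂ := integral_nonneg fun _ => by positivity
  have hgm := hg2.1
  have hpi : Real.pi ^ 2 ≤ 10 := by nlinarith [Real.pi_gt_three, Real.pi_lt_d2]
  have hpi1 := Real.pi_pos
  have hpi2 : Real.pi ≤ 4 := Real.pi_le_four
  have ig : Integrable g := i1.mono' hgm (.of_forall fun ξ => by
    nlinarith [norm_nonneg (g ξ), mul_nonneg (sq_nonneg ‖ξ‖) (norm_nonneg (g ξ))])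
  have ig1 : Integrable fun ξ => ‖ξ‖ * ‖g ξ‖ := i1.mono' (continuous_norm.aestronglyMeasurable.mul
    hgm.norm) (.of_forall fun ξ => by
    rw [Real.norm_of_nonneg (by positivity)]
    have : ‖ξ‖ ≤ 1 + ‖ξ‖ ^ 2 := by nlinarith [sq_nonneg (‖ξ‖ - 1), norm_nonneg ξ]
    gcongr)
  have ig2 : Integrable fun ξ => ‖ξ‖ ^ 2 * ‖g ξ‖ := i1.mono' ((continuous_norm.pow
    2).aestronglyMeasurable.mul hgm.norm) (.of_forall fun ξ => by
    rw [Real.norm_of_nonneg (by positivity)]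
    gcongr; linarith)
  have ib1 : ∫ ξ, ‖ξ‖ * ‖g ξ‖ ≤ S₁ := integral_mono ig1 i1 fun ξ => by
    have : ‖ξ‖ ≤ 1 + ‖ξ‖ ^ 2 := by nlinarith [sq_nonneg (‖ξ‖ - 1), norm_nonneg ξ]
    simp only; gcongr
  have ib0 : ∫ ξ, ‖g ξ‖ ≤ S₁ := integral_mono ig.norm i1 fun ξ => by
    simp only
    nlinarith [norm_nonneg (g ξ), mul_nonneg (sq_nonneg ‖ξ‖) (norm_nonneg (g ξ))]
  have ib2 : ∫ ξ, ‖ξ‖ ^ 2 * ‖g ξ‖ ≤ S₁ := integral_mono ig2 i1 fun ξ => by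
    simp only; gcongr; linarith
  have ub : ∀ x, |u x| ≤ S₁ := fun x => by
    rw [← Real.norm_eq_abs, ← Complex.norm_real, hug]
    exact (norm_fourierInv_le g x).trans ib0
  have symb : ∀ (h : Plane → ℂ) (c : ℝ), 0 ≤ c → AEStronglyMeasurable h volume →
      (∀ ξ, ‖h ξ‖ ≤ c * (‖ξ‖ * ‖g ξ‖)) → Integrable (fun x => ‖𝓕⁻ h x‖ ^ 2) ∧
        ∫ x, ‖𝓕⁻ h x‖ ^ 2 ≤ c ^ 2 * S₂ := by
    intro h c hc0 hm hle
    have hi : Integrable h := (ig1.const_mul c).mono' hm (.of_forall hle)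
    have hsq : ∀ ξ, ‖h ξ‖ ^ 2 ≤ c ^ 2 * ((1 + ‖ξ‖ ^ 2) * ‖g ξ‖ ^ 2) := fun ξ => by
      calc ‖h ξ‖ ^ 2 ≤ (c * (‖ξ‖ * ‖g ξ‖)) ^ 2 := by gcongr; exact hle ξ
        _ = c ^ 2 * (‖ξ‖ ^ 2 * ‖g ξ‖ ^ 2) := by ring
        _ ≤ _ := by gcongr; linarith
    have hi2 : Integrable fun ξ => ‖h ξ‖ ^ 2 := (i2.const_mul (c ^ 2)).mono' (hm.norm.pow 2)
      (.of_forall fun ξ => by rw [Real.norm_of_nonneg (by positivity)]; exact hsq ξ)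
    have hL2 : MemLp h 2 := (memLp_two_iff_integrable_sq_norm hm).2 hi2
    obtain ⟨r1, r2⟩ := integral_norm_sq_fourierInv hi hL2
    refine ⟨r1, r2.trans_le ?_⟩
    calc _ ≤ ∫ ξ, c ^ 2 * ((1 + ‖ξ‖ ^ 2) * ‖g ξ‖ ^ 2) := integral_mono hi2 (i2.const_mul _) hsq
      _ = _ := integral_const_mul _ _
  have hgrad := fun x => MemHk.gradient_fourier hug ig ig1 x
  have hlip : ∀ x y, ‖∇ u x - ∇ u y‖ ≤ 2 * Real.pi * (2 * Real.pi * S₁) * ‖x - y‖ := by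
      intro x y
      refine norm_le_of_abs_inner_le (by positivity) fun v => ?_
      rw [inner_sub_left, (hgrad x).2, (hgrad y).2, ← Complex.sub_re]
      have hds : Integrable fun ξ => ‖ξ‖ * ‖derivSymbol v g ξ‖ := by
        refine (ig2.const_mul (2 * Real.pi * ‖v‖)).mono' (continuous_norm.aestronglyMeasurable.mul
          (aestronglyMeasurable_derivSymbol v hgm).norm) (.of_forall fun ξ => ?_)
        rw [Real.norm_of_nonneg (by positivity)]
        have := mul_le_mul_of_nonneg_left (norm_derivSymbol_le v g ξ) (norm_nonneg ξ)
        nlinarith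
      refine (Complex.abs_re_le_norm _).trans ((norm_fourierInv_sub_le
        (integrable_derivSymbol v hgm ig1) hds x y).trans ?_)
      have hle : ∫ ξ, ‖ξ‖ * ‖derivSymbol v g ξ‖ ≤ 2 * Real.pi * ‖v‖ * S₁ := by
        calc _ ≤ ∫ ξ, 2 * Real.pi * ‖v‖ * (‖ξ‖ ^ 2 * ‖g ξ‖) :=
              integral_mono hds (ig2.const_mul _) fun ξ => by
                have := mul_le_mul_of_nonneg_left (norm_derivSymbol_le v g ξ) (norm_nonneg ξ)
                simp only; nlinarith
          _ = 2 * Real.pi * ‖v‖ * ∫ ξ, ‖ξ‖ ^ 2 * ‖g ξ‖ := integral_const_mul _ _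
          _ ≤ _ := by gcongr
      calc _ ≤ 2 * Real.pi * (2 * Real.pi * ‖v‖ * S₁) * ‖x - y‖ := by gcongr
        _ = _ := by ring
  have hgc : Continuous (∇ u) := by
    refine (LipschitzWith.of_dist_le_mul (K := Real.toNNReal (2 * Real.pi * (2 * Real.pi * S₁)))
      fun x y => ?_).continuous
    rw [dist_eq_norm, dist_eq_norm, Real.coe_toNNReal _ (by positivity)]
    exact hlip x y
  have huc : Continuous u := hu.1
  refine ⟨fun x => (ub x).trans (b1.trans (by nlinarith)), fun H hH => ?_⟩
  have hHn : 0 ≤ H := hH₀n.trans hH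
  have hS₁H : S₁ ≤ 4 * sobolevConst * H := b1.trans (by gcongr)
  have hS₂H : S₂ ≤ 16 * H ^ 2 := b2.trans (by gcongr)
  have hcH : 0 ≤ sobolevConst * H := by positivity
  have hcH2 : 0 ≤ sobolevConst * H ^ 2 := by positivity
  have hH2 : 0 ≤ H ^ 2 := by positivity
  have hN : 40 * S₁ ≤ (160 * sobolevConst + 1280) * (H + H ^ 2) := by nlinarith
  have hN2 : 80 * S₂ ≤ (160 * sobolevConst + 1280) * (H + H ^ 2) := by nlinarith
  have h4pi : (2 * Real.pi) ^ 2 ≤ 40 := by nlinarith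
  have hsqe : ∀ x, u x ^ 2 = ‖𝓕⁻ g x‖ ^ 2 := fun x => by
    rw [← hug, Complex.norm_real, Real.norm_eq_abs, sq_abs]
  have hpl := integral_norm_sq_fourierInv ig hg2
  have hcoord : ∀ j : Fin 2, Integrable (fun x => (∇ u x j) ^ 2) ∧
      ∫ x, (∇ u x j) ^ 2 ≤ 40 * S₂ := by
    intro j
    set e : Plane := EuclideanSpace.single j 1 with he
    have hen : ‖e‖ = 1 := by simp [he]
    obtain ⟨r1, r2⟩ := symb (derivSymbol e g) (2 * Real.pi) (by positivity)
      (aestronglyMeasurable_derivSymbol e hgm) fun ξ => by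
        simpa [hen] using norm_derivSymbol_le e g ξ
    have hle : ∀ x, (∇ u x j) ^ 2 ≤ ‖𝓕⁻ (derivSymbol e g) x‖ ^ 2 := fun x => by
      have h1 : ∇ u x j = (𝓕⁻ (derivSymbol e g) x).re := by
        rw [← (hgrad x).2, he, EuclideanSpace.inner_single_right]; simp
      rw [h1, ← sq_abs]
      gcongr
      exact Complex.abs_re_le_norm _
    have hm : Continuous fun x => (∇ u x j) ^ 2 := by fun_prop
    have hi : Integrable (fun x => (∇ u x j) ^ 2) := r1.mono' hm.aestronglyMeasurable
      (.of_forall fun x => by rw [Real.norm_of_nonneg (by positivity)]; exact hle x)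
    exact ⟨hi, (integral_mono hi r1 hle).trans (r2.trans (mul_le_mul_of_nonneg_right h4pi hS₂n))⟩
  have hnsq : ∀ x, ‖∇ u x‖ ^ 2 = (∇ u x 0) ^ 2 + (∇ u x 1) ^ 2 := fun x => by
    rw [EuclideanSpace.norm_sq_eq]; simp [Fin.sum_univ_two]
  constructor
  · exact fun x => (hgrad x).1
  · exact fun x => (ub x).trans (by linarith)
  · intro x
    refine norm_le_of_abs_inner_le (by linarith) fun v => ?_
    rw [(hgrad x).2]
    refine (Complex.abs_re_le_norm _).trans ((norm_fourierInv_le _ _).trans ?_)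
    calc ∫ ξ, ‖derivSymbol v g ξ‖ ≤ ∫ ξ, 2 * Real.pi * ‖v‖ * (‖ξ‖ * ‖g ξ‖) :=
          integral_mono (integrable_derivSymbol v hgm ig1).norm (ig1.const_mul _)
            (norm_derivSymbol_le v g)
      _ = 2 * Real.pi * ‖v‖ * ∫ ξ, ‖ξ‖ * ‖g ξ‖ := integral_const_mul _ _
      _ ≤ 2 * 4 * ‖v‖ * S₁ := by gcongr
      _ = 8 * S₁ * ‖v‖ := by ring
      _ ≤ _ := mul_le_mul_of_nonneg_right (by linarith) (norm_nonneg _)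
  · intro x y
    refine (hlip x y).trans (mul_le_mul_of_nonneg_right ?_ (norm_nonneg _))
    nlinarith
  · exact hpl.1.congr (.of_forall fun x => (hsqe x).symm)
  · calc ∫ x, u x ^ 2 = ∫ ξ, ‖g ξ‖ ^ 2 := by rw [← hpl.2]; simp_rw [hsqe]
      _ ≤ S₂ := integral_mono ((memLp_two_iff_integrable_sq_norm hgm).1 hg2) i2 fun ξ => by
          simp only; nlinarith [sq_nonneg ‖g ξ‖, mul_nonneg (sq_nonneg ‖ξ‖) (sq_nonneg ‖g ξ‖)]
      _ ≤ _ := by linarith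
  · simp_rw [hnsq]; exact (hcoord 0).1.add (hcoord 1).1
  · simp_rw [hnsq]
    rw [integral_add (hcoord 0).1 (hcoord 1).1]
    linarith [(hcoord 0).2, (hcoord 1).2]
  · intro y
    obtain ⟨r1, r2⟩ := symb (fun ξ => (1 - (Real.fourierChar (-(inner ℝ ξ y)) : ℂ)) * g ξ)
      (2 * Real.pi * ‖y‖) (by positivity)
      ((continuous_one_sub_fourierChar y).aestronglyMeasurable.mul hgm) fun ξ => by
        rw [norm_mul]
        calc _ ≤ 2 * Real.pi * |-(inner ℝ ξ y)| * ‖g ξ‖ := by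
              gcongr; exact norm_one_sub_fourierChar_le _
          _ ≤ 2 * Real.pi * (‖ξ‖ * ‖y‖) * ‖g ξ‖ := by
              rw [abs_neg]; gcongr; exact abs_real_inner_le_norm _ _
          _ = _ := by ring
    have e : ∀ x, (u x - u (x - y)) ^ 2 =
        ‖𝓕⁻ (fun ξ => (1 - (Real.fourierChar (-(inner ℝ ξ y)) : ℂ)) * g ξ) x‖ ^ 2 := fun x => by
      rw [← fourierInv_sub_translate ig, ← hug, ← hug, ← Complex.ofReal_sub, Complex.norm_real,
        Real.norm_eq_abs, sq_abs]
    simp_rw [e]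
    refine r2.trans ?_
    calc (2 * Real.pi * ‖y‖) ^ 2 * S₂ = (2 * Real.pi) ^ 2 * S₂ * ‖y‖ ^ 2 := by ring
      _ ≤ 40 * S₂ * ‖y‖ ^ 2 :=
        mul_le_mul_of_nonneg_right (mul_le_mul_of_nonneg_right h4pi hS₂n) (by positivity)
      _ ≤ _ := mul_le_mul_of_nonneg_right (by linarith) (by positivity)
  · have h := (Complex.continuous_re.tendsto 0).comp (tendsto_fourierInv_cocompact g)
    simp only [Complex.zero_re] at h
    exact h.congr fun x => by simp [← hug]

/-- The perimeter of the unit circle, as twice the area of the unit disc. -/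
def circleLen : ℝ := 2 * volume.real (Metric.ball (0 : Plane) 1)

theorem circleLen_nonneg : 0 ≤ circleLen := by unfold circleLen; positivity

theorem integral_norm_rpow_le {s r : ℝ} (hs : s < 2) (hr : 0 ≤ r) :
    IntegrableOn (fun y : Plane => ‖y‖ ^ (-s)) {y | ‖y‖ ≤ r} ∧
      ∫ y in {y : Plane | ‖y‖ ≤ r}, ‖y‖ ^ (-s) = circleLen * (r ^ (2 - s) / (2 - s)) := by
  have hm : MeasurableSet {y : Plane | ‖y‖ ≤ r} := measurableSet_le (by fun_prop) (by fun_prop)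
  set f : ℝ → ℝ := (Set.Iic r).indicator fun t => t ^ (-s) with hf
  have e : {y : Plane | ‖y‖ ≤ r}.indicator (fun y : Plane => ‖y‖ ^ (-s)) = fun y => f ‖y‖ := by
    ext y; simp [hf, Set.indicator]
  have e2 : ∀ t ∈ Set.Ioi (0:ℝ), t ^ (Module.finrank ℝ Plane - 1) • f t =
      (Set.Ioc 0 r).indicator (fun t => t ^ (1 - s)) t := by
    intro t ht
    have ht' : (0:ℝ) < t := ht
    by_cases h : t ≤ r
    · simp [hf, Set.indicator, h, ht', Real.rpow_sub ht', Real.rpow_neg ht'.le, div_eq_mul_inv]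
    · simp [hf, Set.indicator, h]
  have hI : IntegrableOn (fun t : ℝ => t ^ (1 - s)) (Set.Ioc 0 r) :=
    (intervalIntegrable_iff_integrableOn_Ioc_of_le hr).1
      (intervalIntegral.intervalIntegrable_rpow' (by linarith))
  constructor
  · rw [← integrable_indicator_iff hm, e, integrable_fun_norm_addHaar]
    refine IntegrableOn.congr_fun ?_ (fun t ht => (e2 t ht).symm) measurableSet_Ioi
    exact ((integrable_indicator_iff measurableSet_Ioc).2 hI).integrableOn
  · rw [← integral_indicator hm, e, integral_fun_norm_addHaar, setIntegral_congr_fun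
      measurableSet_Ioi e2, setIntegral_indicator measurableSet_Ioc,
      Set.inter_eq_self_of_subset_right (fun t ht => ht.1),
      ← intervalIntegral.integral_of_le hr, integral_rpow (Or.inl (by linarith))]
    rw [show 1 - s + 1 = 2 - s by ring, Real.zero_rpow (by linarith)]
    simp [circleLen]
    ring

theorem integral_norm_rpow_far {s L : ℝ} (hs : 2 < s) (hL : 0 < L) :
    IntegrableOn (fun y : Plane => ‖y‖ ^ (-s)) {y | L < ‖y‖} ∧
      ∫ y in {y : Plane | L < ‖y‖}, ‖y‖ ^ (-s) = circleLen * (L ^ (2 - s) / (s - 2)) := by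
  have hm : MeasurableSet {y : Plane | L < ‖y‖} := measurableSet_lt (by fun_prop) (by fun_prop)
  set f : ℝ → ℝ := (Set.Ioi L).indicator fun t => t ^ (-s) with hf
  have e : {y : Plane | L < ‖y‖}.indicator (fun y : Plane => ‖y‖ ^ (-s)) = fun y => f ‖y‖ := by
    ext y; simp [hf, Set.indicator]
  have e2 : ∀ t ∈ Set.Ioi (0:ℝ), t ^ (Module.finrank ℝ Plane - 1) • f t =
      (Set.Ioi L).indicator (fun t => t ^ (1 - s)) t := by
    intro t ht
    have ht' : (0:ℝ) < t := ht
    by_cases h : L < t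
    · simp [hf, Set.indicator, h, Real.rpow_sub ht', Real.rpow_neg ht'.le, div_eq_mul_inv]
    · simp [hf, Set.indicator, h]
  have hI : IntegrableOn (fun t : ℝ => t ^ (1 - s)) (Set.Ioi L) :=
    integrableOn_Ioi_rpow_of_lt (by linarith) hL
  constructor
  · rw [← integrable_indicator_iff hm, e, integrable_fun_norm_addHaar]
    refine IntegrableOn.congr_fun ?_ (fun t ht => (e2 t ht).symm) measurableSet_Ioi
    exact ((integrable_indicator_iff measurableSet_Ioi).2 hI).integrableOn
  · rw [← integral_indicator hm, e, integral_fun_norm_addHaar, setIntegral_congr_fun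
      measurableSet_Ioi e2, setIntegral_indicator measurableSet_Ioi,
      show Set.Ioi 0 ∩ Set.Ioi L = Set.Ioi L from
        Set.inter_eq_self_of_subset_right (Set.Ioi_subset_Ioi hL.le),
      integral_Ioi_rpow_of_lt (by linarith) hL]
    have h1 : s - 2 ≠ 0 := by linarith
    have h2 : 2 - s ≠ 0 := by linarith
    rw [show 1 - s + 1 = 2 - s by ring]
    simp [circleLen]
    field_simp
    ring

theorem setIntegral_odd_eq_zero {S : Set Plane} (hS : MeasurableSet S)
    (hsym : ∀ y, -y ∈ S ↔ y ∈ S) {f : Plane → ℝ} (hf : ∀ y, f (-y) = -f y) :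
    ∫ y in S, f y = 0 := by
  have h := integral_neg_eq_self (S.indicator f) (volume : Measure Plane)
  have e : (fun y => S.indicator f (-y)) = fun y => -(S.indicator f y) := by
    ext y
    by_cases hy : y ∈ S
    · rw [Set.indicator_of_mem hy, Set.indicator_of_mem ((hsym y).2 hy), hf]
    · rw [Set.indicator_of_notMem hy,
        Set.indicator_of_notMem (fun h => hy ((hsym y).1 h)), neg_zero]
  rw [e, integral_neg, integral_indicator hS] at h
  linarith

namespace Profile

variable {N : ℝ} {u : Plane → ℝ}

theorem const_nonneg (h : Profile N u) : 0 ≤ N := (abs_nonneg _).trans (h.abs_le 0)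

theorem continuous (h : Profile N u) : Continuous u :=
  continuous_iff_continuousAt.2 fun x => (h.hasGradientAt x).continuousAt

theorem continuous_grad (h : Profile N u) : Continuous (∇ u) :=
  (LipschitzWith.of_dist_le_mul (K := Real.toNNReal N) fun x y => by
    rw [dist_eq_norm, dist_eq_norm, Real.coe_toNNReal _ h.const_nonneg]
    exact h.grad_lipschitz x y).continuous

theorem abs_sub_le (h : Profile N u) (x y : Plane) : |u x - u y| ≤ N * ‖x - y‖ := by
  refine Convex.norm_image_sub_le_of_norm_hasFDerivWithin_le
    (fun z _ => (h.hasGradientAt z).hasFDerivAt.hasFDerivWithinAt) (fun z _ => ?_) convex_univ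
    (Set.mem_univ y) (Set.mem_univ x)
  rw [LinearIsometryEquiv.norm_map]
  exact h.norm_grad_le z

end Profile

/-- The denominator of the contour kernel is at least the power of the distance. -/
theorem denom_ge {p a : ℝ} (hp : 0 ≤ p) (y : Plane) :
    ‖y‖ ^ (2 * p) ≤ (‖y‖ ^ 2 + a ^ 2) ^ p := by
  rw [Real.rpow_mul (norm_nonneg _)]
  norm_num
  gcongr
  nlinarith [sq_nonneg a]

theorem rpow_neg_sub_le {A B p : ℝ} (hA : 0 < A) (hB : 0 ≤ B) (hp : p ≤ 2) :
    A ^ (-p) - (A + B) ^ (-p) ≤ 2 * B * A ^ (-p - 1) := by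
  have h1 : (A + B) ^ (-p) = A ^ (-p) * (1 + B / A) ^ (-p) := by
    rw [← Real.mul_rpow hA.le (by positivity)]
    congr 1; field_simp
  have hz : 0 ≤ B / A := by positivity
  have h2 : 1 - 2 * (B / A) ≤ (1 + B / A) ^ (-p) := by
    have h3 : (1 + B / A) ^ (-2 : ℝ) ≤ (1 + B / A) ^ (-p) :=
      Real.rpow_le_rpow_of_exponent_le (by linarith) (by linarith)
    refine le_trans ?_ h3
    rw [show (-2 : ℝ) = -((2 : ℕ) : ℝ) by norm_num, Real.rpow_neg (by positivity),
      Real.rpow_natCast, ← one_div, le_div_iff₀ (by positivity)]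
    nlinarith [pow_nonneg hz 3, sq_nonneg (B / A)]
  rw [h1, Real.rpow_sub_one hA.ne']
  have := Real.rpow_nonneg hA.le (-p)
  have e : 2 * B * (A ^ (-p) / A) = A ^ (-p) * (2 * (B / A)) := by ring
  rw [e]
  nlinarith

namespace Profile

variable {N α : ℝ} {u : Plane → ℝ}

theorem measurable_contourKernel (h : Profile N u) :
    Measurable fun z : Plane × Plane => contourKernel α u z.1 z.2 := by
  have h1 := h.continuous
  have h2 := h.continuous_grad
  unfold contourKernel
  refine Measurable.div (Continuous.measurable (by fun_prop)) (Measurable.pow_const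
    (Continuous.measurable (by fun_prop)) _)

theorem measurable_contourKernel_right (h : Profile N u) (x : Plane) :
    Measurable fun y : Plane => contourKernel α u x y :=
  Measurable.comp (g := fun z : Plane × Plane => contourKernel α u z.1 z.2)
    (f := fun y => (x, y)) h.measurable_contourKernel measurable_prodMk_left

theorem abs_contourKernel_le (h : Profile N u) (hα : 0 ≤ α) (x y : Plane) :
    |contourKernel α u x y| ≤ N * ‖y‖ ^ (-(1 + α)) := by
  have hN := h.const_nonneg
  rcases eq_or_ne y 0 with rfl | hy
  · simp only [contourKernel, inner_zero_right, zero_div, abs_zero]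
    positivity
  have hy' : 0 < ‖y‖ := norm_pos_iff.2 hy
  have hd := denom_ge (p := (3 + α) / 2) (a := u x - u (x - y)) (by linarith) y
  have hpos : 0 < ‖y‖ ^ (2 * ((3 + α) / 2)) := Real.rpow_pos_of_pos hy' _
  rw [contourKernel, abs_div, abs_of_pos (hpos.trans_le hd)]
  have hi : |inner ℝ (∇ u x - ∇ u (x - y)) y| ≤ N * ‖y‖ * ‖y‖ := by
    refine (abs_real_inner_le_norm _ _).trans ?_
    gcongr
    simpa using h.grad_lipschitz x (x - y)
  calc _ ≤ N * ‖y‖ * ‖y‖ / ‖y‖ ^ (2 * ((3 + α) / 2)) := by gcongr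
    _ = _ := by
      rw [show -(1 + α) = 2 - 2 * ((3 + α) / 2) by ring, Real.rpow_sub hy']
      norm_num
      ring

theorem integrableOn_contourKernel (h : Profile N u) (hα : 0 ≤ α) (hα1 : α < 1) (x : Plane)
    {r : ℝ} (hr : 0 ≤ r) : IntegrableOn (contourKernel α u x) {y | ‖y‖ ≤ r} :=
  ((integral_norm_rpow_le (s := 1 + α) (by linarith) hr).1.const_mul N).mono'
    (h.measurable_contourKernel_right x).aestronglyMeasurable
    (.of_forall fun y => h.abs_contourKernel_le hα x y)

theorem abs_setIntegral_near_le (h : Profile N u) (hα : 0 ≤ α) (hα1 : α < 1) (x : Plane)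
    {r : ℝ} (hr : 0 ≤ r) {S : Set Plane} (hS : S ⊆ {y | ‖y‖ ≤ r}) :
    |∫ y in S, contourKernel α u x y| ≤ N * circleLen / (1 - α) * r ^ (1 - α) := by
  have hI := integral_norm_rpow_le (s := 1 + α) (by linarith) hr
  have hN := h.const_nonneg
  calc |∫ y in S, contourKernel α u x y| ≤ ∫ y in S, N * ‖y‖ ^ (-(1 + α)) := by
        rw [← Real.norm_eq_abs]
        refine norm_integral_le_of_norm_le ((hI.1.mono_set hS).const_mul N)
          (.of_forall fun y => h.abs_contourKernel_le hα x y)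
    _ ≤ ∫ y in {y : Plane | ‖y‖ ≤ r}, N * ‖y‖ ^ (-(1 + α)) :=
        setIntegral_mono_set (hI.1.const_mul N) (.of_forall fun y => by positivity)
          (LE.le.eventuallyLE hS)
    _ = _ := by
        rw [integral_const_mul, hI.2]
        ring_nf

/-- Away from the origin the kernel is, up to an integrable error, an odd function. -/
theorem abs_contourKernel_sub_odd_le (h : Profile N u) (hα : 0 ≤ α) (hα1 : α < 1)
    (x y : Plane) (hy : y ≠ 0) :
    |contourKernel α u x y - inner ℝ (∇ u x) y * ‖y‖ ^ (-(3 + α))| ≤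
      8 * N ^ 3 * ‖y‖ ^ (-(4 + α)) + ‖∇ u (x - y)‖ * ‖y‖ ^ (-(2 + α)) := by
  have hN := h.const_nonneg
  have hy' : 0 < ‖y‖ := norm_pos_iff.2 hy
  set D : ℝ := ‖y‖ ^ 2 + (u x - u (x - y)) ^ 2 with hD
  set p : ℝ := (3 + α) / 2 with hp
  have hD0 : 0 < D := by positivity
  have e2 : ∀ q : ℝ, (‖y‖ ^ 2) ^ q = ‖y‖ ^ (2 * q) := fun q => by
    rw [Real.rpow_mul hy'.le]; norm_num
  have hδ : (u x - u (x - y)) ^ 2 ≤ 4 * N ^ 2 := by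
    have h1 := _root_.abs_le.1 (h.abs_le x)
    have h2 := _root_.abs_le.1 (h.abs_le (x - y))
    nlinarith
  have hdiff := rpow_neg_sub_le (A := ‖y‖ ^ 2) (B := (u x - u (x - y)) ^ 2) (p := p)
    (by positivity) (sq_nonneg _) (by rw [hp]; linarith)
  have hmono : D ^ (-p) ≤ (‖y‖ ^ 2) ^ (-p) :=
    Real.rpow_le_rpow_of_nonpos (by positivity)
      (by rw [hD]; nlinarith [sq_nonneg (u x - u (x - y))])
      (by rw [hp]; linarith)
  rw [e2, show 2 * -p = -(3 + α) by rw [hp]; ring] at hmono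
  rw [e2, e2, show 2 * -p = -(3 + α) by rw [hp]; ring,
    show 2 * (-p - 1) = -(5 + α) by rw [hp]; ring, ← hD] at hdiff
  have hDn : 0 ≤ D ^ (-p) := Real.rpow_nonneg hD0.le _
  have hK : contourKernel α u x y - inner ℝ (∇ u x) y * ‖y‖ ^ (-(3 + α)) =
      inner ℝ (∇ u x) y * (D ^ (-p) - ‖y‖ ^ (-(3 + α))) - inner ℝ (∇ u (x - y)) y * D ^ (-p) := by
    rw [contourKernel, inner_sub_left, ← hD, ← hp, Real.rpow_neg hD0.le]
    ring
  rw [hK]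
  refine (abs_sub _ _).trans (add_le_add ?_ ?_)
  · rw [abs_mul, abs_sub_comm, abs_of_nonneg (sub_nonneg.2 hmono)]
    calc _ ≤ (N * ‖y‖) * (2 * (4 * N ^ 2) * ‖y‖ ^ (-(5 + α))) := by
          refine mul_le_mul ((abs_real_inner_le_norm _ _).trans ?_) (hdiff.trans ?_)
            (sub_nonneg.2 hmono) (by positivity)
          · gcongr; exact h.norm_grad_le x
          · gcongr
      _ = _ := by
          rw [show -(4 + α) = -(5 + α) + 1 by ring, Real.rpow_add_one hy'.ne']
          ring
  · rw [abs_mul, abs_of_nonneg hDn]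
    calc _ ≤ (‖∇ u (x - y)‖ * ‖y‖) * ‖y‖ ^ (-(3 + α)) := by
          gcongr; exact abs_real_inner_le_norm _ _
      _ = _ := by
          rw [show -(2 + α) = -(3 + α) + 1 by ring, Real.rpow_add_one hy'.ne']
          ring

theorem abs_setIntegral_far_le (h : Profile N u) (hα : 0 ≤ α) (hα1 : α < 1) (x : Plane)
    {L S : ℝ} (hL : 1 ≤ L) (hLS : L ≤ S) :
    |∫ y in {y : Plane | L ≤ ‖y‖ ∧ ‖y‖ < S}, contourKernel α u x y| ≤
      (2 * (8 * N ^ 3 + 1) * circleLen + N) / L := by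
  have hN := h.const_nonneg
  have hL0 : 0 < L := by linarith
  have hm : MeasurableSet {y : Plane | L ≤ ‖y‖ ∧ ‖y‖ < S} :=
    measurable_norm measurableSet_Ico
  have hsub : {y : Plane | L ≤ ‖y‖ ∧ ‖y‖ < S} ⊆ {y | ‖y‖ ≤ S} := fun y hy => hy.2.le
  have hKi := (h.integrableOn_contourKernel hα hα1 x (by linarith : 0 ≤ S)).mono_set hsub
  have hgc := h.continuous_grad
  have hoi : IntegrableOn (fun y : Plane => inner ℝ (∇ u x) y * ‖y‖ ^ (-(3 + α)))
      {y : Plane | L ≤ ‖y‖ ∧ ‖y‖ < S} := by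
    refine IntegrableOn.of_bound (C := N * S) ?_ ?_ ?_
    · refine (measure_mono hsub).trans_lt ?_
      have : {y : Plane | ‖y‖ ≤ S} = Metric.closedBall 0 S := by ext; simp
      rw [this]; exact measure_closedBall_lt_top
    · refine Measurable.aestronglyMeasurable (Measurable.mul (Continuous.measurable (by fun_prop))
        ((Continuous.measurable (by fun_prop)).pow_const _))
    · refine (ae_restrict_iff' hm).2 (.of_forall fun y hy => ?_)
      have hyL : 1 ≤ ‖y‖ := hL.trans hy.1
      rw [norm_mul, Real.norm_of_nonneg (by positivity : (0:ℝ) ≤ ‖y‖ ^ (-(3 + α)))]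
      have h1 : ‖y‖ ^ (-(3 + α)) ≤ 1 := Real.rpow_le_one_of_one_le_of_nonpos hyL (by linarith)
      calc _ ≤ (‖∇ u x‖ * ‖y‖) * 1 := by gcongr; exact abs_real_inner_le_norm _ _
        _ ≤ (N * S) * 1 := by gcongr; exacts [h.norm_grad_le x, hy.2.le]
        _ = _ := mul_one _
  have hodd := setIntegral_odd_eq_zero hm (fun y => by simp)
    (f := fun y : Plane => inner ℝ (∇ u x) y * ‖y‖ ^ (-(3 + α))) (fun y => by simp)
  have e : ∫ y in {y : Plane | L ≤ ‖y‖ ∧ ‖y‖ < S}, contourKernel α u x y =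
      ∫ y in {y : Plane | L ≤ ‖y‖ ∧ ‖y‖ < S},
        (contourKernel α u x y - inner ℝ (∇ u x) y * ‖y‖ ^ (-(3 + α))) := by
    rw [integral_sub hKi hoi, hodd, sub_zero]
  rw [e]
  have hfar := integral_norm_rpow_far (s := 4) (L := L / 2) (by norm_num) (by linarith)
  have hgi : Integrable fun y => ‖∇ u (x - y)‖ ^ 2 := h.integrable_grad_sq.comp_sub_left x
  have hsub2 : {y : Plane | L ≤ ‖y‖ ∧ ‖y‖ < S} ⊆ {y | L / 2 < ‖y‖} := fun y hy => by
    have := hy.1; simp only [Set.mem_ofPred_eq]; linarith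
  have hbi : IntegrableOn (fun y : Plane => (8 * N ^ 3 + L / 4) * ‖y‖ ^ (-4 : ℝ) +
      1 / L * ‖∇ u (x - y)‖ ^ 2) {y | L / 2 < ‖y‖} :=
    (hfar.1.const_mul _).add (hgi.integrableOn.const_mul _)
  calc _ ≤ ∫ y in {y : Plane | L ≤ ‖y‖ ∧ ‖y‖ < S},
        ((8 * N ^ 3 + L / 4) * ‖y‖ ^ (-4 : ℝ) + 1 / L * ‖∇ u (x - y)‖ ^ 2) := by
        rw [← Real.norm_eq_abs]
        refine norm_integral_le_of_norm_le (hbi.mono_set hsub2)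
          ((ae_restrict_iff' hm).2 (.of_forall fun y hy => ?_))
        have hyL : 1 ≤ ‖y‖ := hL.trans hy.1
        have hy0 : 0 < ‖y‖ := by linarith
        refine (h.abs_contourKernel_sub_odd_le hα hα1 x y (norm_pos_iff.1 hy0)).trans ?_
        have h1 : ‖y‖ ^ (-(4 + α)) ≤ ‖y‖ ^ (-4 : ℝ) :=
          Real.rpow_le_rpow_of_exponent_le hyL (by linarith)
        have h2 : ‖y‖ ^ (-(2 + α)) ≤ ‖y‖ ^ (-2 : ℝ) :=
          Real.rpow_le_rpow_of_exponent_le hyL (by linarith)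
        have h3 : ‖y‖ ^ (-4 : ℝ) = (‖y‖ ^ (-2 : ℝ)) ^ 2 := by
          rw [← Real.rpow_natCast, ← Real.rpow_mul hy0.le]; norm_num
        have h4 : ‖∇ u (x - y)‖ * ‖y‖ ^ (-2 : ℝ) ≤
            L / 4 * (‖y‖ ^ (-2 : ℝ)) ^ 2 + 1 / L * ‖∇ u (x - y)‖ ^ 2 := by
          have : 0 ≤ 1 / L * (‖∇ u (x - y)‖ - L / 2 * ‖y‖ ^ (-2 : ℝ)) ^ 2 := by positivity
          have e : 1 / L * (‖∇ u (x - y)‖ - L / 2 * ‖y‖ ^ (-2 : ℝ)) ^ 2 =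
            L / 4 * (‖y‖ ^ (-2 : ℝ)) ^ 2 + 1 / L * ‖∇ u (x - y)‖ ^ 2 -
              ‖∇ u (x - y)‖ * ‖y‖ ^ (-2 : ℝ) := by field_simp; ring
          linarith
        calc _ ≤ 8 * N ^ 3 * ‖y‖ ^ (-4 : ℝ) + ‖∇ u (x - y)‖ * ‖y‖ ^ (-2 : ℝ) := by gcongr
          _ ≤ _ := by rw [h3] at *; linarith
    _ ≤ ∫ y in {y : Plane | L / 2 < ‖y‖},
        ((8 * N ^ 3 + L / 4) * ‖y‖ ^ (-4 : ℝ) + 1 / L * ‖∇ u (x - y)‖ ^ 2) :=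
        setIntegral_mono_set hbi (.of_forall fun y => by positivity)
          (LE.le.eventuallyLE hsub2)
    _ ≤ (8 * N ^ 3 + L / 4) * (circleLen * ((L / 2) ^ (2 - 4 : ℝ) / (4 - 2))) + 1 / L * N := by
        rw [integral_add (hfar.1.const_mul _) (hgi.integrableOn.const_mul _), integral_const_mul,
          integral_const_mul, hfar.2]
        have : ∫ y in {y : Plane | L / 2 < ‖y‖}, ‖∇ u (x - y)‖ ^ 2 ≤ N := by
          refine (setIntegral_le_integral hgi (.of_forall fun y => by positivity)).trans ?_
          rw [integral_sub_left_eq_self (fun y => ‖∇ u y‖ ^ 2)]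
          exact h.integral_grad_sq_le
        gcongr
    _ ≤ _ := by
        have hc := circleLen_nonneg
        have e : (L / 2) ^ (2 - 4 : ℝ) = 4 / L ^ 2 := by
          rw [show (2 - 4 : ℝ) = -((2 : ℕ) : ℝ) by norm_num, Real.rpow_neg (by positivity),
            Real.rpow_natCast]
          field_simp; norm_num
        rw [e, ← sub_nonneg]
        have e2 : (2 * (8 * N ^ 3 + 1) * circleLen + N) / L - ((8 * N ^ 3 + L / 4) * (circleLen *
            (4 / L ^ 2 / (4 - 2))) + 1 / L * N) =
            circleLen * (16 * N ^ 3 * (L - 1) + 3 / 2 * L) / L ^ 2 := by field_simp; ring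
        rw [e2]
        have : 0 ≤ L - 1 := by linarith
        positivity

/-- The truncated integrals of the contour kernel converge to the principal value at a rate that
depends only on the profile constant. -/
theorem exists_pv_rate (N : ℝ) (hα : 0 ≤ α) (hα1 : α < 1) :
    ∃ C : ℝ, ∀ u, Profile N u → ∀ (x : Plane) (v : ℝ),
      HasPrincipalValue (contourKernel α u x) v → ∀ ε L : ℝ, 0 < ε → 1 ≤ L → ε ≤ L →
      |v - ∫ y in {y : Plane | ε < ‖y‖ ∧ ‖y‖ < L}, contourKernel α u x y| ≤
        C * (ε ^ (1 - α) + 1 / L) := by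
  refine ⟨max (N * circleLen / (1 - α)) (2 * (8 * N ^ 3 + 1) * circleLen + N),
    fun u h x v hv ε L hε hL hεL => ?_⟩
  set C := max (N * circleLen / (1 - α)) (2 * (8 * N ^ 3 + 1) * circleLen + N)
  have hlim := hv.2.sub_const (∫ y in {y : Plane | ε < ‖y‖ ∧ ‖y‖ < L}, contourKernel α u x y)
  refine le_of_tendsto hlim.abs ?_
  have hev : Set.Ioo 0 ε ×ˢ Set.Ioi L ∈ 𝓝[>] (0 : ℝ) ×ˢ (atTop : Filter ℝ) :=
    prod_mem_prod (Ioo_mem_nhdsGT hε) (Ioi_mem_atTop L)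
  filter_upwards [hev] with q hq
  obtain ⟨⟨hq0, hq1⟩, hq2 : L < q.2⟩ := hq
  have hKi := h.integrableOn_contourKernel hα hα1 x (by linarith : 0 ≤ q.2)
  have hm1 : MeasurableSet {y : Plane | ε < ‖y‖ ∧ ‖y‖ < L} :=
    measurable_norm measurableSet_Ioo
  have hm2 : MeasurableSet {y : Plane | L ≤ ‖y‖ ∧ ‖y‖ < q.2} :=
    measurable_norm measurableSet_Ico
  have e : {y : Plane | q.1 < ‖y‖ ∧ ‖y‖ < q.2} = {y : Plane | q.1 < ‖y‖ ∧ ‖y‖ ≤ ε ∧ ‖y‖ < L} ∪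
      {y : Plane | ε < ‖y‖ ∧ ‖y‖ < L} ∪ {y : Plane | L ≤ ‖y‖ ∧ ‖y‖ < q.2} := by
    ext y
    simp only [Set.mem_ofPred_eq, Set.mem_union]
    constructor
    · rintro ⟨h1, h2⟩
      rcases le_or_gt L ‖y‖ with h3 | h3
      · exact Or.inr ⟨h3, h2⟩
      · rcases le_or_gt ‖y‖ ε with h4 | h4
        · exact Or.inl (Or.inl ⟨h1, h4, h3⟩)
        · exact Or.inl (Or.inr ⟨h4, h3⟩)
    · rintro ((⟨h1, h2, h3⟩ | ⟨h1, h2⟩) | ⟨h1, h2⟩)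
      · exact ⟨h1, h3.trans hq2⟩
      · exact ⟨hq1.trans h1, h2.trans hq2⟩
      · exact ⟨by linarith, h2⟩
  rw [e, setIntegral_union ?_ hm2 ?_ ?_, setIntegral_union ?_ hm1 ?_ ?_]
  · rw [show ∀ a b c : ℝ, a + b + c - b = a + c by intros; ring]
    refine (abs_add_le _ _).trans ?_
    rw [mul_add]
    refine add_le_add ?_ ?_
    · refine (h.abs_setIntegral_near_le hα hα1 x hε.le (fun y hy => hy.2.1)).trans ?_
      gcongr
      exact le_max_left _ _
    · refine (h.abs_setIntegral_far_le hα hα1 x hL hq2.le).trans ?_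
      rw [div_eq_mul_one_div]
      gcongr
      exact le_max_right _ _
  · refine Set.disjoint_left.2 fun y hy hy' => ?_
    exact absurd hy.2.1 (not_le.2 hy'.1)
  · exact hKi.mono_set fun y hy => (hy.2.2.trans hq2).le
  · exact hKi.mono_set fun y hy => (hy.2.trans hq2).le
  · refine Set.disjoint_left.2 fun y hy hy' => ?_
    rcases hy with hy | hy
    · exact absurd hy.2.2 (not_lt.2 hy'.1)
    · exact absurd hy.2 (not_lt.2 hy'.1)
  · refine hKi.mono_set ?_
    rintro y (hy | hy)
    · exact (hy.2.2.trans hq2).le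
    · exact (hy.2.trans hq2).le
  · exact hKi.mono_set fun y hy => hy.2.le

end Profile

/-- The odd primitive of `(1 + t²)^{-p}`. -/
def slopePrimitive (p s : ℝ) : ℝ := ∫ t in (0:ℝ)..s, (1 + t ^ 2) ^ (-p)

theorem continuous_slope (p : ℝ) : Continuous fun t : ℝ => (1 + t ^ 2) ^ (-p) := by
  refine Continuous.rpow_const (by fun_prop) fun t => Or.inl ?_
  positivity

theorem hasDerivAt_slopePrimitive (p s : ℝ) :
    HasDerivAt (slopePrimitive p) ((1 + s ^ 2) ^ (-p)) s :=
  intervalIntegral.integral_hasDerivAt_right ((continuous_slope p).intervalIntegrable _ _)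
    ((continuous_slope p).stronglyMeasurableAtFilter _ _) (continuous_slope p).continuousAt

theorem continuous_slopePrimitive (p : ℝ) : Continuous (slopePrimitive p) :=
  continuous_iff_continuousAt.2 fun s => (hasDerivAt_slopePrimitive p s).continuousAt

theorem slope_le_one {p : ℝ} (hp : 0 ≤ p) (t : ℝ) : (1 + t ^ 2) ^ (-p) ≤ 1 :=
  Real.rpow_le_one_of_one_le_of_nonpos (by nlinarith [sq_nonneg t]) (by linarith)

theorem slopePrimitive_neg (p s : ℝ) : slopePrimitive p (-s) = -slopePrimitive p s := by
  have h := intervalIntegral.integral_comp_neg (a := 0) (b := s) fun t : ℝ => (1 + t ^ 2) ^ (-p)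
  simp only [even_two.neg_pow, neg_zero] at h
  rw [slopePrimitive, slopePrimitive, h, intervalIntegral.integral_symm]

theorem slopePrimitive_nonneg (p : ℝ) {s : ℝ} (hs : 0 ≤ s) : 0 ≤ slopePrimitive p s :=
  intervalIntegral.integral_nonneg hs fun t _ => by positivity

theorem slopePrimitive_le {p : ℝ} (hp : 0 ≤ p) {s : ℝ} (hs : 0 ≤ s) : slopePrimitive p s ≤ s := by
  calc slopePrimitive p s ≤ ∫ _ in (0:ℝ)..s, (1:ℝ) :=
        intervalIntegral.integral_mono_on hs ((continuous_slope p).intervalIntegrable _ _)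
          (by simp) fun t _ => slope_le_one hp t
    _ = s := by simp

theorem sub_slopePrimitive_le {p : ℝ} (hp2 : p ≤ 2) {s : ℝ} (hs : 0 ≤ s) :
    s - slopePrimitive p s ≤ s ^ 2 := by
  have e : s - slopePrimitive p s = ∫ t in (0:ℝ)..s, (1 - (1 + t ^ 2) ^ (-p)) := by
    rw [intervalIntegral.integral_sub (by simp) ((continuous_slope p).intervalIntegrable _ _)]
    simp [slopePrimitive]
  have e2 : s ^ 2 = ∫ t in (0:ℝ)..s, 2 * t := by
    rw [intervalIntegral.integral_const_mul, integral_id]; ring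
  rw [e, e2]
  refine intervalIntegral.integral_mono_on hs
    ((continuous_const.sub (continuous_slope p)).intervalIntegrable _ _)
    ((by fun_prop : Continuous fun t : ℝ => 2 * t).intervalIntegrable _ _) fun t ht => ?_
  have h := rpow_neg_sub_le (A := 1) (B := t ^ 2) one_pos (sq_nonneg t) hp2
  have h2 : 0 ≤ (1 + t ^ 2) ^ (-p) := by positivity
  simp only [Real.one_rpow, mul_one] at h
  rcases le_total t 1 with h1 | h1 <;> nlinarith [ht.1]

theorem abs_slopePrimitive_le {p : ℝ} (hp : 0 ≤ p) (s : ℝ) : |slopePrimitive p s| ≤ |s| := by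
  rcases le_total 0 s with hs | hs
  · rw [abs_of_nonneg hs, abs_of_nonneg (slopePrimitive_nonneg p hs)]
    exact slopePrimitive_le hp hs
  · have hs' : 0 ≤ -s := by linarith
    have h := slopePrimitive_le hp hs'
    have h2 := slopePrimitive_nonneg p hs'
    rw [slopePrimitive_neg] at h h2
    rw [abs_of_nonpos hs, abs_of_nonpos (by linarith)]
    exact h

theorem abs_slopePrimitive_sub_le {p : ℝ} (hp : 0 ≤ p) (hp2 : p ≤ 2) (s : ℝ) :
    |slopePrimitive p s - s| ≤ s ^ 2 := by
  have key : ∀ s : ℝ, 0 ≤ s → |slopePrimitive p s - s| ≤ s ^ 2 := fun s hs => by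
    rw [abs_sub_comm, abs_of_nonneg (sub_nonneg.2 (slopePrimitive_le hp hs))]
    exact sub_slopePrimitive_le hp2 hs
  rcases le_total 0 s with hs | hs
  · exact key s hs
  · have h := key (-s) (by linarith)
    rw [slopePrimitive_neg] at h
    rwa [show -slopePrimitive p s - -s = -(slopePrimitive p s - s) by ring, abs_neg,
      neg_sq] at h

/-- Integration by parts against a radial multiple of the position field. -/
theorem integral_radial_inner_gradient {ψ ψ' : ℝ → ℝ} {g : Plane → ℝ} {g' : Plane → Plane}
    (hψ : ∀ t, 0 ≤ t → HasDerivAt ψ (ψ' t) t) (hψ' : ContinuousOn ψ' (Set.Ici 0))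
    (hg : ∀ y, HasGradientAt g (g' y) y) (hg' : Continuous g') {b : Plane → ℝ}
    (hb : Integrable b) (h1 : ∀ y, |ψ (‖y‖ ^ 2) * g y| ≤ b y)
    (h2 : ∀ y, |ψ' (‖y‖ ^ 2) * ‖y‖ ^ 2 * g y| ≤ b y)
    (h3 : ∀ y, |ψ (‖y‖ ^ 2)| * ‖y‖ * ‖g' y‖ ≤ b y)
    (h4 : ∀ y, |ψ (‖y‖ ^ 2)| * ‖y‖ * |g y| ≤ b y) :
    Integrable (fun y => ψ (‖y‖ ^ 2) * inner ℝ (g' y) y) ∧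
    Integrable (fun y => (ψ (‖y‖ ^ 2) + ψ' (‖y‖ ^ 2) * ‖y‖ ^ 2) * g y) ∧
    ∫ y, ψ (‖y‖ ^ 2) * inner ℝ (g' y) y =
      -(2 * ∫ y, (ψ (‖y‖ ^ 2) + ψ' (‖y‖ ^ 2) * ‖y‖ ^ 2) * g y) := by
  have hψc : Continuous fun y : Plane => ψ (‖y‖ ^ 2) := continuous_iff_continuousAt.2 fun y =>
    ContinuousAt.comp (g := ψ) (hψ _ (by positivity)).continuousAt
      (by fun_prop : Continuous fun y : Plane => ‖y‖ ^ 2).continuousAt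
  have hψ'c : Continuous fun y : Plane => ψ' (‖y‖ ^ 2) :=
    hψ'.comp_continuous (by fun_prop) fun y => by simp
  have hgc : Continuous g := continuous_iff_continuousAt.2 fun x => (hg x).continuousAt
  have hφ : ∀ y, HasFDerivAt (fun y : Plane => ψ (‖y‖ ^ 2))
      ((ψ' (‖y‖ ^ 2)) • (2 • innerSL ℝ y)) y := fun y =>
    (hψ _ (by positivity)).comp_hasFDerivAt y (hasStrictFDerivAt_norm_sq y).hasFDerivAt
  have hcoord : ∀ j : Fin 2,
      Integrable (fun y => ψ (‖y‖ ^ 2) * (y j * g' y j)) ∧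
      Integrable (fun y => (ψ (‖y‖ ^ 2) + 2 * ψ' (‖y‖ ^ 2) * y j ^ 2) * g y) ∧
      ∫ y, ψ (‖y‖ ^ 2) * (y j * g' y j) =
        -∫ y, (ψ (‖y‖ ^ 2) + 2 * ψ' (‖y‖ ^ 2) * y j ^ 2) * g y := by
    intro j
    have hjc : Continuous fun y : Plane => y j := by fun_prop
    have hgjc : Continuous fun y : Plane => g' y j := by fun_prop
    have hyj : ∀ y : Plane, |y j| ≤ ‖y‖ := fun y => by
      simpa using PiLp.norm_apply_le y j
    set e : Plane := EuclideanSpace.single j 1 with he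
    have hgj : ∀ y, InnerProductSpace.toDual ℝ Plane (g' y) e = g' y j := fun y => by
      rw [InnerProductSpace.toDual_apply_apply, he, EuclideanSpace.inner_single_right]; simp
    have hX : ∀ y, HasFDerivAt (fun y : Plane => y j * ψ (‖y‖ ^ 2))
        (y j • ((ψ' (‖y‖ ^ 2)) • (2 • innerSL ℝ y)) +
          ψ (‖y‖ ^ 2) • (EuclideanSpace.proj j : Plane →L[ℝ] ℝ)) y := fun y =>
      ((EuclideanSpace.proj j : Plane →L[ℝ] ℝ).hasFDerivAt).mul (hφ y)
    have hXe : ∀ y : Plane, (y j • ((ψ' (‖y‖ ^ 2)) • (2 • innerSL ℝ y)) +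
          ψ (‖y‖ ^ 2) • (EuclideanSpace.proj j : Plane →L[ℝ] ℝ)) e =
        ψ (‖y‖ ^ 2) + 2 * ψ' (‖y‖ ^ 2) * y j ^ 2 := fun y => by
      simp [he, EuclideanSpace.inner_single_right]
      ring
    have i1 : Integrable (fun y => (ψ (‖y‖ ^ 2) + 2 * ψ' (‖y‖ ^ 2) * y j ^ 2) * g y) := by
      refine (hb.const_mul 3).mono' (Continuous.aestronglyMeasurable
        ((hψc.add ((continuous_const.mul hψ'c).mul (hjc.pow 2))).mul hgc)) (.of_forall fun y => ?_)
      have hle : |ψ' (‖y‖ ^ 2) * y j ^ 2 * g y| ≤ b y := by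
        refine le_trans ?_ (h2 y)
        rw [abs_mul, abs_mul, abs_mul, abs_mul, abs_of_nonneg (sq_nonneg (y j)),
          abs_of_nonneg (sq_nonneg ‖y‖), ← sq_abs (y j)]
        gcongr
        exact hyj y
      have e3 : (ψ (‖y‖ ^ 2) + 2 * ψ' (‖y‖ ^ 2) * y j ^ 2) * g y =
        ψ (‖y‖ ^ 2) * g y + 2 * (ψ' (‖y‖ ^ 2) * y j ^ 2 * g y) := by ring
      rw [e3, Real.norm_eq_abs]
      refine (abs_add_le _ _).trans ?_
      rw [abs_mul (2:ℝ), abs_two]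
      linarith [h1 y]
    have i2 : Integrable (fun y => ψ (‖y‖ ^ 2) * (y j * g' y j)) := by
      refine hb.mono' (Continuous.aestronglyMeasurable (hψc.mul (hjc.mul hgjc)))
        (.of_forall fun y => ?_)
      refine le_trans ?_ (h3 y)
      rw [Real.norm_eq_abs, abs_mul, abs_mul, mul_assoc]
      gcongr
      · exact hyj y
      · simpa using PiLp.norm_apply_le (g' y) j
    have i3 : Integrable (fun y : Plane => y j * ψ (‖y‖ ^ 2) * g y) := by
      refine hb.mono' (Continuous.aestronglyMeasurable ((hjc.mul hψc).mul hgc))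
        (.of_forall fun y => ?_)
      refine le_trans ?_ (h4 y)
      rw [Real.norm_eq_abs, abs_mul, abs_mul, mul_comm |y j|]
      gcongr
      exact hyj y
    have hibp := integral_bilinear_hasFDerivAt_right_eq_neg_left_of_integrable
      (μ := (volume : Measure Plane)) (B := ContinuousLinearMap.mul ℝ ℝ) (v := e)
      (f := fun y : Plane => y j * ψ (‖y‖ ^ 2)) (g := g)
      (g' := fun y => InnerProductSpace.toDual ℝ Plane (g' y))
      (by
        refine i1.congr (.of_forall fun y => ?_)
        simp only [ContinuousLinearMap.mul_apply']
        rw [hXe])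
      (by
        refine i2.congr (.of_forall fun y => ?_)
        simp only [ContinuousLinearMap.mul_apply']
        rw [hgj]; ring)
      (by simpa using i3)
      (fun y _ => hX y) (fun y _ => (hg y).hasFDerivAt)
    refine ⟨i2, i1, ?_⟩
    refine Eq.trans (integral_congr_ae (.of_forall fun y => ?_)) (hibp.trans
      (congrArg Neg.neg (integral_congr_ae (.of_forall fun y => ?_))))
    · simp only [ContinuousLinearMap.mul_apply']
      rw [hgj]; ring
    · simp only [ContinuousLinearMap.mul_apply']
      rw [hXe]
  have hn : ∀ y : Plane, ‖y‖ ^ 2 = y 0 ^ 2 + y 1 ^ 2 := fun y => by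
    rw [EuclideanSpace.norm_sq_eq]; simp [Fin.sum_univ_two]
  have hin : ∀ y : Plane, ψ (‖y‖ ^ 2) * inner ℝ (g' y) y =
      ψ (‖y‖ ^ 2) * (y 0 * g' y 0) + ψ (‖y‖ ^ 2) * (y 1 * g' y 1) := fun y => by
    rw [PiLp.inner_apply, Fin.sum_univ_two]
    simp
    ring
  have hd : ∀ y : Plane, (ψ (‖y‖ ^ 2) + ψ' (‖y‖ ^ 2) * ‖y‖ ^ 2) * g y =
      2⁻¹ * ((ψ (‖y‖ ^ 2) + 2 * ψ' (‖y‖ ^ 2) * y 0 ^ 2) * g y +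
        (ψ (‖y‖ ^ 2) + 2 * ψ' (‖y‖ ^ 2) * y 1 ^ 2) * g y) := fun y => by
    have := hn y
    calc _ = ψ (‖y‖ ^ 2) * g y + ψ' (‖y‖ ^ 2) * (‖y‖ ^ 2) * g y := by ring
      _ = ψ (‖y‖ ^ 2) * g y + ψ' (‖y‖ ^ 2) * (y 0 ^ 2 + y 1 ^ 2) * g y := by
          congr 2; rw [← this]
      _ = _ := by ring
  obtain ⟨a1, a2, a3⟩ := hcoord 0
  obtain ⟨b1, b2, b3⟩ := hcoord 1
  simp_rw [hin]
  simp_rw [hd]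
  refine ⟨a1.add b1, (a2.add b2).const_mul _, ?_⟩
  rw [integral_add a1 b1, integral_const_mul, integral_add a2 b2, a3, b3]
  ring

namespace Profile

variable {N α : ℝ} {u : Plane → ℝ} {x : Plane}

theorem grad_eq_zero (h : Profile N u) (hmax : ∀ z, u z ≤ u x) : ∇ u x = 0 := by
  have h1 : IsLocalMax u x := .of_forall hmax
  have h2 := h1.hasFDerivAt_eq_zero (h.hasGradientAt x).hasFDerivAt
  exact (map_eq_zero_iff _ (InnerProductSpace.toDual ℝ Plane).injective).1 h2

theorem hasGradientAt_gap (h : Profile N u) (x y : Plane) :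
    HasGradientAt (fun y => u x - u (x - y)) (∇ u (x - y)) y := by
  rw [hasGradientAt_iff_hasFDerivAt]
  have h1 := ((h.hasGradientAt (x - y)).hasFDerivAt.comp y
    ((hasFDerivAt_const x y).sub (hasFDerivAt_id y))).const_sub (u x)
  refine h1.congr_fderiv ?_
  ext v
  simp

theorem norm_grad_le_of_max (h : Profile N u) (hmax : ∀ z, u z ≤ u x) (y : Plane) :
    ‖∇ u (x - y)‖ ≤ N * ‖y‖ := by
  have := h.grad_lipschitz (x - y) x
  rw [h.grad_eq_zero hmax] at this
  simpa using this

theorem gap_le (h : Profile N u) (y : Plane) : u x - u (x - y) ≤ 2 * N := by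
  have h1 := _root_.abs_le.1 (h.abs_le x)
  have h2 := _root_.abs_le.1 (h.abs_le (x - y))
  linarith

theorem gap_le_sq (h : Profile N u) (hmax : ∀ z, u z ≤ u x) (y : Plane) :
    u x - u (x - y) ≤ N * ‖y‖ ^ 2 := by
  have hN := h.const_nonneg
  have h1 := (convex_closedBall (0 : Plane) ‖y‖).norm_image_sub_le_of_norm_hasFDerivWithin_le
    (f := fun y => u x - u (x - y)) (C := N * ‖y‖)
    (fun z _ => (h.hasGradientAt_gap x z).hasFDerivAt.hasFDerivWithinAt)
    (fun z hz => by
      rw [LinearIsometryEquiv.norm_map]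
      refine (h.norm_grad_le_of_max hmax z).trans ?_
      have : ‖z‖ ≤ ‖y‖ := by simpa using hz
      gcongr) (x := 0) (y := y) (by simp) (by simp)
  simp only [sub_zero, sub_self] at h1
  have h2 := le_of_abs_le h1
  nlinarith

/-- The function dominating all integrands at a maximum point is integrable. -/
theorem integrable_dominating (h : Profile N u) (hα : 0 ≤ α) (hα1 : α < 1)
    (hmax : ∀ z, u z ≤ u x) :
    Integrable fun y => ‖∇ u (x - y)‖ * ‖y‖ ^ (-(2 + α)) +
      (u x - u (x - y)) * ‖y‖ ^ (-(3 + α)) := by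
  have hN := h.const_nonneg
  have hu := h.continuous
  have hg := h.continuous_grad
  have hm : AEStronglyMeasurable (fun y => ‖∇ u (x - y)‖ * ‖y‖ ^ (-(2 + α)) +
      (u x - u (x - y)) * ‖y‖ ^ (-(3 + α))) volume := by
    refine Measurable.aestronglyMeasurable (Measurable.add (Measurable.mul
      (Continuous.measurable (by fun_prop)) (measurable_norm.pow_const _)) (Measurable.mul
      (Continuous.measurable (by fun_prop)) (measurable_norm.pow_const _)))
  have h0 : ∀ y, 0 ≤ ‖∇ u (x - y)‖ * ‖y‖ ^ (-(2 + α)) +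
      (u x - u (x - y)) * ‖y‖ ^ (-(3 + α)) := fun y => by
    have := sub_nonneg.2 (hmax (x - y)); positivity
  have hm1 : MeasurableSet {y : Plane | ‖y‖ ≤ 1} := measurable_norm measurableSet_Iic
  have hm2 : MeasurableSet {y : Plane | 1 < ‖y‖} := measurable_norm measurableSet_Ioi
  rw [← integrableOn_univ, show (Set.univ : Set Plane) = {y | ‖y‖ ≤ 1} ∪ {y | 1 < ‖y‖} by
    ext y; simp [le_or_gt]]
  refine IntegrableOn.union ?_ ?_
  · have hI := (integral_norm_rpow_le (s := 1 + α) (r := 1) (by linarith) zero_le_one).1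
    refine (hI.const_mul (2 * N)).mono' hm.restrict ((ae_restrict_iff' hm1).2
      (.of_forall fun y _ => ?_))
    rw [Real.norm_of_nonneg (h0 y)]
    rcases eq_or_ne y 0 with rfl | hy
    · have e1 := h.grad_eq_zero hmax
      simp only [sub_zero, e1, norm_zero, zero_mul, sub_self, add_zero]
      positivity
    have hy' : 0 < ‖y‖ := norm_pos_iff.2 hy
    have e1 : ‖y‖ ^ (-(1 + α)) = ‖y‖ ^ (-(2 + α)) * ‖y‖ := by
      rw [← Real.rpow_add_one hy'.ne']; ring_nf
    have e2 : ‖y‖ ^ (-(2 + α)) = ‖y‖ ^ (-(3 + α)) * ‖y‖ := by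
      rw [← Real.rpow_add_one hy'.ne']; ring_nf
    calc _ ≤ N * ‖y‖ * ‖y‖ ^ (-(2 + α)) + N * ‖y‖ ^ 2 * ‖y‖ ^ (-(3 + α)) := by
          gcongr
          · exact h.norm_grad_le_of_max hmax y
          · exact h.gap_le_sq hmax y
      _ = _ := by rw [e1, e2]; ring
  · have hI4 := (integral_norm_rpow_far (s := 4) (L := 1) (by norm_num) one_pos).1
    have hI3 := (integral_norm_rpow_far (s := 3) (L := 1) (by norm_num) one_pos).1
    have hgi : Integrable fun y => ‖∇ u (x - y)‖ ^ 2 := h.integrable_grad_sq.comp_sub_left x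
    refine ((hgi.integrableOn.add hI4).add (hI3.const_mul (2 * N))).mono' hm.restrict
      ((ae_restrict_iff' hm2).2 (.of_forall fun y hy => ?_))
    have hy1 : 1 ≤ ‖y‖ := (show 1 < ‖y‖ from hy).le
    have hy0 : 0 < ‖y‖ := by linarith
    rw [Real.norm_of_nonneg (h0 y)]
    have h2 : ‖y‖ ^ (-(2 + α)) ≤ ‖y‖ ^ (-2 : ℝ) :=
      Real.rpow_le_rpow_of_exponent_le hy1 (by linarith)
    have h3 : ‖y‖ ^ (-(3 + α)) ≤ ‖y‖ ^ (-3 : ℝ) :=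
      Real.rpow_le_rpow_of_exponent_le hy1 (by linarith)
    have h4 : ‖y‖ ^ (-4 : ℝ) = (‖y‖ ^ (-2 : ℝ)) ^ 2 := by
      rw [← Real.rpow_natCast, ← Real.rpow_mul hy0.le]; norm_num
    have h5 := h.gap_le (x := x) y
    simp only [Pi.add_apply]
    calc _ ≤ ‖∇ u (x - y)‖ * ‖y‖ ^ (-2 : ℝ) + 2 * N * ‖y‖ ^ (-3 : ℝ) := by gcongr
      _ ≤ _ := by
        rw [h4]
        have := sq_nonneg (‖∇ u (x - y)‖ - ‖y‖ ^ (-2 : ℝ))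
        have p1 : 0 ≤ ‖∇ u (x - y)‖ * ‖y‖ ^ (-2 : ℝ) := by positivity
        nlinarith

/-- The integrand of the regularized inequality at a maximum point. -/
def regularized (α : ℝ) (u : Plane → ℝ) (x : Plane) (η : ℝ) (y : Plane) : ℝ :=
  (1 + ‖y‖ ^ 2) ^ (-η) * ((‖y‖ ^ 2 + η ^ 2) + (u x - u (x - y)) ^ 2) ^ (-((3 + α) / 2)) *
      (inner ℝ (∇ u (x - y)) y - (u x - u (x - y)) * (‖y‖ ^ 2 / (‖y‖ ^ 2 + η ^ 2))) +
    2 * (η ^ 2 * (‖y‖ ^ 2 + η ^ 2) ^ (-((5 + α) / 2)) * (u x - u (x - y)))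

theorem abs_regularized_le (hα : 0 ≤ α) (hmax : ∀ z, u z ≤ u x)
    {η : ℝ} (hη : 0 < η) {y : Plane} (hy : y ≠ 0) :
    |regularized α u x η y| ≤ 3 * (‖∇ u (x - y)‖ * ‖y‖ ^ (-(2 + α)) +
      (u x - u (x - y)) * ‖y‖ ^ (-(3 + α))) := by
  have hy' : 0 < ‖y‖ := norm_pos_iff.2 hy
  have hδ : 0 ≤ u x - u (x - y) := sub_nonneg.2 (hmax _)
  set δ := u x - u (x - y) with hδd
  set r := ‖y‖ ^ 2 + η ^ 2 with hr
  have hr0 : 0 < r := by positivity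
  have hyr : ‖y‖ ^ 2 ≤ r := by rw [hr]; nlinarith
  have e2 : ∀ q : ℝ, (‖y‖ ^ 2) ^ q = ‖y‖ ^ (2 * q) := fun q => by
    rw [Real.rpow_mul hy'.le]; norm_num
  have hE : (r + δ ^ 2) ^ (-((3 + α) / 2)) ≤ ‖y‖ ^ (-(3 + α)) := by
    calc _ ≤ (‖y‖ ^ 2) ^ (-((3 + α) / 2)) :=
          Real.rpow_le_rpow_of_nonpos (by positivity) (by nlinarith [sq_nonneg δ]) (by linarith)
      _ = _ := by rw [e2]; ring_nf
  have hE0 : 0 ≤ (r + δ ^ 2) ^ (-((3 + α) / 2)) := by positivity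
  have hw : (1 + ‖y‖ ^ 2) ^ (-η) ≤ 1 :=
    Real.rpow_le_one_of_one_le_of_nonpos (by nlinarith [sq_nonneg ‖y‖]) (by linarith)
  have hw0 : 0 ≤ (1 + ‖y‖ ^ 2) ^ (-η) := by positivity
  have hq : ‖y‖ ^ 2 / r ≤ 1 := (div_le_one hr0).2 hyr
  have hq0 : 0 ≤ ‖y‖ ^ 2 / r := by positivity
  have hR : η ^ 2 * r ^ (-((5 + α) / 2)) ≤ ‖y‖ ^ (-(3 + α)) := by
    calc η ^ 2 * r ^ (-((5 + α) / 2)) ≤ r * r ^ (-((5 + α) / 2)) := by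
          gcongr; rw [hr]; nlinarith [sq_nonneg ‖y‖]
      _ = r ^ (-((3 + α) / 2)) := by
          rw [mul_comm, ← Real.rpow_add_one hr0.ne']; ring_nf
      _ ≤ (‖y‖ ^ 2) ^ (-((3 + α) / 2)) :=
          Real.rpow_le_rpow_of_nonpos (by positivity) hyr (by linarith)
      _ = _ := by rw [e2]; ring_nf
  have hin : |inner ℝ (∇ u (x - y)) y - δ * (‖y‖ ^ 2 / r)| ≤ ‖∇ u (x - y)‖ * ‖y‖ + δ := by
    refine (abs_sub _ _).trans (add_le_add (abs_real_inner_le_norm _ _) ?_)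
    rw [abs_of_nonneg (by positivity)]
    exact mul_le_of_le_one_right hδ hq
  have e3 : ‖y‖ ^ (-(2 + α)) = ‖y‖ ^ (-(3 + α)) * ‖y‖ := by
    rw [← Real.rpow_add_one hy'.ne']; ring_nf
  rw [regularized, ← hδd, ← hr]
  refine (abs_add_le _ _).trans ?_
  rw [abs_mul, abs_of_nonneg (mul_nonneg hw0 hE0), abs_of_nonneg (a := 2 * _) (by positivity)]
  calc _ ≤ 1 * ‖y‖ ^ (-(3 + α)) * (‖∇ u (x - y)‖ * ‖y‖ + δ) + 2 * (‖y‖ ^ (-(3 + α)) * δ) := by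
        gcongr
    _ ≤ _ := by
        rw [e3]
        have p1 : 0 ≤ ‖∇ u (x - y)‖ * (‖y‖ ^ (-(3 + α)) * ‖y‖) := by positivity
        nlinarith

theorem tendsto_regularized {y : Plane} (hy : y ≠ 0) {η : ℕ → ℝ} (hη : Tendsto η atTop (𝓝 0)) :
    Tendsto (fun n => regularized α u x (η n) y) atTop
      (𝓝 ((‖y‖ ^ 2 + (u x - u (x - y)) ^ 2) ^ (-((3 + α) / 2)) *
        (inner ℝ (∇ u (x - y)) y - (u x - u (x - y))))) := by
  have hy' : 0 < ‖y‖ := norm_pos_iff.2 hy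
  have hc : ContinuousAt (fun t : ℝ => regularized α u x t y) 0 := by
    unfold regularized
    refine ContinuousAt.add (ContinuousAt.mul (ContinuousAt.mul ?_ ?_) ?_) ?_
    · exact ContinuousAt.rpow continuousAt_const continuousAt_id.neg
        (Or.inl (by positivity))
    · exact ContinuousAt.rpow (by fun_prop) continuousAt_const (Or.inl (by positivity))
    · refine continuousAt_const.sub (continuousAt_const.mul (ContinuousAt.div continuousAt_const
        (by fun_prop) (by positivity)))
    · refine continuousAt_const.mul (ContinuousAt.mul (ContinuousAt.mul (by fun_prop) ?_)
        continuousAt_const)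
      exact ContinuousAt.rpow (by fun_prop) continuousAt_const (Or.inl (by positivity))
  have h := hc.tendsto.comp hη
  have e : regularized α u x 0 y = (‖y‖ ^ 2 + (u x - u (x - y)) ^ 2) ^ (-((3 + α) / 2)) *
        (inner ℝ (∇ u (x - y)) y - (u x - u (x - y))) := by
    have : ‖y‖ ^ 2 / ‖y‖ ^ 2 = 1 := div_self (by positivity)
    simp [regularized, this]
  rw [e] at h
  exact h

end Profile

/-- The radial weight `(t + η²)^{-a} (1 + t)^{-η}` in the variable `t = |y|²`. -/
def radialWeight (a η t : ℝ) : ℝ := (t + η ^ 2) ^ (-a) * (1 + t) ^ (-η)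

/-- The derivative of `radialWeight`. -/
def radialWeightDeriv (a η t : ℝ) : ℝ :=
  (-a * (t + η ^ 2) ^ (-a - 1)) * (1 + t) ^ (-η) +
    (t + η ^ 2) ^ (-a) * (-η * (1 + t) ^ (-η - 1))

theorem hasDerivAt_radialWeight (a : ℝ) {η t : ℝ} (hη : 0 < η) (ht : 0 ≤ t) :
    HasDerivAt (radialWeight a η) (radialWeightDeriv a η t) t := by
  have h1 : HasDerivAt (fun t : ℝ => (t + η ^ 2) ^ (-a)) (-a * (t + η ^ 2) ^ (-a - 1)) t := by
    simpa using ((hasDerivAt_id t).add_const (η ^ 2)).rpow_const (p := -a)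
      (Or.inl (by simp only [id]; positivity))
  have h2 : HasDerivAt (fun t : ℝ => (1 + t) ^ (-η)) (-η * (1 + t) ^ (-η - 1)) t := by
    simpa using ((hasDerivAt_id t).const_add 1).rpow_const (p := -η)
      (Or.inl (by simp only [id]; positivity))
  exact h1.mul h2

theorem continuousOn_radialWeightDeriv (a : ℝ) {η : ℝ} (hη : 0 < η) :
    ContinuousOn (radialWeightDeriv a η) (Set.Ici 0) := by
  unfold radialWeightDeriv
  intro t ht
  have ht' : (0:ℝ) ≤ t := ht
  have h1 : t + η ^ 2 ≠ 0 := by positivity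
  have h2 : 1 + t ≠ 0 := by positivity
  refine ContinuousAt.continuousWithinAt ?_
  refine ContinuousAt.add (ContinuousAt.mul (continuousAt_const.mul ?_) ?_)
    (ContinuousAt.mul ?_ (continuousAt_const.mul ?_))
  all_goals exact ContinuousAt.rpow_const (by fun_prop) (Or.inl (by assumption))

theorem radialWeight_nonneg (a η : ℝ) {t : ℝ} (ht : 0 ≤ t) : 0 ≤ radialWeight a η t := by
  unfold radialWeight; positivity

theorem radialWeight_add_deriv_le {a η t : ℝ} (ha : 1 ≤ a) (hη : 0 < η) (ht : 0 ≤ t) :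
    radialWeight a η t + radialWeightDeriv a η t * t ≤ η ^ 2 * (t + η ^ 2) ^ (-a - 1) := by
  have hr : 0 < t + η ^ 2 := by positivity
  have hw1 : (1 + t) ^ (-η) ≤ 1 := Real.rpow_le_one_of_one_le_of_nonpos (by linarith) (by linarith)
  have hw0 : 0 ≤ (1 + t) ^ (-η) := by positivity
  have e : (t + η ^ 2) ^ (-a) = (t + η ^ 2) ^ (-a - 1) * (t + η ^ 2) := by
    rw [← Real.rpow_add_one hr.ne']; ring_nf
  have hR : 0 ≤ (t + η ^ 2) ^ (-a - 1) := by positivity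
  have hneg : 0 ≤ (t + η ^ 2) ^ (-a) * (η * (1 + t) ^ (-η - 1)) * t := by positivity
  have e2 : radialWeight a η t + radialWeightDeriv a η t * t =
      (t + η ^ 2) ^ (-a - 1) * (1 + t) ^ (-η) * (η ^ 2 - (a - 1) * t) -
        (t + η ^ 2) ^ (-a) * (η * (1 + t) ^ (-η - 1)) * t := by
    unfold radialWeight radialWeightDeriv
    rw [e]; ring
  have h3 : η ^ 2 - (a - 1) * t ≤ η ^ 2 := by nlinarith
  rw [e2]
  calc _ ≤ (t + η ^ 2) ^ (-a - 1) * (1 + t) ^ (-η) * (η ^ 2 - (a - 1) * t) := by linarith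
    _ ≤ (t + η ^ 2) ^ (-a - 1) * (1 + t) ^ (-η) * η ^ 2 := by gcongr
    _ ≤ (t + η ^ 2) ^ (-a - 1) * 1 * η ^ 2 := by gcongr
    _ = _ := by ring

theorem abs_radialWeightDeriv_mul_le {a η t : ℝ} (ha : 0 ≤ a) (hη : 0 < η) (ht : 0 ≤ t) :
    |radialWeightDeriv a η t * t| ≤ (a + η) * radialWeight a η t := by
  have hr : 0 < t + η ^ 2 := by positivity
  have hs : 0 < 1 + t := by positivity
  have e : (t + η ^ 2) ^ (-a) = (t + η ^ 2) ^ (-a - 1) * (t + η ^ 2) := by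
    rw [← Real.rpow_add_one hr.ne']; ring_nf
  have e' : (1 + t) ^ (-η) = (1 + t) ^ (-η - 1) * (1 + t) := by
    rw [← Real.rpow_add_one hs.ne']; ring_nf
  have hA : 0 ≤ (t + η ^ 2) ^ (-a - 1) := by positivity
  have hB : 0 ≤ (1 + t) ^ (-η - 1) := by positivity
  unfold radialWeightDeriv radialWeight
  rw [e, e']
  set A := (t + η ^ 2) ^ (-a - 1)
  set B := (1 + t) ^ (-η - 1)
  rw [show (-a * A * (B * (1 + t)) + A * (t + η ^ 2) * (-η * B)) * t =
    -((a * (A * B) * (1 + t) + η * (A * B) * (t + η ^ 2)) * t) by ring, abs_neg,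
    abs_of_nonneg (by positivity)]
  have hAB : 0 ≤ A * B := by positivity
  have p1 : 0 ≤ a * (A * B) * ((1 + t) * η ^ 2) := by positivity
  have p2 : 0 ≤ η * (A * B) * (t + η ^ 2) := by positivity
  nlinarith

theorem radialWeight_le {a η t : ℝ} (ha : 0 ≤ a) (hη : 0 < η) (hη1 : η ≤ 1) (ht : 0 ≤ t) :
    radialWeight a η t ≤ (η ^ 2) ^ (-a) * (1 + t) ^ (-(2 * (a + η)) / 2) := by
  have hs : 0 < 1 + t := by positivity
  have h1 : η ^ 2 * (1 + t) ≤ t + η ^ 2 := by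
    have : η ^ 2 ≤ 1 := by nlinarith
    nlinarith
  have h2 : (t + η ^ 2) ^ (-a) ≤ (η ^ 2 * (1 + t)) ^ (-a) :=
    Real.rpow_le_rpow_of_nonpos (by positivity) h1 (by linarith)
  rw [Real.mul_rpow (by positivity) hs.le] at h2
  rw [show -(2 * (a + η)) / 2 = -a + -η by ring, Real.rpow_add hs, radialWeight, ← mul_assoc]
  gcongr

namespace Profile

variable {N α : ℝ} {u : Plane → ℝ} {x : Plane}

/-- The gradient of `y ↦ G((u(x) - u(x - y)) / (|y|² + η²)^{1/2})`. -/
theorem hasGradientAt_slope (h : Profile N u) (x : Plane) (p : ℝ) {η : ℝ} (hη : 0 < η)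
    (y : Plane) :
    HasGradientAt
      (fun y => slopePrimitive p ((u x - u (x - y)) * (‖y‖ ^ 2 + η ^ 2) ^ (-(1 / 2 : ℝ))))
      ((1 + ((u x - u (x - y)) * (‖y‖ ^ 2 + η ^ 2) ^ (-(1 / 2 : ℝ))) ^ 2) ^ (-p) •
        ((‖y‖ ^ 2 + η ^ 2) ^ (-(1 / 2 : ℝ)) • ∇ u (x - y) -
          ((u x - u (x - y)) * (‖y‖ ^ 2 + η ^ 2) ^ (-(1 / 2 : ℝ) - 1)) • y)) y := by
  rw [hasGradientAt_iff_hasFDerivAt]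
  have h0 : HasDerivAt (fun t : ℝ => (t + η ^ 2) ^ (-(1 / 2 : ℝ)))
      (-(1 / 2 : ℝ) * (‖y‖ ^ 2 + η ^ 2) ^ (-(1 / 2 : ℝ) - 1)) (‖y‖ ^ 2) := by
    simpa using ((hasDerivAt_id (‖y‖ ^ 2)).add_const (η ^ 2)).rpow_const (p := -(1 / 2 : ℝ))
      (Or.inl (by simp only [id]; positivity))
  have h1 := h0.comp_hasFDerivAt y (hasStrictFDerivAt_norm_sq y).hasFDerivAt
  have h2 := (h.hasGradientAt_gap x y).hasFDerivAt.mul h1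
  have h3 := (hasDerivAt_slopePrimitive p
    ((u x - u (x - y)) * (‖y‖ ^ 2 + η ^ 2) ^ (-(1 / 2 : ℝ)))).comp_hasFDerivAt y h2
  refine h3.congr_fderiv ?_
  ext v
  simp
  ring

theorem integral_regularized_nonneg (h : Profile N u) (hα : 0 ≤ α) (hα1 : α < 1)
    (hmax : ∀ z, u z ≤ u x) {η : ℝ} (hη : 0 < η) (hη1 : η ≤ 1) :
    0 ≤ ∫ y, regularized α u x η y := by
  have hN := h.const_nonneg
  have hu := h.continuous
  have hgu := h.continuous_grad
  set a : ℝ := (2 + α) / 2 with ha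
  set p : ℝ := (3 + α) / 2 with hp
  have hδ : ∀ y, 0 ≤ u x - u (x - y) := fun y => sub_nonneg.2 (hmax _)
  set g : Plane → ℝ := fun y =>
    slopePrimitive p ((u x - u (x - y)) * (‖y‖ ^ 2 + η ^ 2) ^ (-(1 / 2 : ℝ))) with hgdef
  set g' : Plane → Plane := fun y =>
    ((1 + ((u x - u (x - y)) * (‖y‖ ^ 2 + η ^ 2) ^ (-(1 / 2 : ℝ))) ^ 2) ^ (-p) •
        ((‖y‖ ^ 2 + η ^ 2) ^ (-(1 / 2 : ℝ)) • ∇ u (x - y) -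
          ((u x - u (x - y)) * (‖y‖ ^ 2 + η ^ 2) ^ (-(1 / 2 : ℝ) - 1)) • y)) with hg'def
  have hr0 : ∀ y : Plane, 0 < ‖y‖ ^ 2 + η ^ 2 := fun y => by positivity
  have hrc : ∀ q : ℝ, Continuous fun y : Plane => (‖y‖ ^ 2 + η ^ 2) ^ q := fun q =>
    Continuous.rpow_const (by fun_prop) fun y => Or.inl (hr0 y).ne'
  have hg'c : Continuous g' := by
    have c1 := hrc (-(1 / 2 : ℝ))
    have c2 := hrc (-(1 / 2 : ℝ) - 1)
    have c3 : Continuous fun y => u x - u (x - y) := by fun_prop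
    have c4 : Continuous fun y => ∇ u (x - y) := by fun_prop
    refine Continuous.smul ((continuous_slope p).comp (c3.mul c1)) ?_
    exact (c1.smul c4).sub ((c3.mul c2).smul continuous_id)
  -- pointwise bounds
  have hq0 : ∀ y : Plane, 0 ≤ (‖y‖ ^ 2 + η ^ 2) ^ (-(1 / 2 : ℝ)) := fun y => by positivity
  have hqη : ∀ y : Plane, (‖y‖ ^ 2 + η ^ 2) ^ (-(1 / 2 : ℝ)) ≤ 1 / η := fun y => by
    calc _ ≤ (η ^ 2) ^ (-(1 / 2 : ℝ)) := Real.rpow_le_rpow_of_nonpos (by positivity)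
          (by nlinarith [sq_nonneg ‖y‖]) (by norm_num)
      _ = 1 / η := by
          rw [Real.rpow_neg (by positivity), ← Real.sqrt_eq_rpow, Real.sqrt_sq hη.le, one_div]
  have hqy : ∀ y : Plane, ‖y‖ * (‖y‖ ^ 2 + η ^ 2) ^ (-(1 / 2 : ℝ)) ≤ 1 := fun y => by
    rw [Real.rpow_neg (hr0 y).le, ← Real.sqrt_eq_rpow, ← div_eq_mul_inv,
      div_le_one (Real.sqrt_pos.2 (hr0 y))]
    exact Real.le_sqrt_of_sq_le (by nlinarith [sq_nonneg η])
  have hq2 : ∀ y : Plane, (‖y‖ ^ 2 + η ^ 2) ^ (-(1 / 2 : ℝ) - 1) =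
      ((‖y‖ ^ 2 + η ^ 2) ^ (-(1 / 2 : ℝ))) ^ 3 := fun y => by
    rw [← Real.rpow_natCast ((‖y‖ ^ 2 + η ^ 2) ^ (-(1 / 2 : ℝ))) 3, ← Real.rpow_mul (hr0 y).le]
    norm_num
  have hg0 : ∀ y, 0 ≤ g y := fun y => slopePrimitive_nonneg p (mul_nonneg (hδ y) (hq0 y))
  have hgs : ∀ y, g y ≤ (u x - u (x - y)) * (‖y‖ ^ 2 + η ^ 2) ^ (-(1 / 2 : ℝ)) := fun y =>
    slopePrimitive_le (by rw [hp]; linarith) (mul_nonneg (hδ y) (hq0 y))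
  have hNη : N ≤ N / η := by rw [le_div_iff₀ hη]; nlinarith
  have hgη : ∀ y, g y ≤ 2 * (N / η) := fun y => by
    calc g y ≤ (2 * N) * (1 / η) := (hgs y).trans (mul_le_mul (h.gap_le y) (hqη y) (hq0 y)
          (by positivity))
      _ = _ := by ring
  have hyg : ∀ y, ‖y‖ * g y ≤ 2 * (N / η) := fun y => by
    calc ‖y‖ * g y ≤ ‖y‖ * ((2 * N) * (‖y‖ ^ 2 + η ^ 2) ^ (-(1 / 2 : ℝ))) := by
          refine mul_le_mul_of_nonneg_left ((hgs y).trans ?_) (norm_nonneg _)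
          exact mul_le_mul_of_nonneg_right (h.gap_le y) (hq0 y)
      _ = 2 * N * (‖y‖ * (‖y‖ ^ 2 + η ^ 2) ^ (-(1 / 2 : ℝ))) := by ring
      _ ≤ 2 * N * 1 := by gcongr; exact hqy y
      _ ≤ _ := by linarith
  have hyg' : ∀ y, ‖y‖ * ‖g' y‖ ≤ 3 * (N / η) := fun y => by
    set q := (‖y‖ ^ 2 + η ^ 2) ^ (-(1 / 2 : ℝ)) with hq
    have e1 : ‖g' y‖ ≤ q * N + 2 * N * q ^ 3 * ‖y‖ := by
      rw [hg'def]
      simp only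
      rw [norm_smul, Real.norm_of_nonneg (by positivity)]
      refine (mul_le_of_le_one_left (norm_nonneg _)
        (slope_le_one (by rw [hp]; linarith) _)).trans ?_
      refine (norm_sub_le _ _).trans (add_le_add ?_ ?_)
      · rw [norm_smul, Real.norm_of_nonneg (hq0 y)]
        exact mul_le_mul_of_nonneg_left (h.norm_grad_le _) (hq0 y)
      · rw [norm_smul, hq2, Real.norm_of_nonneg (mul_nonneg (hδ y) (pow_nonneg (hq0 y) 3))]
        have := h.gap_le (x := x) y
        have := hq0 y
        gcongr
    have b1 := hqy y
    have b2 := hqη y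
    rw [← hq] at b1 b2
    have hq0' : 0 ≤ q := hq0 y
    calc ‖y‖ * ‖g' y‖ ≤ ‖y‖ * (q * N + 2 * N * q ^ 3 * ‖y‖) := by gcongr
      _ = N * (‖y‖ * q) + 2 * N * q * ((‖y‖ * q) * (‖y‖ * q)) := by ring
      _ ≤ N * 1 + 2 * N * (1 / η) * (1 * 1) := by gcongr
      _ = N + 2 * (N / η) := by ring
      _ ≤ _ := by linarith
  set b : Plane → ℝ := fun y =>
    (η ^ 2) ^ (-a) * (6 * (N / η)) * (1 + ‖y‖ ^ 2) ^ (-(2 * (a + η)) / 2) with hb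
  have hbi : Integrable b := (integrable_rpow_neg_one_add_norm_sq (by
    rw [show Module.finrank ℝ Plane = 2 by simp]; rw [ha]; push_cast; linarith)).const_mul _
  have hbnd : ∀ (y : Plane) (c : ℝ), 0 ≤ c → c ≤ 6 * (N / η) →
      radialWeight a η (‖y‖ ^ 2) * c ≤ b y := fun y c hc0 hc => by
    calc _ ≤ ((η ^ 2) ^ (-a) * (1 + ‖y‖ ^ 2) ^ (-(2 * (a + η)) / 2)) * (6 * (N / η)) := by
          refine mul_le_mul (radialWeight_le (by rw [ha]; linarith) hη hη1 (by positivity)) hc hc0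
            (by positivity)
      _ = b y := by rw [hb]; ring
  have hψ0 : ∀ y : Plane, 0 ≤ radialWeight a η (‖y‖ ^ 2) := fun y =>
    radialWeight_nonneg a η (by positivity)
  have hNη0 : 0 ≤ N / η := by positivity
  obtain ⟨j1, j2, j3⟩ := integral_radial_inner_gradient (ψ := radialWeight a η)
    (ψ' := radialWeightDeriv a η) (g := g) (g' := g')
    (fun t ht => hasDerivAt_radialWeight a hη ht) (continuousOn_radialWeightDeriv a hη)
    (fun y => h.hasGradientAt_slope x p hη y) hg'c hbi
    (fun y => by
      rw [abs_of_nonneg (mul_nonneg (hψ0 y) (hg0 y))]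
      exact hbnd y _ (hg0 y) ((hgη y).trans (by linarith)))
    (fun y => by
      rw [abs_mul, abs_of_nonneg (hg0 y)]
      have := abs_radialWeightDeriv_mul_le (a := a) (η := η) (t := ‖y‖ ^ 2) (by rw [ha]; linarith)
        hη (by positivity)
      have h3 : a + η ≤ 3 := by rw [ha]; linarith
      calc _ ≤ (3 * radialWeight a η (‖y‖ ^ 2)) * g y := by
            refine mul_le_mul_of_nonneg_right (this.trans ?_) (hg0 y)
            exact mul_le_mul_of_nonneg_right h3 (hψ0 y)
        _ = radialWeight a η (‖y‖ ^ 2) * (3 * g y) := by ring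
        _ ≤ _ := hbnd y _ (by have := hg0 y; positivity) (by linarith [hgη y]))
    (fun y => by
      rw [abs_of_nonneg (hψ0 y), mul_assoc]
      exact hbnd y _ (by positivity) (by linarith [hyg' y]))
    (fun y => by
      rw [abs_of_nonneg (hψ0 y), abs_of_nonneg (hg0 y), mul_assoc]
      exact hbnd y _ (by have := hg0 y; positivity) (by linarith [hyg y]))
  -- identification of the integrands
  have hid : ∀ y, regularized α u x η y = radialWeight a η (‖y‖ ^ 2) * inner ℝ (g' y) y +
      2 * (η ^ 2 * (‖y‖ ^ 2 + η ^ 2) ^ (-((5 + α) / 2)) * (u x - u (x - y))) := fun y => by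
    have hr := hr0 y
    set r := ‖y‖ ^ 2 + η ^ 2 with hrd
    set δ := u x - u (x - y) with hδd
    have hrr : (r ^ (-(1 / 2 : ℝ))) ^ 2 = r⁻¹ := by
      rw [← Real.rpow_natCast, ← Real.rpow_mul hr.le, ← Real.rpow_neg_one]; norm_num
    have e1 : (1 + (δ * r ^ (-(1 / 2 : ℝ))) ^ 2) ^ (-p) = (r + δ ^ 2) ^ (-p) * r ^ p := by
      have : 1 + (δ * r ^ (-(1 / 2 : ℝ))) ^ 2 = (r + δ ^ 2) * r⁻¹ := by
        rw [mul_pow, hrr]; field_simp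
      rw [this, Real.mul_rpow (by positivity) (by positivity), Real.inv_rpow hr.le,
        Real.rpow_neg hr.le, inv_inv]
    have e2 : r ^ (-a) * r ^ p * r ^ (-(1 / 2 : ℝ)) = 1 := by
      rw [← Real.rpow_add hr, ← Real.rpow_add hr, ha, hp]
      ring_nf; simp
    have e3 : r ^ (-(1 / 2 : ℝ) - 1) = r ^ (-(1 / 2 : ℝ)) / r := Real.rpow_sub_one hr.ne' _
    rw [regularized, hg'def]
    simp only
    rw [← hrd, ← hδd, ← hp, e1, e3, inner_smul_left, inner_sub_left, inner_smul_left,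
      inner_smul_left, real_inner_self_eq_norm_sq, radialWeight, ← hrd]
    simp only [conj_trivial]
    have e4 : ∀ W E I Q : ℝ, r ^ (-a) * W * (E * r ^ p * (r ^ (-(1 / 2 : ℝ)) * I -
        δ * (r ^ (-(1 / 2 : ℝ)) / r) * Q)) =
        (r ^ (-a) * r ^ p * r ^ (-(1 / 2 : ℝ))) * (W * E * (I - δ * (Q / r))) := by
      intros; ring
    rw [e4, e2, one_mul]
  have hint2 : Integrable fun y => 2 * (η ^ 2 * (‖y‖ ^ 2 + η ^ 2) ^ (-((5 + α) / 2)) *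
      (u x - u (x - y))) := by
    refine ((h.integrable_dominating hα hα1 hmax).const_mul 3 |>.add j1.abs).mono' ?_ ?_
    · refine Continuous.aestronglyMeasurable ?_
      have c3 : Continuous fun y => u x - u (x - y) := by fun_prop
      exact continuous_const.mul ((continuous_const.mul (hrc _)).mul c3)
    · filter_upwards [ (Measure.ae_ne volume (0 : Plane)) ] with y hy
      have h1 := abs_regularized_le hα hmax hη hy
      rw [hid y] at h1
      simp only [Pi.add_apply, Real.norm_eq_abs]
      set A := radialWeight a η (‖y‖ ^ 2) * inner ℝ (g' y) y
      set B := 2 * (η ^ 2 * (‖y‖ ^ 2 + η ^ 2) ^ (-((5 + α) / 2)) * (u x - u (x - y)))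
      have : |B| ≤ |A + B| + |A| := by
        have := abs_sub (A + B) A
        simpa using this
      linarith
  simp_rw [hid]
  rw [integral_add j1 hint2, j3]
  have hle : 2 * ∫ y, (radialWeight a η (‖y‖ ^ 2) + radialWeightDeriv a η (‖y‖ ^ 2) * ‖y‖ ^ 2) *
      g y ≤ ∫ y, 2 * (η ^ 2 * (‖y‖ ^ 2 + η ^ 2) ^ (-((5 + α) / 2)) * (u x - u (x - y))) := by
    rw [← integral_const_mul]
    refine integral_mono (j2.const_mul 2) hint2 fun y => ?_
    have h1 := radialWeight_add_deriv_le (a := a) (η := η) (t := ‖y‖ ^ 2) (by rw [ha]; linarith)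
      hη (by positivity)
    have hr := hr0 y
    have e5 : (‖y‖ ^ 2 + η ^ 2) ^ (-((5 + α) / 2)) = (‖y‖ ^ 2 + η ^ 2) ^ (-a - 1) *
        (‖y‖ ^ 2 + η ^ 2) ^ (-(1 / 2 : ℝ)) := by
      rw [← Real.rpow_add hr, ha]; ring_nf
    simp only
    have hR : 0 ≤ η ^ 2 * (‖y‖ ^ 2 + η ^ 2) ^ (-a - 1) := by positivity
    calc _ ≤ 2 * ((η ^ 2 * (‖y‖ ^ 2 + η ^ 2) ^ (-a - 1)) *
          ((u x - u (x - y)) * (‖y‖ ^ 2 + η ^ 2) ^ (-(1 / 2 : ℝ)))) := by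
          refine mul_le_mul_of_nonneg_left ?_ (by norm_num)
          exact mul_le_mul h1 (hgs y) (hg0 y) hR
      _ = _ := by rw [e5]; ring
  linarith

/-- At a global maximum the principal value is at most minus the absolutely convergent integral of
the gap against the kernel. -/
theorem pv_le_of_max (h : Profile N u) (hα : 0 ≤ α) (hα1 : α < 1) (hmax : ∀ z, u z ≤ u x)
    {v : ℝ} (hv : HasPrincipalValue (contourKernel α u x) v) :
    Integrable (fun y => (u x - u (x - y)) *
      (‖y‖ ^ 2 + (u x - u (x - y)) ^ 2) ^ (-((3 + α) / 2))) ∧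
    v ≤ -∫ y, (u x - u (x - y)) * (‖y‖ ^ 2 + (u x - u (x - y)) ^ 2) ^ (-((3 + α) / 2)) := by
  have hu := h.continuous
  have hgu := h.continuous_grad
  have hΘ := h.integrable_dominating hα hα1 hmax
  have hδ : ∀ y, 0 ≤ u x - u (x - y) := fun y => sub_nonneg.2 (hmax _)
  have hDle : ∀ y : Plane, y ≠ 0 →
      (‖y‖ ^ 2 + (u x - u (x - y)) ^ 2) ^ (-((3 + α) / 2)) ≤ ‖y‖ ^ (-(3 + α)) := fun y hy => by
    have hy' : 0 < ‖y‖ := norm_pos_iff.2 hy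
    calc _ ≤ (‖y‖ ^ 2) ^ (-((3 + α) / 2)) := Real.rpow_le_rpow_of_nonpos (by positivity)
          (by nlinarith [sq_nonneg (u x - u (x - y))]) (by linarith)
      _ = _ := by
          rw [show -(3 + α) = 2 * (-((3 + α) / 2)) by ring, Real.rpow_mul hy'.le]; norm_num
  have hDm : Measurable fun y : Plane =>
      (‖y‖ ^ 2 + (u x - u (x - y)) ^ 2) ^ (-((3 + α) / 2)) :=
    (Continuous.measurable (by fun_prop)).pow_const _
  have i1 : Integrable (fun y => (u x - u (x - y)) *
      (‖y‖ ^ 2 + (u x - u (x - y)) ^ 2) ^ (-((3 + α) / 2))) := by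
    refine hΘ.mono' (Measurable.aestronglyMeasurable
      ((Continuous.measurable (by fun_prop)).mul hDm)) ?_
    filter_upwards [Measure.ae_ne volume (0 : Plane)] with y hy
    rw [Real.norm_of_nonneg (mul_nonneg (hδ y) (by positivity))]
    have := mul_le_mul_of_nonneg_left (hDle y hy) (hδ y)
    have p1 : 0 ≤ ‖∇ u (x - y)‖ * ‖y‖ ^ (-(2 + α)) := by positivity
    linarith
  have i2 : Integrable (fun y => inner ℝ (∇ u (x - y)) y *
      (‖y‖ ^ 2 + (u x - u (x - y)) ^ 2) ^ (-((3 + α) / 2))) := by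
    refine hΘ.mono' (Measurable.aestronglyMeasurable
      ((Continuous.measurable (by fun_prop)).mul hDm)) ?_
    filter_upwards [Measure.ae_ne volume (0 : Plane)] with y hy
    have hy' : 0 < ‖y‖ := norm_pos_iff.2 hy
    rw [norm_mul, Real.norm_of_nonneg (by positivity : 0 ≤ (‖y‖ ^ 2 +
      (u x - u (x - y)) ^ 2) ^ (-((3 + α) / 2)))]
    have e3 : ‖y‖ ^ (-(2 + α)) = ‖y‖ ^ (-(3 + α)) * ‖y‖ := by
      rw [← Real.rpow_add_one hy'.ne']; ring_nf
    have p1 : 0 ≤ (u x - u (x - y)) * ‖y‖ ^ (-(3 + α)) := mul_nonneg (hδ y) (by positivity)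
    calc _ ≤ (‖∇ u (x - y)‖ * ‖y‖) * ‖y‖ ^ (-(3 + α)) :=
          mul_le_mul (abs_real_inner_le_norm _ _) (hDle y hy) (by positivity) (by positivity)
      _ ≤ _ := by rw [e3]; linarith
  have hK : contourKernel α u x = fun y => -(inner ℝ (∇ u (x - y)) y *
      (‖y‖ ^ 2 + (u x - u (x - y)) ^ 2) ^ (-((3 + α) / 2))) := by
    ext y
    rw [contourKernel, h.grad_eq_zero hmax, zero_sub, inner_neg_left,
      Real.rpow_neg (by positivity)]
    ring
  have hvK : v = ∫ y, contourKernel α u x y := by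
    have hcov : AECover volume (𝓝[>] (0 : ℝ) ×ˢ atTop)
        (fun q : ℝ × ℝ => {y : Plane | q.1 < ‖y‖ ∧ ‖y‖ < q.2}) := by
      refine ⟨?_, fun q => measurable_norm measurableSet_Ioo⟩
      filter_upwards [Measure.ae_ne volume (0 : Plane)] with y hy
      have hy' : 0 < ‖y‖ := norm_pos_iff.2 hy
      have : Set.Ioo 0 ‖y‖ ×ˢ Set.Ioi ‖y‖ ∈ 𝓝[>] (0 : ℝ) ×ˢ (atTop : Filter ℝ) :=
        prod_mem_prod (Ioo_mem_nhdsGT hy') (Ioi_mem_atTop _)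
      filter_upwards [this] with q hq
      exact ⟨hq.1.2, hq.2⟩
    exact tendsto_nhds_unique hv.2
      (hcov.integral_tendsto_of_countably_generated (by rw [hK]; exact i2.neg))
  refine ⟨i1, ?_⟩
  have hη : Tendsto (fun n : ℕ => 1 / ((n : ℝ) + 1)) atTop (𝓝 0) :=
    tendsto_one_div_add_atTop_nhds_zero_nat
  have hlim := tendsto_integral_of_dominated_convergence (μ := (volume : Measure Plane))
    (F := fun (n : ℕ) y => regularized α u x (1 / ((n : ℝ) + 1)) y) _
    (fun n => by
      have hm : Measurable (regularized α u x (1 / ((n : ℝ) + 1))) := by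
        unfold regularized
        refine Measurable.add (Measurable.mul (Measurable.mul ?_ ?_) ?_) ?_
        · exact (Continuous.measurable (by fun_prop)).pow_const _
        · exact (Continuous.measurable (by fun_prop)).pow_const _
        · refine Measurable.sub (Continuous.measurable (by fun_prop)) (Measurable.mul
            (Continuous.measurable (by fun_prop)) (Measurable.div
            (Continuous.measurable (by fun_prop)) (Continuous.measurable (by fun_prop))))
        · refine Measurable.const_mul (Measurable.mul (Measurable.const_mul
            ((Continuous.measurable (by fun_prop)).pow_const _) _)
            (Continuous.measurable (by fun_prop))) _
      exact hm.aestronglyMeasurable)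
    (hΘ.const_mul 3)
    (fun n => by
      filter_upwards [Measure.ae_ne volume (0 : Plane)] with y hy
      exact abs_regularized_le hα hmax (by positivity) hy)
    (by
      filter_upwards [Measure.ae_ne volume (0 : Plane)] with y hy
      exact tendsto_regularized hy hη)
  have hnn := ge_of_tendsto' hlim fun n => h.integral_regularized_nonneg hα hα1 hmax
    (by positivity : (0:ℝ) < 1 / ((n : ℝ) + 1)) (by
      rw [div_le_one (by positivity)]; have : (0:ℝ) ≤ n := by positivity
      linarith)
  have e : ∫ y, (‖y‖ ^ 2 + (u x - u (x - y)) ^ 2) ^ (-((3 + α) / 2)) *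
        (inner ℝ (∇ u (x - y)) y - (u x - u (x - y))) =
      (∫ y, inner ℝ (∇ u (x - y)) y *
        (‖y‖ ^ 2 + (u x - u (x - y)) ^ 2) ^ (-((3 + α) / 2))) -
      ∫ y, (u x - u (x - y)) * (‖y‖ ^ 2 + (u x - u (x - y)) ^ 2) ^ (-((3 + α) / 2)) := by
    rw [← integral_sub i2 i1]
    refine integral_congr_ae (.of_forall fun y => ?_)
    simp only
    ring
  rw [e] at hnn
  rw [hvK, hK, integral_neg]
  linarith

end Profile

theorem ennreal_add_sq_le (a b : ℝ≥0∞) : (a + b) ^ 2 ≤ 2 * (a ^ 2 + b ^ 2) := by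
  have h := ENNReal.rpow_add_le_mul_rpow_add_rpow a b (p := 2) (by norm_num)
  norm_num at h
  exact h

theorem hkNorm_add_sq_le {k : ℕ} {u w : Plane → ℝ} (hu : MemHk k u) (hw : MemHk k w) :
    hkNorm k (fun x => u x + w x) ^ 2 ≤ 2 * (hkNorm k u ^ 2 + hkNorm k w ^ 2) := by
  have h1 := hu.memLp_complex
  have h2 := hw.memLp_complex
  have h3 : MemLp (fun x => ((u x + w x : ℝ) : ℂ)) 2 (volume : Measure Plane) := by
    refine (h1.add h2).ae_eq (.of_forall fun x => ?_)
    simp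
  have e : h3.toLp _ = h1.toLp _ + h2.toLp _ := by
    rw [← MemLp.toLp_add]
    exact MemLp.toLp_congr _ _ (.of_forall fun x => by simp)
  rw [hkNorm_sq h1, hkNorm_sq h2, hkNorm_sq h3, e, FourierTransform.fourier_add]
  set F := (𝓕 (h1.toLp (fun x => (u x : ℂ))) : Lp ℂ 2 (volume : Measure Plane))
  set G := (𝓕 (h2.toLp (fun x => (w x : ℂ))) : Lp ℂ 2 (volume : Measure Plane))
  have b1 : eLpNorm (fun x => u x + w x) 2 volume ^ 2 ≤
      2 * (eLpNorm u 2 volume ^ 2 + eLpNorm w 2 volume ^ 2) := by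
    refine le_trans ?_ (ennreal_add_sq_le _ _)
    gcongr
    exact eLpNorm_add_le hu.1.aestronglyMeasurable hw.1.aestronglyMeasurable (by norm_num)
  have b2 : ∫⁻ ξ : Plane, ENNReal.ofReal ((2 * Real.pi * ‖ξ‖) ^ (2 * k)) *
        ‖((F + G : Lp ℂ 2 (volume : Measure Plane)) : Plane → ℂ) ξ‖ₑ ^ 2 ≤
      2 * ((∫⁻ ξ : Plane, ENNReal.ofReal ((2 * Real.pi * ‖ξ‖) ^ (2 * k)) * ‖F ξ‖ₑ ^ 2) +
        ∫⁻ ξ : Plane, ENNReal.ofReal ((2 * Real.pi * ‖ξ‖) ^ (2 * k)) * ‖G ξ‖ₑ ^ 2) := by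
    have hFm : AEMeasurable (fun ξ : Plane => ENNReal.ofReal ((2 * Real.pi * ‖ξ‖) ^ (2 * k)) *
        ‖F ξ‖ₑ ^ 2) volume := by
      have hw : Measurable fun ξ : Plane => ENNReal.ofReal ((2 * Real.pi * ‖ξ‖) ^ (2 * k)) := by
        fun_prop
      exact hw.aemeasurable.mul ((Lp.aestronglyMeasurable F).enorm.pow_const 2)
    rw [← lintegral_add_left' hFm, ← lintegral_const_mul' _ _ (by norm_num)]
    refine lintegral_mono_ae ?_
    filter_upwards [Lp.coeFn_add F G] with ξ hξ
    rw [hξ, Pi.add_apply]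
    calc _ ≤ ENNReal.ofReal ((2 * Real.pi * ‖ξ‖) ^ (2 * k)) * (2 * (‖F ξ‖ₑ ^ 2 + ‖G ξ‖ₑ ^ 2)) := by
          gcongr
          refine le_trans ?_ (ennreal_add_sq_le _ _)
          gcongr
          exact enorm_add_le _ _
      _ = _ := by ring
  calc _ ≤ _ := add_le_add b1 b2
    _ = _ := by ring

/-- The part of the solution concept that the estimates use: uniform regularity in time,
continuity in the uniform norm, and the contour equation. -/
structure Flow (α N T : ℝ) (f : ℝ → Plane → ℝ) : Prop where
  profile : ∀ t ∈ Set.Icc 0 T, Profile N (f t)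
  unif : ∀ t ∈ Set.Icc 0 T, ∀ ε > 0, ∀ᶠ s in 𝓝[Set.Icc 0 T] t, ∀ x, |f s x - f t x| < ε
  equation : ∀ t ∈ Set.Icc 0 T, ∀ x : Plane, ∃ v : ℝ,
    HasPrincipalValue (contourKernel α (f t) x) v ∧
    HasDerivWithinAt (fun s => f s x) v (Set.Icc 0 T) t

theorem IsSolution.exists_flow {α T : ℝ} {k : ℕ} (hk : 4 ≤ k) {f₀ : Plane → ℝ}
    {f : ℝ → Plane → ℝ} (h : IsSolution α k T f₀ f) : ∃ N, Flow α N T f := by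
  obtain ⟨C, hC, hP⟩ := exists_profile_const
  have hdiff : ∀ t ∈ Set.Icc 0 T, ∀ s ∈ Set.Icc 0 T, Continuous fun x => f s x - f t x :=
    fun t ht s hs => (h.mem_hk s hs).1.sub (h.mem_hk t ht).1
  have hbound : ∃ B : ℝ, ∀ t ∈ Set.Icc 0 T, (hkNorm k (f t)).toReal ≤ B := by
    refine isCompact_Icc.induction_on (p := fun S => ∃ B : ℝ, ∀ t ∈ S, (hkNorm k (f t)).toReal ≤ B)
      ⟨0, fun t ht => absurd ht (Set.notMem_empty t)⟩
      (fun S S' hSS' ⟨B, hB⟩ => ⟨B, fun t ht => hB t (hSS' ht)⟩)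
      (fun S S' ⟨B, hB⟩ ⟨B', hB'⟩ => ⟨max B B', fun t ht => ?_⟩) (fun t ht => ?_)
    · rcases ht with ht | ht
      · exact (hB t ht).trans (le_max_left _ _)
      · exact (hB' t ht).trans (le_max_right _ _)
    · have h1 : ∀ᶠ s in 𝓝[Set.Icc 0 T] t, hkNorm k (fun x => f s x - f t x) < 1 :=
        (h.continuous_hk t ht).eventually (gt_mem_nhds one_pos)
      refine ⟨_, h1.and self_mem_nhdsWithin, (1 + 2 * (1 + hkNorm k (f t) ^ 2)).toReal,
        fun s hs => ?_⟩
      obtain ⟨hs1, hs2⟩ := hs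
      have hd : MemHk k (fun x => f s x - f t x) :=
        ⟨hdiff t ht s hs2, hs1.trans ENNReal.one_lt_top⟩
      have h2 := hkNorm_add_sq_le hd (h.mem_hk t ht)
      simp only [sub_add_cancel] at h2
      have hfin : hkNorm k (f t) ≠ ∞ := (h.mem_hk t ht).2.ne
      refine ENNReal.toReal_mono (by finiteness) ?_
      have h3 : hkNorm k (fun x => f s x) ^ 2 ≤ 2 * (1 + hkNorm k (f t) ^ 2) := by
        refine h2.trans ?_
        gcongr
        exact pow_le_one₀ (by positivity) hs1.le
      rcases le_total (hkNorm k (f s)) 1 with h4 | h4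
      · exact h4.trans le_self_add
      · exact (le_self_pow₀ h4 (by norm_num)).trans (h3.trans le_add_self)
  obtain ⟨B, hB⟩ := hbound
  refine ⟨C * (B + B ^ 2), fun t ht => (hP k hk _ (h.mem_hk t ht)).2 B (hB t ht), ?_, h.equation⟩
  intro t ht ε hε
  have h1 : ∀ᶠ s in 𝓝[Set.Icc 0 T] t,
      hkNorm k (fun x => f s x - f t x) < ENNReal.ofReal (ε / C) :=
    (h.continuous_hk t ht).eventually (gt_mem_nhds (by simp; positivity))
  filter_upwards [h1, self_mem_nhdsWithin] with s hs hs2 x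
  have hd : MemHk k (fun x => f s x - f t x) := ⟨hdiff t ht s hs2, hs.trans ENNReal.ofReal_lt_top⟩
  have h2 := (hP k hk _ hd).1 x
  have h3 := ENNReal.toReal_lt_of_lt_ofReal hs
  calc _ ≤ _ := h2
    _ < C * (ε / C) := by gcongr
    _ = ε := by field_simp

theorem gradient_neg_fun (u : Plane → ℝ) (x : Plane) : ∇ (fun z => -u z) x = -∇ u x := by
  unfold gradient
  rw [← map_neg, ← fderiv_fun_neg]

theorem contourKernel_neg (α : ℝ) (u : Plane → ℝ) (x y : Plane) :
    contourKernel α (fun z => -u z) x y = -contourKernel α u x y := by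
  unfold contourKernel
  rw [gradient_neg_fun, gradient_neg_fun, ← neg_sub', inner_neg_left, neg_div, ← neg_sub', neg_sq]

theorem HasPrincipalValue.neg {g : Plane → ℝ} {v : ℝ} (h : HasPrincipalValue g v) :
    HasPrincipalValue (fun y => -g y) (-v) := by
  refine ⟨fun ε R hε => (h.1 ε R hε).neg, ?_⟩
  simp_rw [integral_neg]
  exact h.2.neg

theorem Profile.neg {N : ℝ} {u : Plane → ℝ} (h : Profile N u) : Profile N (fun z => -u z) := by
  constructor
  · intro x
    rw [gradient_neg_fun]
    rw [hasGradientAt_iff_hasFDerivAt, map_neg]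
    exact (h.hasGradientAt x).hasFDerivAt.neg
  · simpa using h.abs_le
  · simpa [gradient_neg_fun] using h.norm_grad_le
  · intro x y
    rw [gradient_neg_fun, gradient_neg_fun, ← neg_sub', norm_neg]
    exact h.grad_lipschitz x y
  · simpa using h.integrable_sq
  · simpa using h.integral_sq_le
  · simpa [gradient_neg_fun] using h.integrable_grad_sq
  · simpa [gradient_neg_fun] using h.integral_grad_sq_le
  · intro y
    refine le_trans (le_of_eq ?_) (h.integral_shift_sq_le y)
    congr 1; ext x; ring
  · simpa using h.vanish.neg

namespace Flow

variable {α N T : ℝ} {f : ℝ → Plane → ℝ}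

theorem neg (h : Flow α N T f) : Flow α N T (fun t x => -f t x) where
  profile t ht := (h.profile t ht).neg
  unif t ht ε hε := by
    filter_upwards [h.unif t ht ε hε] with s hs x
    rw [← neg_sub', abs_neg]
    exact hs x
  equation t ht x := by
    obtain ⟨v, h1, h2⟩ := h.equation t ht x
    refine ⟨-v, ?_, h2.neg⟩
    convert h1.neg using 1
    ext y
    exact contourKernel_neg α (f t) x y

theorem continuousWithinAt (h : Flow α N T f) {t : ℝ} (ht : t ∈ Set.Icc 0 T) (x : Plane) :
    ContinuousWithinAt (fun s => f s x) (Set.Icc 0 T) t := by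
  obtain ⟨v, -, h2⟩ := h.equation t ht x
  exact h2.continuousWithinAt

end Flow

theorem HasDerivWithinAt.nonpos_of_left_min {h : ℝ → ℝ} {d T t : ℝ} (ht0 : 0 < t) (htT : t ≤ T)
    (hd : HasDerivWithinAt h d (Set.Icc 0 T) t) (hpos : ∀ s, 0 ≤ s → s < t → h t ≤ h s) :
    d ≤ 0 := by
  rw [hasDerivWithinAt_iff_tendsto_slope] at hd
  have hsub : Set.Ioo 0 t ⊆ Set.Icc 0 T \ {t} := fun s hs =>
    ⟨⟨hs.1.le, hs.2.le.trans htT⟩, hs.2.ne⟩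
  have hd' := hd.mono_left (nhdsWithin_mono t hsub)
  have : (𝓝[Set.Ioo 0 t] t).NeBot := right_nhdsWithin_Ioo_neBot ht0
  refine le_of_tendsto hd' ?_
  filter_upwards [self_mem_nhdsWithin] with s hs
  rw [slope_def_field]
  exact div_nonpos_of_nonneg_of_nonpos (sub_nonneg.2 (hpos s hs.1.le hs.2)) (by linarith [hs.2])

namespace Flow

variable {α N T : ℝ} {f : ℝ → Plane → ℝ}

/-- A function vanishing at infinity and lying strictly below a positive constant lies below it by
a positive margin. -/
theorem exists_margin {u : Plane → ℝ} (hu : Continuous u) (hv : Tendsto u (cocompact Plane) (𝓝 0))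
    {c : ℝ} (hc : 0 < c) (hlt : ∀ x, u x < c) : ∃ ε > 0, ∀ x, u x ≤ c - ε := by
  have h1 : ∀ᶠ x in cocompact Plane, u x < c / 2 := hv.eventually (gt_mem_nhds (by linarith))
  obtain ⟨K, hK, hKc⟩ := mem_cocompact.1 h1
  rcases K.eq_empty_or_nonempty with rfl | hne
  · refine ⟨c / 2, by linarith, fun x => ?_⟩
    have : u x < c / 2 := hKc (by simp)
    linarith
  · obtain ⟨z, hz, hmax⟩ := hK.exists_isMaxOn hne hu.continuousOn
    refine ⟨min (c / 2) (c - u z), lt_min (by linarith) (by linarith [hlt z]), fun x => ?_⟩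
    by_cases hx : x ∈ K
    · have h2 : u x ≤ u z := hmax hx
      linarith [min_le_right (c / 2) (c - u z)]
    · have h2 : u x < c / 2 := hKc hx
      linarith [min_le_left (c / 2) (c - u z)]

/-- Comparison with a positive barrier: if at any touching point the solution moves strictly slower
than the barrier, then it stays below the barrier. -/
theorem lt_of_barrier (h : Flow α N T f) {φ φ' : ℝ → ℝ} (hφ0 : ∀ t ∈ Set.Icc 0 T, 0 < φ t)
    (hφ : ∀ t ∈ Set.Icc 0 T, HasDerivWithinAt φ (φ' t) (Set.Icc 0 T) t)
    (hinit : ∀ x, f 0 x < φ 0)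
    (htouch : ∀ t ∈ Set.Icc 0 T, ∀ x v, (∀ z, f t z ≤ f t x) → f t x = φ t →
      HasPrincipalValue (contourKernel α (f t) x) v → v < φ' t) :
    ∀ t ∈ Set.Icc 0 T, ∀ x, f t x < φ t := by
  by_contra hcon
  push Not at hcon
  set S : Set ℝ := {t | t ∈ Set.Icc 0 T ∧ ∃ x, φ t ≤ f t x} with hS
  have hSne : S.Nonempty := by
    obtain ⟨t, ht, x, hx⟩ := hcon
    exact ⟨t, ht, x, hx⟩
  have hbdd : BddBelow S := ⟨0, fun t ht => ht.1.1⟩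
  set t₀ := sInf S with ht₀
  have ht₀I : t₀ ∈ Set.Icc 0 T := by
    obtain ⟨t, ht⟩ := hSne
    exact ⟨le_csInf ⟨t, ht⟩ fun s hs => hs.1.1, (csInf_le hbdd ht).trans ht.1.2⟩
  have hbefore : ∀ s, 0 ≤ s → s < t₀ → ∀ x, f s x < φ s := fun s hs0 hs x => by
    by_contra hc
    push Not at hc
    exact absurd (csInf_le hbdd (show s ∈ S from ⟨⟨hs0, hs.le.trans ht₀I.2⟩, x, hc⟩)) (not_le.2 hs)
  have hP := h.profile t₀ ht₀I
  have ht₀S : t₀ ∈ S := by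
    refine ⟨ht₀I, ?_⟩
    by_contra hc
    push Not at hc
    obtain ⟨ε, hε, hm⟩ := exists_margin hP.continuous hP.vanish (hφ0 t₀ ht₀I) hc
    have e1 := h.unif t₀ ht₀I (ε / 2) (by linarith)
    have e2 : ∀ᶠ s in 𝓝[Set.Icc 0 T] t₀, φ t₀ - ε / 2 < φ s :=
      (hφ t₀ ht₀I).continuousWithinAt.eventually (lt_mem_nhds (by linarith))
    obtain ⟨δ, hδ, hball⟩ := Metric.mem_nhdsWithin_iff.1 (e1.and e2)
    obtain ⟨s, hs, hsδ⟩ := exists_lt_of_csInf_lt hSne (show sInf S < t₀ + δ by linarith)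
    have hs0 : t₀ ≤ s := csInf_le hbdd hs
    have hmem : s ∈ Metric.ball t₀ δ ∩ Set.Icc 0 T := by
      refine ⟨?_, hs.1⟩
      rw [Metric.mem_ball, Real.dist_eq, abs_of_nonneg (by linarith)]
      linarith
    obtain ⟨g1, g2⟩ := hball hmem
    obtain ⟨x, hx⟩ := hs.2
    have g3 := (abs_lt.1 (g1 x)).2
    linarith [hm x]
  obtain ⟨x, hx⟩ := ht₀S.2
  have ht₀pos : 0 < t₀ := by
    rcases ht₀I.1.eq_or_lt with h0 | h0
    · rw [← h0] at hx
      exact absurd (hinit x) (not_lt.2 hx)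
    · exact h0
  have hle : ∀ z, f t₀ z ≤ φ t₀ := fun z => by
    have : (𝓝[Set.Ioo 0 t₀] t₀).NeBot := right_nhdsWithin_Ioo_neBot ht₀pos
    have hsub : Set.Ioo 0 t₀ ⊆ Set.Icc 0 T := fun s hs => ⟨hs.1.le, hs.2.le.trans ht₀I.2⟩
    refine le_of_tendsto_of_tendsto ((h.continuousWithinAt ht₀I z).mono hsub).tendsto
      ((hφ t₀ ht₀I).continuousWithinAt.mono hsub).tendsto ?_
    filter_upwards [self_mem_nhdsWithin] with s hs
    exact (hbefore s hs.1.le hs.2 z).le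
  have heq : f t₀ x = φ t₀ := le_antisymm (hle x) hx
  obtain ⟨v, hv1, hv2⟩ := h.equation t₀ ht₀I x
  have h1 := htouch t₀ ht₀I x v (fun z => heq ▸ hle z) heq hv1
  have h2 := HasDerivWithinAt.nonpos_of_left_min ht₀pos ht₀I.2 ((hφ t₀ ht₀I).sub hv2)
    fun s hs0 hs => by
      have := hbefore s hs0 hs x
      simp only [Pi.sub_apply]
      linarith
  linarith

theorem nonpos (h : Flow α N T f) (hα : 0 ≤ α) (hα1 : α < 1) (h0 : ∀ x, f 0 x ≤ 0) :
    ∀ t ∈ Set.Icc 0 T, ∀ x, f t x ≤ 0 := by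
  intro t ht x
  refine le_of_forall_pos_le_add fun ε hε => ?_
  have hT : 0 < 1 + t := by linarith [ht.1]
  have hb : f t x < ε / (1 + t) * (1 + t) := h.lt_of_barrier
    (φ := fun s => ε / (1 + t) * (1 + s)) (φ' := fun _ => ε / (1 + t))
    (fun s hs => by have := hs.1; positivity)
    (fun s _ => by
      simpa using (((hasDerivAt_id s).const_add 1).const_mul (ε / (1 + t))).hasDerivWithinAt)
    (fun z => (h0 z).trans_lt (by positivity))
    (fun s hs z v hmax _ hv => by
      have h1 := ((h.profile s hs).pv_le_of_max hα hα1 hmax hv).2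
      have h2 : 0 ≤ ∫ y, (f s z - f s (z - y)) *
          (‖y‖ ^ 2 + (f s z - f s (z - y)) ^ 2) ^ (-((3 + α) / 2)) :=
        integral_nonneg fun y => mul_nonneg (sub_nonneg.2 (hmax _)) (by positivity)
      have : 0 < ε / (1 + t) := by positivity
      linarith) t ht x
  rw [div_mul_cancel₀ _ hT.ne'] at hb
  linarith

end Flow

/-- The weight `(1 + |x|²/R²)^{-2}`. -/
def cutoff (R : ℝ) (x : Plane) : ℝ := ((1 + ‖x‖ ^ 2 / R ^ 2) ^ 2)⁻¹

/-- The gradient of `cutoff`. -/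
def cutoffGrad (R : ℝ) (x : Plane) : Plane :=
  (-(4 / R ^ 2) * ((1 + ‖x‖ ^ 2 / R ^ 2) ^ 3)⁻¹) • x

theorem cutoff_base_pos (R : ℝ) (x : Plane) : 0 < 1 + ‖x‖ ^ 2 / R ^ 2 := by positivity

theorem cutoff_nonneg (R : ℝ) (x : Plane) : 0 ≤ cutoff R x := by unfold cutoff; positivity

theorem cutoff_le_one (R : ℝ) (x : Plane) : cutoff R x ≤ 1 := by
  unfold cutoff
  refine inv_le_one_of_one_le₀ (one_le_pow₀ ?_)
  have : 0 ≤ ‖x‖ ^ 2 / R ^ 2 := by positivity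
  linarith

theorem continuous_cutoff (R : ℝ) : Continuous (cutoff R) := by
  unfold cutoff
  exact Continuous.inv₀ (by fun_prop) fun x => by have := cutoff_base_pos R x; positivity

theorem continuous_cutoffGrad (R : ℝ) : Continuous (cutoffGrad R) := by
  unfold cutoffGrad
  have h : Continuous fun x : Plane => (1 + ‖x‖ ^ 2 / R ^ 2) ^ 3 := by fun_prop
  refine Continuous.smul (continuous_const.mul (h.inv₀ fun x => ?_)) continuous_id
  have := cutoff_base_pos R x; positivity

theorem hasGradientAt_cutoff (R : ℝ) (x : Plane) :
    HasGradientAt (cutoff R) (cutoffGrad R x) x := by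
  rw [hasGradientAt_iff_hasFDerivAt]
  have hb := cutoff_base_pos R x
  have h0 : HasDerivAt (fun t : ℝ => ((1 + t / R ^ 2) ^ 2)⁻¹)
      (-(2 * (1 + ‖x‖ ^ 2 / R ^ 2) * (1 / R ^ 2)) / ((1 + ‖x‖ ^ 2 / R ^ 2) ^ 2) ^ 2)
      (‖x‖ ^ 2) := by
    have h1 : HasDerivAt (fun t : ℝ => 1 + t / R ^ 2) (1 / R ^ 2) (‖x‖ ^ 2) :=
      ((hasDerivAt_id (‖x‖ ^ 2)).div_const (R ^ 2)).const_add 1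
    have h2 : HasDerivAt (fun t : ℝ => (1 + t / R ^ 2) ^ 2)
        (2 * (1 + ‖x‖ ^ 2 / R ^ 2) * (1 / R ^ 2)) (‖x‖ ^ 2) := by
      simpa using h1.fun_pow 2
    exact h2.fun_inv (pow_pos hb 2).ne'
  have h1 := h0.comp_hasFDerivAt x (hasStrictFDerivAt_norm_sq x).hasFDerivAt
  refine h1.congr_fderiv ?_
  ext v
  simp [cutoffGrad]
  field_simp
  ring

theorem norm_cutoffGrad_le {R : ℝ} (hR : 0 < R) (x : Plane) :
    ‖cutoffGrad R x‖ ≤ 2 / R * cutoff R x := by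
  have hb := cutoff_base_pos R x
  rw [cutoffGrad, norm_smul, cutoff, neg_mul, norm_neg, Real.norm_of_nonneg (by positivity)]
  have h1 : 2 * (‖x‖ / R) ≤ 1 + ‖x‖ ^ 2 / R ^ 2 := by
    rw [← div_pow]; nlinarith [sq_nonneg (‖x‖ / R - 1)]
  calc 4 / R ^ 2 * ((1 + ‖x‖ ^ 2 / R ^ 2) ^ 3)⁻¹ * ‖x‖
      = 2 / R * ((2 * (‖x‖ / R)) * ((1 + ‖x‖ ^ 2 / R ^ 2) ^ 3)⁻¹) := by field_simp; ring
    _ ≤ 2 / R * ((1 + ‖x‖ ^ 2 / R ^ 2) * ((1 + ‖x‖ ^ 2 / R ^ 2) ^ 3)⁻¹) := by gcongr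
    _ = _ := by
        congr 1
        field_simp

/-- The integral of the unit-scale cutoff. -/
def cutoffMass : ℝ := ∫ x, cutoff 1 x

theorem cutoffMass_nonneg : 0 ≤ cutoffMass := integral_nonneg fun x => cutoff_nonneg 1 x

theorem integrable_cutoff {R : ℝ} (hR : 0 < R) :
    Integrable (cutoff R) ∧ ∫ x, cutoff R x = R ^ 2 * cutoffMass := by
  have h1 : Integrable (cutoff 1) := by
    refine integrable_japanese_two.congr (.of_forall fun x => ?_)
    simp [cutoff]
  have e : cutoff R = fun x => cutoff 1 (R⁻¹ • x) := by
    ext x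
    simp only [cutoff, norm_smul, norm_inv, Real.norm_of_nonneg hR.le, one_pow, div_one]
    congr 3
    field_simp
  constructor
  · rw [e]; exact h1.comp_smul (inv_ne_zero hR.ne')
  · rw [e, Measure.integral_comp_inv_smul]
    simp [cutoffMass, abs_of_pos hR]

theorem cutoff_translate_le {R : ℝ} (x y : Plane) {s : ℝ} (hs : s ^ 2 ≤ 1) :
    cutoff R (x + s • y) ≤ 4 * (1 + ‖y‖ ^ 2 / R ^ 2) ^ 2 * cutoff R x := by
  have hb1 := cutoff_base_pos R x
  have hb2 := cutoff_base_pos R (x + s • y)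
  have hb3 := cutoff_base_pos R y
  have h1 : ‖x‖ ^ 2 ≤ 2 * ‖x + s • y‖ ^ 2 + 2 * ‖y‖ ^ 2 := by
    have h2 : ‖x‖ ≤ ‖x + s • y‖ + ‖s • y‖ := by
      simpa using norm_sub_le (x + s • y) (s • y)
    have h3 : ‖s • y‖ ^ 2 ≤ ‖y‖ ^ 2 := by
      rw [norm_smul, mul_pow, Real.norm_eq_abs, sq_abs]
      exact mul_le_of_le_one_left (by positivity) hs
    nlinarith [sq_nonneg (‖x + s • y‖ - ‖s • y‖), norm_nonneg x, norm_nonneg (s • y),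
      norm_nonneg (x + s • y)]
  have h4 : 1 + ‖x‖ ^ 2 / R ^ 2 ≤
      2 * (1 + ‖y‖ ^ 2 / R ^ 2) * (1 + ‖x + s • y‖ ^ 2 / R ^ 2) := by
    have h5 : ‖x‖ ^ 2 / R ^ 2 ≤ (2 * ‖x + s • y‖ ^ 2 + 2 * ‖y‖ ^ 2) / R ^ 2 := by gcongr
    have h6 : 0 ≤ ‖y‖ ^ 2 / R ^ 2 * (‖x + s • y‖ ^ 2 / R ^ 2) := by positivity
    have h7 : (2 * ‖x + s • y‖ ^ 2 + 2 * ‖y‖ ^ 2) / R ^ 2 =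
      2 * (‖x + s • y‖ ^ 2 / R ^ 2) + 2 * (‖y‖ ^ 2 / R ^ 2) := by ring
    nlinarith
  unfold cutoff
  rw [inv_le_iff_one_le_mul₀ (by positivity)]
  have h8 : (1 + ‖x‖ ^ 2 / R ^ 2) ^ 2 ≤
      (2 * (1 + ‖y‖ ^ 2 / R ^ 2) * (1 + ‖x + s • y‖ ^ 2 / R ^ 2)) ^ 2 := by gcongr
  calc (1:ℝ) = ((1 + ‖x‖ ^ 2 / R ^ 2) ^ 2)⁻¹ * (1 + ‖x‖ ^ 2 / R ^ 2) ^ 2 := by field_simp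
    _ ≤ ((1 + ‖x‖ ^ 2 / R ^ 2) ^ 2)⁻¹ *
        (2 * (1 + ‖y‖ ^ 2 / R ^ 2) * (1 + ‖x + s • y‖ ^ 2 / R ^ 2)) ^ 2 := by gcongr
    _ = _ := by ring

/-- Second-order bound on the weight, relative to the weight itself. -/
theorem abs_inner_cutoffGrad_sub_le {R : ℝ} (hR : 0 < R) (x y : Plane) :
    |inner ℝ (cutoffGrad R (x + y) - cutoffGrad R x) y| ≤
      112 / R ^ 2 * ‖y‖ ^ 2 * (1 + ‖y‖ ^ 2 / R ^ 2) ^ 2 * cutoff R x := by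
  set Q : ℝ → ℝ := fun s => ‖x‖ ^ 2 + 2 * s * inner ℝ x y + s ^ 2 * ‖y‖ ^ 2 with hQ
  have hQn : ∀ s : ℝ, ‖x + s • y‖ ^ 2 = Q s := fun s => by
    rw [norm_add_sq_real, inner_smul_right, norm_smul, mul_pow, Real.norm_eq_abs, sq_abs, hQ]
    ring
  have hbase : ∀ s, 0 < 1 + Q s / R ^ 2 := fun s => by
    rw [← hQn]; exact cutoff_base_pos R _
  set ℓ : ℝ → ℝ := fun s => inner ℝ x y + s * ‖y‖ ^ 2 with hℓ
  have hℓn : ∀ s : ℝ, inner ℝ (x + s • y) y = ℓ s := fun s => by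
    rw [inner_add_left, inner_smul_left, real_inner_self_eq_norm_sq, hℓ]; simp
  have hQd : ∀ s, HasDerivAt Q (2 * ℓ s) s := fun s => by
    have h1 : HasDerivAt (fun s : ℝ => ‖x‖ ^ 2 + 2 * s * inner ℝ x y + s ^ 2 * ‖y‖ ^ 2)
        (2 * inner ℝ x y + 2 * s * ‖y‖ ^ 2) s := by
      have a1 := (((hasDerivAt_id s).const_mul 2).mul_const (inner ℝ x y)).const_add (‖x‖ ^ 2)
      have a2 := ((hasDerivAt_id s).pow 2).mul_const (‖y‖ ^ 2)
      simpa using a1.fun_add a2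
    convert h1 using 1
    rw [hℓ]; ring
  have hℓd : ∀ s, HasDerivAt ℓ (‖y‖ ^ 2) s := fun s => by
    have h1 := ((hasDerivAt_id s).mul_const (‖y‖ ^ 2)).const_add (inner ℝ x y)
    rw [one_mul] at h1
    exact h1
  set F : ℝ → ℝ := fun s => -(4 / R ^ 2) * (ℓ s / (1 + Q s / R ^ 2) ^ 3) with hF
  have hFn : ∀ s : ℝ, inner ℝ (cutoffGrad R (x + s • y)) y = F s := fun s => by
    rw [cutoffGrad, inner_smul_left, hℓn, hQn, hF]
    simp only [conj_trivial]
    ring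
  have hFd : ∀ s, HasDerivAt F (-(4 / R ^ 2) * ((‖y‖ ^ 2 * (1 + Q s / R ^ 2) ^ 3 -
      ℓ s * (3 * (1 + Q s / R ^ 2) ^ 2 * (2 * ℓ s / R ^ 2))) / ((1 + Q s / R ^ 2) ^ 3) ^ 2)) s := by
    intro s
    have h1 := (((hQd s).div_const (R ^ 2)).const_add 1).fun_pow 3
    have h2 := ((hℓd s).fun_div h1 (pow_pos (hbase s) 3).ne').const_mul (-(4 / R ^ 2))
    exact h2
  have hFb : ∀ s ∈ Set.Ico (0:ℝ) 1, ‖-(4 / R ^ 2) * ((‖y‖ ^ 2 * (1 + Q s / R ^ 2) ^ 3 -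
      ℓ s * (3 * (1 + Q s / R ^ 2) ^ 2 * (2 * ℓ s / R ^ 2))) / ((1 + Q s / R ^ 2) ^ 3) ^ 2)‖ ≤
      112 / R ^ 2 * ‖y‖ ^ 2 * (1 + ‖y‖ ^ 2 / R ^ 2) ^ 2 * cutoff R x := by
    intro s hs
    have hw := hbase s
    have hQ0 : 0 ≤ Q s := by rw [← hQn]; positivity
    have hℓQ : ℓ s ^ 2 ≤ Q s * ‖y‖ ^ 2 := by
      rw [← hℓn, ← hQn, ← mul_pow, ← sq_abs]
      gcongr
      exact abs_real_inner_le_norm _ _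
    have htr := cutoff_translate_le (R := R) x y (s := s) (by nlinarith [hs.1, hs.2])
    have hcw : cutoff R (x + s • y) = ((1 + Q s / R ^ 2) ^ 2)⁻¹ := by rw [cutoff, hQn]
    set w := 1 + Q s / R ^ 2 with hwd
    have hw1 : 1 ≤ w := by have : 0 ≤ Q s / R ^ 2 := by positivity
                           linarith
    have hℓw : ℓ s ^ 2 / R ^ 2 ≤ w * ‖y‖ ^ 2 := by
      calc ℓ s ^ 2 / R ^ 2 ≤ Q s * ‖y‖ ^ 2 / R ^ 2 := by gcongr
        _ = (Q s / R ^ 2) * ‖y‖ ^ 2 := by ring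
        _ ≤ _ := by gcongr; linarith
    have e1 : (‖y‖ ^ 2 * w ^ 3 - ℓ s * (3 * w ^ 2 * (2 * ℓ s / R ^ 2))) / (w ^ 3) ^ 2 =
        (‖y‖ ^ 2 * w - 6 * (ℓ s ^ 2 / R ^ 2)) / w ^ 4 := by field_simp; ring
    have e2 : |‖y‖ ^ 2 * w - 6 * (ℓ s ^ 2 / R ^ 2)| ≤ 7 * (‖y‖ ^ 2 * w) := by
      have : 0 ≤ ℓ s ^ 2 / R ^ 2 := by positivity
      rw [abs_le]; constructor <;> nlinarith
    rw [e1, Real.norm_eq_abs, abs_mul, abs_neg, abs_of_nonneg (by positivity : 0 ≤ 4 / R ^ 2),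
      abs_div, abs_of_nonneg (by positivity : 0 ≤ w ^ 4)]
    calc 4 / R ^ 2 * (|‖y‖ ^ 2 * w - 6 * (ℓ s ^ 2 / R ^ 2)| / w ^ 4)
        ≤ 4 / R ^ 2 * (7 * (‖y‖ ^ 2 * w) / w ^ 4) := by gcongr
      _ = 28 / R ^ 2 * ‖y‖ ^ 2 * ((w ^ 2)⁻¹ * w⁻¹) := by field_simp; ring
      _ ≤ 28 / R ^ 2 * ‖y‖ ^ 2 * ((w ^ 2)⁻¹ * 1) := by
          gcongr; exact inv_le_one_of_one_le₀ hw1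
      _ = 28 / R ^ 2 * ‖y‖ ^ 2 * cutoff R (x + s • y) := by rw [hcw, mul_one]
      _ ≤ 28 / R ^ 2 * ‖y‖ ^ 2 * (4 * (1 + ‖y‖ ^ 2 / R ^ 2) ^ 2 * cutoff R x) := by gcongr
      _ = _ := by ring
  have h := norm_image_sub_le_of_norm_deriv_le_segment_01' (f := F)
    (fun s _ => (hFd s).hasDerivWithinAt) hFb
  rw [← hFn, ← hFn] at h
  simp only [one_smul, zero_smul, add_zero] at h
  rw [inner_sub_left]
  exact h

theorem abs_inner_cutoffGrad_le {R : ℝ} (hR : 0 < R) (x y : Plane) :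
    |inner ℝ (cutoffGrad R x) y| ≤ 2 / R * ‖y‖ * cutoff R x := by
  refine (abs_real_inner_le_norm _ _).trans ?_
  calc ‖cutoffGrad R x‖ * ‖y‖ ≤ 2 / R * cutoff R x * ‖y‖ := by
        gcongr; exact norm_cutoffGrad_le hR x
    _ = _ := by ring

theorem integrable_norm_cutoffGrad {R : ℝ} (hR : 0 < R) :
    Integrable (fun x => ‖cutoffGrad R x‖) ∧
      ∫ x, ‖cutoffGrad R x‖ ≤ 2 * R * cutoffMass := by
  have h := integrable_cutoff hR
  have hi : Integrable (fun x => ‖cutoffGrad R x‖) :=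
    (h.1.const_mul (2 / R)).mono' (continuous_cutoffGrad R).norm.aestronglyMeasurable
      (.of_forall fun x => by rw [norm_norm]; exact norm_cutoffGrad_le hR x)
  refine ⟨hi, ?_⟩
  calc ∫ x, ‖cutoffGrad R x‖ ≤ ∫ x, 2 / R * cutoff R x :=
        integral_mono hi (h.1.const_mul _) fun x => norm_cutoffGrad_le hR x
    _ = 2 * R * cutoffMass := by
        rw [integral_const_mul, h.2]; field_simp

namespace Profile

variable {N α : ℝ} {u : Plane → ℝ}

theorem integrable_shift_sq (h : Profile N u) (y : Plane) :
    Integrable (fun x => (u x - u (x - y)) ^ 2) ∧ ∫ x, (u x - u (x - y)) ^ 2 ≤ 4 * N := by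
  have hc := h.continuous
  have h1 : Integrable fun x => 2 * u x ^ 2 + 2 * u (x - y) ^ 2 :=
    (h.integrable_sq.const_mul 2).add ((h.integrable_sq.comp_sub_right y).const_mul 2)
  have hle : ∀ x, (u x - u (x - y)) ^ 2 ≤ 2 * u x ^ 2 + 2 * u (x - y) ^ 2 := fun x => by
    nlinarith [sq_nonneg (u x + u (x - y))]
  have hi : Integrable (fun x => (u x - u (x - y)) ^ 2) :=
    h1.mono' (Continuous.aestronglyMeasurable (by fun_prop)) (.of_forall fun x => by
      rw [Real.norm_of_nonneg (sq_nonneg _)]; exact hle x)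
  refine ⟨hi, (integral_mono hi h1 hle).trans ?_⟩
  rw [integral_add (h.integrable_sq.const_mul 2)
    ((h.integrable_sq.comp_sub_right y).const_mul 2), integral_const_mul, integral_const_mul,
    integral_sub_right_eq_self (fun x => u x ^ 2)]
  linarith [h.integral_sq_le]

theorem integral_cutoff_mul_contourKernel (h : Profile N u) (hα : 0 ≤ α) {R : ℝ}
    (hR : 0 < R) {y : Plane} (hy : y ≠ 0) :
    ∫ x, cutoff R x * contourKernel α u x y = -(‖y‖ ^ (-(2 + α)) *
      ∫ x, inner ℝ (cutoffGrad R x) y *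
        slopePrimitive ((3 + α) / 2) ((u x - u (x - y)) / ‖y‖)) := by
  have hr : 0 < ‖y‖ := norm_pos_iff.2 hy
  have hN := h.const_nonneg
  have hc := h.continuous
  have hgc := h.continuous_grad
  have hχc := continuous_cutoff R
  have hχgc := continuous_cutoffGrad R
  have hχi := (integrable_cutoff hR).1
  set p := (3 + α) / 2 with hp
  have hp0 : 0 ≤ p := by rw [hp]; linarith
  set s : Plane → ℝ := fun x => (u x - u (x - y)) / ‖y‖ with hs
  have hsc : Continuous s := by rw [hs]; fun_prop
  have hsN : ∀ x, |s x| ≤ N := fun x => by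
    rw [hs]
    simp only [abs_div, abs_norm]
    rw [div_le_iff₀ hr]
    simpa using h.abs_sub_le x (x - y)
  have hsd : ∀ x, HasFDerivAt s (‖y‖⁻¹ • (InnerProductSpace.toDual ℝ Plane (∇ u x) -
      InnerProductSpace.toDual ℝ Plane (∇ u (x - y)))) x := fun x => by
    have h1 : HasFDerivAt (fun x => u (x - y))
        (InnerProductSpace.toDual ℝ Plane (∇ u (x - y))) x :=
      (hasFDerivAt_comp_sub y).2 (h.hasGradientAt (x - y)).hasFDerivAt
    have h2 := ((h.hasGradientAt x).hasFDerivAt.fun_sub h1).const_smul ‖y‖⁻¹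
    refine h2.congr_of_eventuallyEq (.of_forall fun z => ?_)
    simp [hs, div_eq_inv_mul]
  set g' : Plane → (Plane →L[ℝ] ℝ) := fun x => ((1 + s x ^ 2) ^ (-p)) •
    (‖y‖⁻¹ • (InnerProductSpace.toDual ℝ Plane (∇ u x) -
      InnerProductSpace.toDual ℝ Plane (∇ u (x - y)))) with hg'
  have hgd : ∀ x, HasFDerivAt (fun x => slopePrimitive p (s x)) (g' x) x := fun x =>
    (hasDerivAt_slopePrimitive p (s x)).comp_hasFDerivAt x (hsd x)
  have hGc : Continuous fun x => slopePrimitive p (s x) :=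
    (continuous_slopePrimitive p).comp hsc
  have hGN : ∀ x, |slopePrimitive p (s x)| ≤ N := fun x =>
    (abs_slopePrimitive_le hp0 _).trans (hsN x)
  have hg'y : ∀ x, g' x y = (1 + s x ^ 2) ^ (-p) *
      (‖y‖⁻¹ * inner ℝ (∇ u x - ∇ u (x - y)) y) := fun x => by
    simp [hg', inner_sub_left]
  have hg'c : Continuous fun x => (1 + s x ^ 2) ^ (-p) *
      (‖y‖⁻¹ * inner ℝ (∇ u x - ∇ u (x - y)) y) :=
    ((continuous_slope p).comp hsc).mul (by fun_prop)
  have hg'N : ∀ x, |g' x y| ≤ N * ‖y‖ := fun x => by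
    rw [hg'y, abs_mul, abs_mul, abs_of_nonneg (by positivity : 0 ≤ (1 + s x ^ 2) ^ (-p)),
      abs_of_nonneg (by positivity : 0 ≤ ‖y‖⁻¹)]
    have h1 : |inner ℝ (∇ u x - ∇ u (x - y)) y| ≤ N * ‖y‖ * ‖y‖ :=
      (abs_real_inner_le_norm _ _).trans (by
        gcongr; simpa using h.grad_lipschitz x (x - y))
    calc (1 + s x ^ 2) ^ (-p) * (‖y‖⁻¹ * |inner ℝ (∇ u x - ∇ u (x - y)) y|)
        ≤ 1 * (‖y‖⁻¹ * (N * ‖y‖ * ‖y‖)) := by gcongr; exact slope_le_one hp0 _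
      _ = N * ‖y‖ := by field_simp
  have hK : ∀ x, contourKernel α u x y = ‖y‖ ^ (-(2 + α)) * g' x y := fun x => by
    have e1 : ‖y‖ ^ 2 + (u x - u (x - y)) ^ 2 = ‖y‖ ^ 2 * (1 + s x ^ 2) := by
      simp only [hs]; field_simp
    have e2 : (‖y‖ ^ 2) ^ p = ‖y‖ ^ (2 + α) * ‖y‖ := by
      rw [← Real.rpow_natCast, ← Real.rpow_mul hr.le, ← Real.rpow_add_one hr.ne']
      congr 1; rw [hp]; push_cast; ring
    rw [hg'y, contourKernel, ← hp, e1, Real.mul_rpow (by positivity) (by positivity), e2,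
      Real.rpow_neg hr.le, Real.rpow_neg (by positivity)]
    have : (1 + s x ^ 2) ^ p ≠ 0 := by positivity
    have : ‖y‖ ^ (2 + α) ≠ 0 := by positivity
    field_simp
  have hibp := integral_bilinear_hasFDerivAt_right_eq_neg_left_of_integrable
    (μ := (volume : Measure Plane)) (B := ContinuousLinearMap.mul ℝ ℝ) (v := y)
    (f := cutoff R) (f' := fun x => InnerProductSpace.toDual ℝ Plane (cutoffGrad R x))
    (g := fun x => slopePrimitive p (s x)) (g' := g')
    (by
      simp only [ContinuousLinearMap.mul_apply', InnerProductSpace.toDual_apply_apply]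
      refine (hχi.const_mul (2 / R * ‖y‖ * N)).mono'
        (Continuous.aestronglyMeasurable (by fun_prop)) (.of_forall fun x => ?_)
      rw [Real.norm_eq_abs, abs_mul]
      calc _ ≤ 2 / R * ‖y‖ * cutoff R x * N := by
            have := cutoff_nonneg R x
            exact mul_le_mul (abs_inner_cutoffGrad_le hR x y) (hGN x) (abs_nonneg _)
              (by positivity)
        _ = _ := by ring)
    (by
      simp only [ContinuousLinearMap.mul_apply']
      refine (hχi.mul_const (N * ‖y‖)).mono'
        (Continuous.aestronglyMeasurable (by simp_rw [hg'y]; fun_prop)) (.of_forall fun x => ?_)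
      rw [Real.norm_eq_abs, abs_mul, abs_of_nonneg (cutoff_nonneg R x)]
      exact mul_le_mul_of_nonneg_left (hg'N x) (cutoff_nonneg R x))
    (by
      simp only [ContinuousLinearMap.mul_apply']
      refine (hχi.mul_const N).mono'
        (Continuous.aestronglyMeasurable (by fun_prop)) (.of_forall fun x => ?_)
      rw [Real.norm_eq_abs, abs_mul, abs_of_nonneg (cutoff_nonneg R x)]
      exact mul_le_mul_of_nonneg_left (hGN x) (cutoff_nonneg R x))
    (fun x _ => (hasGradientAt_cutoff R x).hasFDerivAt) (fun x _ => hgd x)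
  simp only [ContinuousLinearMap.mul_apply', InnerProductSpace.toDual_apply_apply] at hibp
  rw [← mul_neg, ← hibp, ← integral_const_mul]
  refine integral_congr_ae (.of_forall fun x => ?_)
  simp only [hK]
  ring

theorem integrable_inner_cutoffGrad_mul (h : Profile N u) {R : ℝ} (hR : 0 < R) (y z w : Plane) :
    Integrable fun x => inner ℝ (cutoffGrad R (x + w)) y * u (x - z) := by
  have hc := h.continuous
  have hχgc := continuous_cutoffGrad R
  have hχi := ((integrable_cutoff hR).1.comp_add_right w)
  refine (hχi.const_mul (2 / R * ‖y‖ * N)).mono'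
    (Continuous.aestronglyMeasurable (by fun_prop)) (.of_forall fun x => ?_)
  rw [Real.norm_eq_abs, abs_mul]
  have hN := h.const_nonneg
  have := cutoff_nonneg R (x + w)
  calc _ ≤ 2 / R * ‖y‖ * cutoff R (x + w) * N := by
        gcongr
        · exact abs_inner_cutoffGrad_le hR _ y
        · exact h.abs_le _
    _ = _ := by ring

/-- The weighted flux is, up to a quadratic error, linear in the profile. -/
theorem abs_integral_cutoff_mul_contourKernel_add_le (h : Profile N u) (hα : 0 ≤ α)
    (hα1 : α < 1) {R : ℝ} (hR : 0 < R) {y : Plane} (hy : y ≠ 0) :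
    |(∫ x, cutoff R x * contourKernel α u x y) + ‖y‖ ^ (-(3 + α)) *
        ∫ x, inner ℝ (cutoffGrad R x) y * (u x - u (x - y))| ≤
      2 / R * (‖y‖ ^ (-(3 + α)) * ∫ x, (u x - u (x - y)) ^ 2) := by
  have hr : 0 < ‖y‖ := norm_pos_iff.2 hy
  have hN := h.const_nonneg
  have hc := h.continuous
  have hχgc := continuous_cutoffGrad R
  have hχi := (integrable_cutoff hR).1
  set p := (3 + α) / 2 with hp
  have hp0 : 0 ≤ p := by rw [hp]; linarith
  have hp2 : p ≤ 2 := by rw [hp]; linarith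
  have hGc := continuous_slopePrimitive p
  have e0 : ‖y‖ ^ (-(2 + α)) = ‖y‖ ^ (-(3 + α)) * ‖y‖ := by
    rw [← Real.rpow_add_one hr.ne']; congr 1; ring
  have hbd : ∀ x, |inner ℝ (cutoffGrad R x) y *
      (slopePrimitive p ((u x - u (x - y)) / ‖y‖) - (u x - u (x - y)) / ‖y‖)| ≤
      2 / R * ‖y‖⁻¹ * (u x - u (x - y)) ^ 2 := fun x => by
    rw [abs_mul]
    have h1 := abs_inner_cutoffGrad_le hR x y
    have h2 : 2 / R * ‖y‖ * cutoff R x ≤ 2 / R * ‖y‖ :=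
      mul_le_of_le_one_right (by positivity) (cutoff_le_one R x)
    calc _ ≤ 2 / R * ‖y‖ * ((u x - u (x - y)) / ‖y‖) ^ 2 := by
          gcongr
          · exact h1.trans h2
          · exact abs_slopePrimitive_sub_le hp0 hp2 _
      _ = _ := by field_simp
  have hiδ : Integrable fun x => inner ℝ (cutoffGrad R x) y * ((u x - u (x - y)) / ‖y‖) := by
    have h1 := h.integrable_inner_cutoffGrad_mul hR y 0 0
    have h2 := h.integrable_inner_cutoffGrad_mul hR y y 0
    refine ((h1.sub h2).mul_const ‖y‖⁻¹).congr (.of_forall fun x => ?_)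
    simp
    ring
  have hid : Integrable fun x => inner ℝ (cutoffGrad R x) y *
      (slopePrimitive p ((u x - u (x - y)) / ‖y‖) - (u x - u (x - y)) / ‖y‖) :=
    ((h.integrable_shift_sq y).1.const_mul (2 / R * ‖y‖⁻¹)).mono'
      (Continuous.aestronglyMeasurable (by fun_prop)) (.of_forall fun x => hbd x)
  have e1 : (∫ x, cutoff R x * contourKernel α u x y) + ‖y‖ ^ (-(3 + α)) *
        ∫ x, inner ℝ (cutoffGrad R x) y * (u x - u (x - y)) =
      -(‖y‖ ^ (-(3 + α)) * ‖y‖ * ∫ x, inner ℝ (cutoffGrad R x) y *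
        (slopePrimitive p ((u x - u (x - y)) / ‖y‖) - (u x - u (x - y)) / ‖y‖)) := by
    have e2 : ∫ x, inner ℝ (cutoffGrad R x) y * (u x - u (x - y)) =
        ‖y‖ * ∫ x, inner ℝ (cutoffGrad R x) y * ((u x - u (x - y)) / ‖y‖) := by
      rw [← integral_const_mul]
      refine integral_congr_ae (.of_forall fun x => ?_)
      simp only
      field_simp
    have e3 : ∫ x, inner ℝ (cutoffGrad R x) y *
        slopePrimitive p ((u x - u (x - y)) / ‖y‖) =
        (∫ x, inner ℝ (cutoffGrad R x) y *
        (slopePrimitive p ((u x - u (x - y)) / ‖y‖) - (u x - u (x - y)) / ‖y‖)) +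
        ∫ x, inner ℝ (cutoffGrad R x) y * ((u x - u (x - y)) / ‖y‖) := by
      rw [← integral_add hid hiδ]
      refine integral_congr_ae (.of_forall fun x => ?_)
      simp only
      ring
    rw [h.integral_cutoff_mul_contourKernel hα hR hy, ← hp, e0, e2, e3]
    ring
  rw [e1, abs_neg, abs_mul, abs_of_nonneg (by positivity : 0 ≤ ‖y‖ ^ (-(3 + α)) * ‖y‖)]
  calc _ ≤ ‖y‖ ^ (-(3 + α)) * ‖y‖ * (2 / R * ‖y‖⁻¹ * ∫ x, (u x - u (x - y)) ^ 2) := by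
        gcongr
        rw [← integral_const_mul, ← Real.norm_eq_abs]
        exact norm_integral_le_of_norm_le ((h.integrable_shift_sq y).1.const_mul _)
          (.of_forall fun x => hbd x)
    _ = _ := by field_simp

end Profile

/-- An integrable majorant of `|y|^{-(3+α)} ‖u - u(· - y)‖₂²`. -/
def shiftWeight (N α : ℝ) (y : Plane) : ℝ :=
  {y : Plane | ‖y‖ ≤ 1}.indicator (fun y => N * ‖y‖ ^ (-(1 + α))) y +
    {y : Plane | 1 < ‖y‖}.indicator (fun y => 4 * N * ‖y‖ ^ (-(3 + α))) y

theorem shiftWeight_nonneg {N : ℝ} (hN : 0 ≤ N) (α : ℝ) (y : Plane) : 0 ≤ shiftWeight N α y :=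
  add_nonneg (Set.indicator_nonneg (fun _ _ => by positivity) _)
    (Set.indicator_nonneg (fun _ _ => by positivity) _)

theorem integrable_shiftWeight (N : ℝ) {α : ℝ} (hα : 0 ≤ α) (hα1 : α < 1) :
    Integrable (shiftWeight N α) := by
  have h1 := (integral_norm_rpow_le (s := 1 + α) (by linarith) zero_le_one).1.const_mul N
  have h2 := (integral_norm_rpow_far (s := 3 + α) (by linarith) one_pos).1.const_mul (4 * N)
  exact ((integrable_indicator_iff (measurableSet_le (by fun_prop) (by fun_prop))).2 h1).add
    ((integrable_indicator_iff (measurableSet_lt (by fun_prop) (by fun_prop))).2 h2)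

theorem Profile.shift_sq_le_shiftWeight {N : ℝ} {u : Plane → ℝ} (h : Profile N u) (α : ℝ)
    {y : Plane} (hy : y ≠ 0) :
    ‖y‖ ^ (-(3 + α)) * ∫ x, (u x - u (x - y)) ^ 2 ≤ shiftWeight N α y := by
  have hr : 0 < ‖y‖ := norm_pos_iff.2 hy
  rcases le_or_gt ‖y‖ 1 with h1 | h1
  · have e : ‖y‖ ^ (-(1 + α)) = ‖y‖ ^ (-(3 + α)) * ‖y‖ ^ 2 := by
      rw [← Real.rpow_natCast, ← Real.rpow_add hr]; congr 1; push_cast; ring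
    simp only [shiftWeight, Set.indicator, Set.mem_ofPred_eq, h1, not_lt.2 h1, if_true, if_false,
      add_zero]
    rw [e]
    calc _ ≤ ‖y‖ ^ (-(3 + α)) * (N * ‖y‖ ^ 2) := by gcongr; exact h.integral_shift_sq_le y
      _ = _ := by ring
  · simp only [shiftWeight, Set.indicator, Set.mem_ofPred_eq, h1, not_le.2 h1, if_true, if_false,
      zero_add]
    calc _ ≤ ‖y‖ ^ (-(3 + α)) * (4 * N) := by gcongr; exact (h.integrable_shift_sq y).2
      _ = _ := by ring

/-- Rate constant in the weighted flux bound. -/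
def fluxRate (α : ℝ) : ℝ := 448 * (circleLen / (1 - α))

/-- Error constant in the weighted flux bound. -/
def fluxError (N α : ℝ) : ℝ :=
  4 * (∫ y, shiftWeight N α y) + 2 * cutoffMass * (circleLen + N)

theorem fluxRate_nonneg {α : ℝ} (hα1 : α < 1) : 0 ≤ fluxRate α := by
  have := circleLen_nonneg
  have : 0 < 1 - α := by linarith
  unfold fluxRate; positivity

theorem fluxError_nonneg {N : ℝ} (hN : 0 ≤ N) (α : ℝ) : 0 ≤ fluxError N α := by
  have h1 := circleLen_nonneg
  have h2 := cutoffMass_nonneg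
  have h3 : 0 ≤ ∫ y, shiftWeight N α y := integral_nonneg (shiftWeight_nonneg hN α)
  unfold fluxError; positivity

namespace Profile

variable {N α : ℝ} {u : Plane → ℝ}

theorem integrable_cutoff_mul (h : Profile N u) {R : ℝ} (hR : 0 < R) :
    Integrable fun x => cutoff R x * u x := by
  have := continuous_cutoff R
  have := h.continuous
  refine ((integrable_cutoff hR).1.mul_const N).mono'
    (Continuous.aestronglyMeasurable (by fun_prop)) (.of_forall fun x => ?_)
  rw [Real.norm_eq_abs, abs_mul, abs_of_nonneg (cutoff_nonneg R x)]
  exact mul_le_mul_of_nonneg_left (h.abs_le x) (cutoff_nonneg R x)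

theorem integrable_cutoff_mul_contourKernel (h : Profile N u) (hα : 0 ≤ α) (hα1 : α < 1)
    {R S : ℝ} (hR : 0 < R) (hS : 0 ≤ S) {E : Set Plane} (hE : E ⊆ {y | ‖y‖ ≤ S}) :
    Integrable (fun z : Plane × Plane => cutoff R z.1 * contourKernel α u z.1 z.2)
      (volume.prod (volume.restrict E)) := by
  have h1 : Integrable (fun y : Plane => N * ‖y‖ ^ (-(1 + α))) (volume.restrict E) :=
    ((integral_norm_rpow_le (s := 1 + α) (by linarith) hS).1.mono_set hE).const_mul N
  refine ((integrable_cutoff hR).1.mul_prod h1).mono'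
    (Measurable.aestronglyMeasurable ?_) (.of_forall fun z => ?_)
  · exact ((continuous_cutoff R).measurable.comp measurable_fst).mul h.measurable_contourKernel
  · rw [Real.norm_eq_abs, abs_mul, abs_of_nonneg (cutoff_nonneg R _)]
    exact mul_le_mul_of_nonneg_left (h.abs_contourKernel_le hα _ _) (cutoff_nonneg R _)

theorem abs_weighted_kernel_near_le (h : Profile N u) (hu : ∀ x, 0 ≤ u x) (hα : 0 ≤ α)
    (hα1 : α < 1) {R K : ℝ} (hR : 0 < R) (hK : 1 ≤ K) {y : Plane} (hy : y ≠ 0)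
    (hyL : ‖y‖ ≤ R * K) :
    |∫ x, cutoff R x * contourKernel α u x y| ≤
      448 * K ^ 4 / R ^ 2 * (∫ x, cutoff R x * u x) * ‖y‖ ^ (-(1 + α)) +
        2 / R * shiftWeight N α y := by
  have hr : 0 < ‖y‖ := norm_pos_iff.2 hy
  have h1 := h.abs_integral_cutoff_mul_contourKernel_add_le hα hα1 hR hy
  have h2 := h.shift_sq_le_shiftWeight α hy
  have i1 := h.integrable_inner_cutoffGrad_mul hR y 0 0
  have i2 := h.integrable_inner_cutoffGrad_mul hR y y 0
  have i3 := h.integrable_inner_cutoffGrad_mul hR y 0 y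
  simp only [add_zero, sub_zero] at i1 i2 i3
  have e : ∫ x, inner ℝ (cutoffGrad R x) y * (u x - u (x - y)) =
      -∫ x, inner ℝ (cutoffGrad R (x + y) - cutoffGrad R x) y * u x := by
    have e1 : ∫ x, inner ℝ (cutoffGrad R x) y * u (x - y) =
        ∫ x, inner ℝ (cutoffGrad R (x + y)) y * u x := by
      rw [← integral_sub_right_eq_self (fun x => inner ℝ (cutoffGrad R (x + y)) y * u x) y]
      simp only [sub_add_cancel]
    simp_rw [mul_sub, inner_sub_left, sub_mul]
    rw [integral_sub i1 i2, integral_sub i3 i1, e1]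
    ring
  have hlin : |∫ x, inner ℝ (cutoffGrad R x) y * (u x - u (x - y))| ≤
      448 * K ^ 4 / R ^ 2 * ‖y‖ ^ 2 * ∫ x, cutoff R x * u x := by
    rw [e, abs_neg, ← integral_const_mul, ← Real.norm_eq_abs]
    refine norm_integral_le_of_norm_le ((h.integrable_cutoff_mul hR).const_mul _)
      (.of_forall fun x => ?_)
    rw [Real.norm_eq_abs, abs_mul, abs_of_nonneg (hu x), ← mul_assoc]
    refine mul_le_mul_of_nonneg_right ((abs_inner_cutoffGrad_sub_le hR x y).trans ?_) (hu x)
    refine mul_le_mul_of_nonneg_right ?_ (cutoff_nonneg R x)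
    have hq : ‖y‖ ^ 2 / R ^ 2 ≤ K ^ 2 := by
      rw [← div_pow]
      gcongr
      rw [div_le_iff₀ hR]; linarith
    have hK2 : 1 ≤ K ^ 2 := one_le_pow₀ hK
    calc 112 / R ^ 2 * ‖y‖ ^ 2 * (1 + ‖y‖ ^ 2 / R ^ 2) ^ 2
        ≤ 112 / R ^ 2 * ‖y‖ ^ 2 * (2 * K ^ 2) ^ 2 := by gcongr; linarith
      _ = _ := by ring
  have e3 : ‖y‖ ^ (-(1 + α)) = ‖y‖ ^ (-(3 + α)) * ‖y‖ ^ 2 := by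
    rw [← Real.rpow_natCast, ← Real.rpow_add hr]; congr 1; push_cast; ring
  have h4 : |‖y‖ ^ (-(3 + α)) * ∫ x, inner ℝ (cutoffGrad R x) y * (u x - u (x - y))| ≤
      448 * K ^ 4 / R ^ 2 * (∫ x, cutoff R x * u x) * ‖y‖ ^ (-(1 + α)) := by
    rw [abs_mul, abs_of_nonneg (by positivity : 0 ≤ ‖y‖ ^ (-(3 + α))), e3]
    calc _ ≤ ‖y‖ ^ (-(3 + α)) * (448 * K ^ 4 / R ^ 2 * ‖y‖ ^ 2 * ∫ x, cutoff R x * u x) := by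
          gcongr
      _ = _ := by ring
  have h5 : 2 / R * (‖y‖ ^ (-(3 + α)) * ∫ x, (u x - u (x - y)) ^ 2) ≤
      2 / R * shiftWeight N α y := by gcongr
  obtain ⟨a1, a2⟩ := _root_.abs_le.1 h1
  obtain ⟨b1, b2⟩ := _root_.abs_le.1 h4
  exact _root_.abs_le.2 ⟨by linarith, by linarith⟩

/-- Tail majorant of the linear part of the weighted flux. -/
def tailWeight (L R : ℝ) (u : Plane → ℝ) (y : Plane) : ℝ :=
  L / 2 * (∫ x, ‖cutoffGrad R x‖) * ‖y‖ ^ (-4 : ℝ) +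
    1 / (2 * L) * ∫ x, ‖cutoffGrad R x‖ * u (x - y) ^ 2

theorem tailWeight_nonneg {L : ℝ} (hL : 0 ≤ L) (R : ℝ) (u : Plane → ℝ) (y : Plane) :
    0 ≤ tailWeight L R u y := by
  have h1 : 0 ≤ ∫ x, ‖cutoffGrad R x‖ := integral_nonneg fun x => norm_nonneg _
  have h2 : 0 ≤ ∫ x, ‖cutoffGrad R x‖ * u (x - y) ^ 2 := integral_nonneg fun x => by positivity
  unfold tailWeight; positivity

theorem integral_tailWeight_le (h : Profile N u) {L R : ℝ} (hL : 0 < L) (hR : 0 < R) :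
    IntegrableOn (tailWeight L R u) {y | L < ‖y‖} ∧
      ∫ y in {y : Plane | L < ‖y‖}, tailWeight L R u y ≤
        2 * R * cutoffMass * (circleLen + N) / L := by
  have hg := integrable_norm_cutoffGrad hR
  have hcm := cutoffMass_nonneg
  have hcl := circleLen_nonneg
  have hN := h.const_nonneg
  have hf := integral_norm_rpow_far (s := 4) (by norm_num) hL
  have hui : Integrable fun x => u (-x) ^ 2 := h.integrable_sq.comp_neg
  have hconv : ∀ y, ∫ x, ‖cutoffGrad R x‖ * u (x - y) ^ 2 =
      convolution (fun x => ‖cutoffGrad R x‖) (fun x => u (-x) ^ 2)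
        (ContinuousLinearMap.mul ℝ ℝ) volume y := fun y => by
    simp [convolution]
  have hci := hg.1.integrable_convolution (ContinuousLinearMap.mul ℝ ℝ) hui
  have hcint := integral_convolution (ContinuousLinearMap.mul ℝ ℝ) hg.1 hui
  simp only [ContinuousLinearMap.mul_apply'] at hcint
  rw [integral_neg_eq_self (fun x => u x ^ 2)] at hcint
  have i1 := hf.1.const_mul (L / 2 * (∫ x, ‖cutoffGrad R x‖))
  have i2 := (hci.const_mul (1 / (2 * L)))
  have ew : tailWeight L R u = fun y => L / 2 * (∫ x, ‖cutoffGrad R x‖) * ‖y‖ ^ (-4 : ℝ) +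
      1 / (2 * L) * convolution (fun x => ‖cutoffGrad R x‖) (fun x => u (-x) ^ 2)
        (ContinuousLinearMap.mul ℝ ℝ) volume y := by
    ext y; rw [tailWeight, hconv]
  rw [ew]
  refine ⟨i1.add i2.integrableOn, ?_⟩
  rw [integral_add i1 i2.integrableOn, integral_const_mul, hf.2]
  have h3 : ∫ y in {y : Plane | L < ‖y‖}, 1 / (2 * L) *
      convolution (fun x => ‖cutoffGrad R x‖) (fun x => u (-x) ^ 2)
        (ContinuousLinearMap.mul ℝ ℝ) volume y ≤ 1 / (2 * L) * ((2 * R * cutoffMass) * N) := by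
    refine (setIntegral_le_integral i2 (.of_forall fun y => ?_)).trans ?_
    · simp only [Pi.zero_apply]
      rw [← hconv]
      have : 0 ≤ ∫ x, ‖cutoffGrad R x‖ * u (x - y) ^ 2 := integral_nonneg fun x => by positivity
      positivity
    · rw [integral_const_mul, hcint]
      have : 0 ≤ ∫ x, u x ^ 2 := integral_nonneg fun x => by positivity
      gcongr
      · exact hg.2
      · exact h.integral_sq_le
  have e2 : L ^ ((2:ℝ) - 4) = (L ^ 2)⁻¹ := by
    rw [show (2:ℝ) - 4 = -((2:ℕ):ℝ) by norm_num, Real.rpow_neg hL.le, Real.rpow_natCast]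
  have h4 : L / 2 * (∫ x, ‖cutoffGrad R x‖) * (circleLen * (L ^ ((2:ℝ) - 4) / (4 - 2))) ≤
      L / 2 * (2 * R * cutoffMass) * (circleLen * (L ^ ((2:ℝ) - 4) / (4 - 2))) := by
    rw [e2]
    have : (0:ℝ) < 4 - 2 := by norm_num
    gcongr
    exact hg.2
  refine (add_le_add h4 h3).trans ?_
  have e3 : L / 2 * (2 * R * cutoffMass) * (circleLen * ((L ^ 2)⁻¹ / (4 - 2))) +
      1 / (2 * L) * (2 * R * cutoffMass * N) =
      2 * R * cutoffMass * (circleLen / 4 + N / 2) / L := by field_simp; ring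
  rw [e2, e3]
  gcongr <;> linarith

theorem abs_weighted_kernel_far_le (h : Profile N u) (hα : 0 ≤ α)
    (hα1 : α < 1) {R L : ℝ} (hR : 0 < R) (hL : 1 ≤ L) {y : Plane} (hyL : L < ‖y‖) :
    |(∫ x, cutoff R x * contourKernel α u x y) +
      ‖y‖ ^ (-(3 + α)) * ∫ x, inner ℝ (cutoffGrad R x) y * u x| ≤
      2 / R * shiftWeight N α y + tailWeight L R u y := by
  have hr : 0 < ‖y‖ := by linarith
  have hy : y ≠ 0 := norm_pos_iff.1 hr
  have h1 := h.abs_integral_cutoff_mul_contourKernel_add_le hα hα1 hR hy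
  have h2 := h.shift_sq_le_shiftWeight α hy
  have i1 := h.integrable_inner_cutoffGrad_mul hR y 0 0
  have i2 := h.integrable_inner_cutoffGrad_mul hR y y 0
  simp only [add_zero, sub_zero] at i1 i2
  have e : ∫ x, inner ℝ (cutoffGrad R x) y * (u x - u (x - y)) =
      (∫ x, inner ℝ (cutoffGrad R x) y * u x) - ∫ x, inner ℝ (cutoffGrad R x) y * u (x - y) := by
    simp_rw [mul_sub]
    rw [integral_sub i1 i2]
  have hg := (integrable_norm_cutoffGrad hR).1
  have hgu : Integrable fun x => ‖cutoffGrad R x‖ * u (x - y) ^ 2 := by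
    have := h.continuous
    have := continuous_cutoffGrad R
    refine (hg.mul_const (N ^ 2)).mono' (Continuous.aestronglyMeasurable (by fun_prop))
      (.of_forall fun x => ?_)
    rw [Real.norm_of_nonneg (by positivity), ← sq_abs (u (x - y))]
    gcongr
    exact h.abs_le _
  have h3 : |‖y‖ ^ (-(3 + α)) * ∫ x, inner ℝ (cutoffGrad R x) y * u (x - y)| ≤
      tailWeight L R u y := by
    have et : tailWeight L R u y = ∫ x, (L / 2 * ‖y‖ ^ (-4 : ℝ) * ‖cutoffGrad R x‖ +
        1 / (2 * L) * (‖cutoffGrad R x‖ * u (x - y) ^ 2)) := by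
      rw [integral_add (hg.const_mul _) (hgu.const_mul _), integral_const_mul,
        integral_const_mul, tailWeight]
      ring
    rw [et, ← integral_const_mul, ← Real.norm_eq_abs]
    refine norm_integral_le_of_norm_le ((hg.const_mul _).add (hgu.const_mul _))
      (.of_forall fun x => ?_)
    have e4 : ‖y‖ ^ (-(3 + α)) * ‖y‖ ≤ (‖y‖ ^ 2)⁻¹ := by
      rw [← Real.rpow_add_one hr.ne', ← Real.rpow_natCast, ← Real.rpow_neg hr.le]
      refine Real.rpow_le_rpow_of_exponent_le (by linarith) ?_
      push_cast; linarith
    have e5 : ‖y‖ ^ (-4 : ℝ) = ((‖y‖ ^ 2)⁻¹) ^ 2 := by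
      rw [show (-4:ℝ) = -((4:ℕ):ℝ) by norm_num, Real.rpow_neg hr.le, Real.rpow_natCast, inv_pow]
      ring
    rw [Real.norm_eq_abs, abs_mul, abs_mul, abs_of_nonneg (by positivity : 0 ≤ ‖y‖ ^ (-(3 + α)))]
    have e6 : (‖y‖ ^ 2)⁻¹ * |u (x - y)| ≤
        L / 2 * ((‖y‖ ^ 2)⁻¹) ^ 2 + 1 / (2 * L) * u (x - y) ^ 2 := by
      have hL0 : 0 < L := by linarith
      have h7 := sq_nonneg (L * (‖y‖ ^ 2)⁻¹ - |u (x - y)|)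
      rw [← sq_abs (u (x - y))]
      have e8 : L / 2 * ((‖y‖ ^ 2)⁻¹) ^ 2 + 1 / (2 * L) * |u (x - y)| ^ 2 -
        (‖y‖ ^ 2)⁻¹ * |u (x - y)| = 1 / (2 * L) * (L * (‖y‖ ^ 2)⁻¹ - |u (x - y)|) ^ 2 := by
        field_simp; ring
      have : 0 ≤ 1 / (2 * L) * (L * (‖y‖ ^ 2)⁻¹ - |u (x - y)|) ^ 2 := by positivity
      linarith
    calc ‖y‖ ^ (-(3 + α)) * (|inner ℝ (cutoffGrad R x) y| * |u (x - y)|)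
        ≤ ‖y‖ ^ (-(3 + α)) * ((‖cutoffGrad R x‖ * ‖y‖) * |u (x - y)|) := by
          gcongr; exact abs_real_inner_le_norm _ _
      _ = ‖cutoffGrad R x‖ * ((‖y‖ ^ (-(3 + α)) * ‖y‖) * |u (x - y)|) := by ring
      _ ≤ ‖cutoffGrad R x‖ * ((‖y‖ ^ 2)⁻¹ * |u (x - y)|) := by gcongr
      _ ≤ ‖cutoffGrad R x‖ * (L / 2 * ((‖y‖ ^ 2)⁻¹) ^ 2 + 1 / (2 * L) * u (x - y) ^ 2) := by
          gcongr
      _ = _ := by rw [e5]; ring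
  have h5 : 2 / R * (‖y‖ ^ (-(3 + α)) * ∫ x, (u x - u (x - y)) ^ 2) ≤
      2 / R * shiftWeight N α y := by gcongr
  rw [e, mul_sub] at h1
  obtain ⟨a1, a2⟩ := _root_.abs_le.1 h1
  obtain ⟨b1, b2⟩ := _root_.abs_le.1 h3
  exact _root_.abs_le.2 ⟨by linarith, by linarith⟩

/-- The truncated flux, integrated against the weight at scale `K⁶`. -/
theorem weighted_flux_le (h : Profile N u) (hu : ∀ x, 0 ≤ u x) (hα : 0 ≤ α)
    (hα1 : α < 1) {K ε S : ℝ} (hK : 1 ≤ K) (hε : 0 < ε) (hεK : ε ≤ 1) (hS : K ^ 7 < S) :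
    Integrable (fun x => cutoff (K ^ 6) x *
      ∫ y in {y : Plane | ε < ‖y‖ ∧ ‖y‖ < S}, contourKernel α u x y) ∧
    ∫ x, cutoff (K ^ 6) x * ∫ y in {y : Plane | ε < ‖y‖ ∧ ‖y‖ < S}, contourKernel α u x y ≤
      fluxRate α / K * (∫ x, cutoff (K ^ 6) x * u x) + fluxError N α / K := by
  have hK0 : 0 < K := by linarith
  set R := K ^ 6 with hRdef
  have hR : 0 < R := by positivity
  have hR1 : 1 ≤ R := one_le_pow₀ hK
  set L := R * K with hLdef
  have hL1 : 1 ≤ L := by nlinarith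
  have hLS : L < S := by rw [hLdef, hRdef]; linarith [pow_succ K 6]
  have hS0 : 0 ≤ S := by linarith
  have hN := h.const_nonneg
  set ann : Set Plane := {y : Plane | ε < ‖y‖ ∧ ‖y‖ < S} with hann
  have hannS : ann ⊆ {y | ‖y‖ ≤ S} := fun y hy => hy.2.le
  have hint := h.integrable_cutoff_mul_contourKernel hα hα1 hR hS0 hannS
  set I : Plane → ℝ := fun y => ∫ x, cutoff R x * contourKernel α u x y with hI
  have hIi : IntegrableOn I ann := hint.integral_prod_right
  have hx : (fun x => cutoff R x * ∫ y in ann, contourKernel α u x y) =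
      fun x => ∫ y in ann, cutoff R x * contourKernel α u x y := by
    ext x; rw [integral_const_mul]
  rw [hx]
  refine ⟨hint.integral_prod_left, ?_⟩
  rw [integral_integral_swap hint]
  set near : Set Plane := {y : Plane | ε < ‖y‖ ∧ ‖y‖ ≤ L} with hnear
  set far : Set Plane := {y : Plane | L < ‖y‖ ∧ ‖y‖ < S} with hfar
  have hnm : MeasurableSet near := measurable_norm measurableSet_Ioc
  have hfm : MeasurableSet far := measurable_norm measurableSet_Ioo
  have hnsub : near ⊆ {y | ‖y‖ ≤ L} := fun y hy => hy.2
  have hfsub : far ⊆ {y | L < ‖y‖} := fun y hy => hy.1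
  have hnann : near ⊆ ann := fun y hy => ⟨hy.1, hy.2.trans_lt hLS⟩
  have hfann : far ⊆ ann := fun y hy => ⟨by linarith [hy.1], hy.2⟩
  have hunion : ann = near ∪ far := by
    refine Set.Subset.antisymm (fun y hy => ?_) (Set.union_subset hnann hfann)
    rcases le_or_gt ‖y‖ L with h1 | h1
    · exact Or.inl ⟨hy.1, h1⟩
    · exact Or.inr ⟨h1, hy.2⟩
  have hdisj : Disjoint near far :=
    Set.disjoint_left.2 fun y hy hy' => absurd hy'.1 (not_lt.2 hy.2)
  have hIn := hIi.mono_set hnann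
  have hIf := hIi.mono_set hfann
  have hsplit : ∫ y in ann, I y = (∫ y in near, I y) + ∫ y in far, I y := by
    rw [hunion, setIntegral_union hdisj hfm hIn hIf]
  have hcl := circleLen_nonneg
  have hcm := cutoffMass_nonneg
  set m := ∫ x, cutoff R x * u x with hm
  have hm0 : 0 ≤ m := integral_nonneg fun x => mul_nonneg (cutoff_nonneg R x) (hu x)
  have hSWi := integrable_shiftWeight N hα hα1
  have hSWn := shiftWeight_nonneg hN α
  set W := ∫ y, shiftWeight N α y with hW
  have hW0 : 0 ≤ W := integral_nonneg hSWn
  have hWle : ∀ E : Set Plane, ∫ y in E, 2 / R * shiftWeight N α y ≤ 2 / R * W := fun E => by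
    rw [integral_const_mul]
    gcongr
    exact setIntegral_le_integral hSWi (.of_forall hSWn)
  have hRK : 1 / R ≤ 1 / K := by
    gcongr
    rw [hRdef]; exact le_self_pow₀ hK (by norm_num)
  have hWK : 2 / R * W ≤ 2 * W / K := by
    calc 2 / R * W = 2 * W * (1 / R) := by ring
      _ ≤ 2 * W * (1 / K) := by gcongr
      _ = _ := by ring
  have hnear : ∫ y in near, I y ≤ fluxRate α / K * m + 2 * W / K := by
    have hp := integral_norm_rpow_le (s := 1 + α) (r := L) (by linarith) (by linarith)
    have ip : IntegrableOn (fun y : Plane => 448 * K ^ 4 / R ^ 2 * m * ‖y‖ ^ (-(1 + α))) near :=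
      (hp.1.mono_set hnsub).const_mul _
    have iw : IntegrableOn (fun y => 2 / R * shiftWeight N α y) near :=
      (hSWi.const_mul _).integrableOn
    have h1 : ∫ y in near, I y ≤
        ∫ y in near, (448 * K ^ 4 / R ^ 2 * m * ‖y‖ ^ (-(1 + α)) + 2 / R * shiftWeight N α y) := by
      refine setIntegral_mono_on hIn (ip.add iw) hnm fun y hy => ?_
      exact (le_abs_self _).trans (h.abs_weighted_kernel_near_le hu hα hα1 hR hK
        (norm_pos_iff.1 (hε.trans hy.1)) hy.2)
    rw [integral_add ip iw, integral_const_mul] at h1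
    have h2 : ∫ y in near, ‖y‖ ^ (-(1 + α)) ≤ circleLen * (L / (1 - α)) := by
      have hα' : 0 < 1 - α := by linarith
      calc ∫ y in near, ‖y‖ ^ (-(1 + α)) ≤ ∫ y in {y : Plane | ‖y‖ ≤ L}, ‖y‖ ^ (-(1 + α)) :=
            setIntegral_mono_set hp.1 (.of_forall fun y => by positivity)
              (.of_forall hnsub)
        _ = circleLen * (L ^ (2 - (1 + α)) / (2 - (1 + α))) := hp.2
        _ ≤ _ := by
            rw [show 2 - (1 + α) = 1 - α by ring]
            gcongr
            calc L ^ (1 - α) ≤ L ^ (1:ℝ) := Real.rpow_le_rpow_of_exponent_le hL1 (by linarith)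
              _ = L := Real.rpow_one L
    have h3 : 448 * K ^ 4 / R ^ 2 * m * ∫ y in near, ‖y‖ ^ (-(1 + α)) ≤ fluxRate α / K * m := by
      calc _ ≤ 448 * K ^ 4 / R ^ 2 * m * (circleLen * (L / (1 - α))) := by gcongr
        _ = _ := by
          have hα' : 1 - α ≠ 0 := by linarith
          rw [hLdef, hRdef, fluxRate]
          field_simp
    linarith [hWle near]
  have hfar : ∫ y in far, I y ≤ 2 * W / K + 2 * cutoffMass * (circleLen + N) / K := by
    have hcg := (integrable_norm_cutoffGrad hR).1
    have hwi : Integrable fun x => u x • cutoffGrad R x := by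
      have := h.continuous
      have := continuous_cutoffGrad R
      refine (hcg.const_mul N).mono' (Continuous.aestronglyMeasurable (by fun_prop))
        (.of_forall fun x => ?_)
      rw [norm_smul]
      exact mul_le_mul_of_nonneg_right (h.abs_le x) (norm_nonneg _)
    set w : Plane := ∫ x, u x • cutoffGrad R x with hw
    have hQ : ∀ y, ∫ x, inner ℝ (cutoffGrad R x) y * u x = inner ℝ w y := fun y => by
      rw [real_inner_comm, hw, ← integral_inner hwi]
      refine integral_congr_ae (.of_forall fun x => ?_)
      simp only [inner_smul_right, real_inner_comm y]
      ring
    have hQi : IntegrableOn (fun y => ‖y‖ ^ (-(3 + α)) * inner ℝ w y) far := by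
      have hp := (integral_norm_rpow_le (s := 1) (r := S) (by norm_num) hS0).1
      refine ((hp.mono_set fun y hy => hannS (hfann hy)).const_mul ‖w‖).mono'
        (Measurable.aestronglyMeasurable (by fun_prop)) ?_
      filter_upwards [ae_restrict_mem hfm] with y hy
      have hy1 : 1 ≤ ‖y‖ := hL1.trans hy.1.le
      have hy0 : 0 < ‖y‖ := by linarith
      rw [Real.norm_eq_abs, abs_mul, abs_of_nonneg (by positivity : 0 ≤ ‖y‖ ^ (-(3 + α)))]
      calc ‖y‖ ^ (-(3 + α)) * |inner ℝ w y| ≤ ‖y‖ ^ (-(3 + α)) * (‖w‖ * ‖y‖) := by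
            gcongr; exact abs_real_inner_le_norm _ _
        _ = ‖w‖ * ‖y‖ ^ (-(2 + α)) := by
            rw [show -(2 + α) = -(3 + α) + 1 by ring, Real.rpow_add_one hy0.ne']; ring
        _ ≤ ‖w‖ * ‖y‖ ^ (-1 : ℝ) := by
            refine mul_le_mul_of_nonneg_left ?_ (norm_nonneg w)
            exact Real.rpow_le_rpow_of_exponent_le hy1 (by linarith)
    have hQ0 : ∫ y in far, ‖y‖ ^ (-(3 + α)) * inner ℝ w y = 0 :=
      setIntegral_odd_eq_zero hfm (fun y => by simp [hfar]) fun y => by simp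
    have htw := h.integral_tailWeight_le (L := L) (by linarith) hR
    have iw : IntegrableOn (fun y => 2 / R * shiftWeight N α y) far :=
      (hSWi.const_mul _).integrableOn
    have itw := htw.1.mono_set hfsub
    have h1 : ∫ y in far, (I y + ‖y‖ ^ (-(3 + α)) * inner ℝ w y) ≤
        ∫ y in far, (2 / R * shiftWeight N α y + tailWeight L R u y) := by
      refine setIntegral_mono_on (hIf.add hQi) (iw.add itw) hfm fun y hy => ?_
      rw [← hQ]
      exact (le_abs_self _).trans (h.abs_weighted_kernel_far_le hα hα1 hR hL1 hy.1)
    rw [integral_add hIf hQi, hQ0, add_zero, integral_add iw itw] at h1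
    have h2 : ∫ y in far, tailWeight L R u y ≤ ∫ y in {y : Plane | L < ‖y‖}, tailWeight L R u y :=
      setIntegral_mono_set htw.1 (.of_forall fun y => tailWeight_nonneg (by linarith) R u y)
        (.of_forall hfsub)
    have h3 : 2 * R * cutoffMass * (circleLen + N) / L =
        2 * cutoffMass * (circleLen + N) / K := by
      rw [hLdef]; field_simp
    linarith [hWle far, htw.2]
  rw [hsplit]
  have e : fluxError N α / K = 2 * W / K + (2 * W / K + 2 * cutoffMass * (circleLen + N) / K) := by
    rw [fluxError, ← hW]; ring
  rw [e]
  linarith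

end Profile

theorem Profile.measurable_of_hasPrincipalValue {N α : ℝ} {u : Plane → ℝ} (h : Profile N u)
    {V : Plane → ℝ} (hV : ∀ x, HasPrincipalValue (contourKernel α u x) (V x)) :
    Measurable V := by
  have hseq : Tendsto (fun n : ℕ => (((n : ℝ) + 1)⁻¹, (n : ℝ) + 1)) atTop
      (𝓝[>] (0 : ℝ) ×ˢ atTop) := by
    have h1 : Tendsto (fun n : ℕ => (n : ℝ) + 1) atTop atTop :=
      tendsto_atTop_add_const_right _ _ tendsto_natCast_atTop_atTop
    exact (tendsto_inv_atTop_nhdsGT_zero.comp h1).prodMk h1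
  refine measurable_of_tendsto_metrizable (f := fun (n : ℕ) x =>
    ∫ y in {y : Plane | ((n : ℝ) + 1)⁻¹ < ‖y‖ ∧ ‖y‖ < (n : ℝ) + 1}, contourKernel α u x y)
    (fun n => ?_) (tendsto_pi_nhds.2 fun x => (hV x).2.comp hseq)
  exact (StronglyMeasurable.integral_prod_right
    h.measurable_contourKernel.stronglyMeasurable).measurable

theorem Profile.exists_abs_velocity_le (N : ℝ) {α : ℝ} (hα : 0 ≤ α) (hα1 : α < 1) :
    ∃ C : ℝ, 0 ≤ C ∧ ∀ u, Profile N u → ∀ x v,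
      HasPrincipalValue (contourKernel α u x) v → |v| ≤ C := by
  obtain ⟨C, hC⟩ := Profile.exists_pv_rate N hα hα1
  refine ⟨|C| * 2, by positivity, fun u h x v hv => ?_⟩
  have h1 := hC u h x v hv 1 1 one_pos le_rfl le_rfl
  have he : {y : Plane | 1 < ‖y‖ ∧ ‖y‖ < 1} = ∅ := by
    ext y; simpa using fun h => le_of_lt h
  rw [he] at h1
  simp only [setIntegral_empty, sub_zero, Real.one_rpow, div_one] at h1
  refine h1.trans ?_
  rw [show (1:ℝ) + 1 = 2 by norm_num]
  exact mul_le_mul_of_nonneg_right (le_abs_self C) (by norm_num)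

/-- The weighted velocity of a nonnegative profile is controlled by its weighted mass. -/
theorem Profile.weighted_velocity_le {N α : ℝ} {u : Plane → ℝ} (h : Profile N u)
    (hu : ∀ x, 0 ≤ u x) (hα : 0 ≤ α) (hα1 : α < 1) {K : ℝ} (hK : 1 ≤ K)
    {V : Plane → ℝ} (hV : ∀ x, HasPrincipalValue (contourKernel α u x) (V x)) :
    Integrable (fun x => cutoff (K ^ 6) x * V x) ∧
    ∫ x, cutoff (K ^ 6) x * V x ≤
      fluxRate α / K * (∫ x, cutoff (K ^ 6) x * u x) + fluxError N α / K := by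
  have hR : 0 < K ^ 6 := by positivity
  have hχ := (integrable_cutoff hR).1
  obtain ⟨B, hB0, hB⟩ := Profile.exists_abs_velocity_le N hα hα1
  obtain ⟨C, hC⟩ := Profile.exists_pv_rate N hα hα1
  have hVm := h.measurable_of_hasPrincipalValue hV
  have hVi : Integrable (fun x => cutoff (K ^ 6) x * V x) := by
    refine (hχ.mul_const B).mono'
      ((continuous_cutoff _).measurable.mul hVm).aestronglyMeasurable (.of_forall fun x => ?_)
    rw [Real.norm_eq_abs, abs_mul, abs_of_nonneg (cutoff_nonneg _ x)]
    exact mul_le_mul_of_nonneg_left (hB u h x _ (hV x)) (cutoff_nonneg _ x)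
  refine ⟨hVi, ?_⟩
  have hα' : 0 < 1 - α := by linarith
  have hlim : Tendsto (fun S : ℝ => fluxRate α / K * (∫ x, cutoff (K ^ 6) x * u x) +
      fluxError N α / K + (∫ x, cutoff (K ^ 6) x) * (C * (S⁻¹ ^ (1 - α) + 1 / S))) atTop
      (𝓝 (fluxRate α / K * (∫ x, cutoff (K ^ 6) x * u x) +
      fluxError N α / K + (∫ x, cutoff (K ^ 6) x) * (C * (0 ^ (1 - α) + 0)))) := by
    have h1 : Tendsto (fun S : ℝ => S⁻¹ ^ (1 - α)) atTop (𝓝 (0 ^ (1 - α))) :=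
      tendsto_inv_atTop_zero.rpow_const (Or.inr hα'.le)
    have h2 : Tendsto (fun S : ℝ => 1 / S) atTop (𝓝 0) := by
      simpa using tendsto_inv_atTop_zero (𝕜 := ℝ)
    exact (((h1.add h2).const_mul C).const_mul _).const_add _
  rw [Real.zero_rpow hα'.ne', add_zero, mul_zero, mul_zero, add_zero] at hlim
  refine ge_of_tendsto hlim ?_
  filter_upwards [eventually_gt_atTop (K ^ 7), eventually_ge_atTop 1] with S hS hS1
  have hS0 : 0 < S := by linarith
  have hSi : S⁻¹ ≤ 1 := inv_le_one_of_one_le₀ hS1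
  have hf := h.weighted_flux_le hu hα hα1 hK (inv_pos.2 hS0) hSi hS
  have hmono : ∫ x, cutoff (K ^ 6) x * V x ≤ ∫ x, (cutoff (K ^ 6) x *
      (∫ y in {y : Plane | S⁻¹ < ‖y‖ ∧ ‖y‖ < S}, contourKernel α u x y) +
      cutoff (K ^ 6) x * (C * (S⁻¹ ^ (1 - α) + 1 / S))) := by
    refine integral_mono hVi (hf.1.add (hχ.mul_const _)) fun x => ?_
    have h1 := (le_abs_self _).trans
      (hC u h x _ (hV x) S⁻¹ S (inv_pos.2 hS0) hS1 (hSi.trans hS1))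
    simp only
    rw [← mul_add]
    exact mul_le_mul_of_nonneg_left (by linarith) (cutoff_nonneg _ x)
  rw [integral_add hf.1 (hχ.mul_const _), integral_mul_const] at hmono
  linarith [hf.2]

namespace Flow

variable {α N T : ℝ} {f : ℝ → Plane → ℝ}

theorem hasDerivWithinAt_weighted_mass (h : Flow α N T f) (hα : 0 ≤ α) (hα1 : α < 1)
    {R : ℝ} (hR : 0 < R) {V : ℝ → Plane → ℝ}
    (hV : ∀ t ∈ Set.Icc 0 T, ∀ x, HasPrincipalValue (contourKernel α (f t) x) (V t x) ∧
      HasDerivWithinAt (fun s => f s x) (V t x) (Set.Icc 0 T) t) {t : ℝ} (ht : t ∈ Set.Icc 0 T) :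
    HasDerivWithinAt (fun s => ∫ x, cutoff R x * f s x) (∫ x, cutoff R x * V t x)
      (Set.Icc 0 T) t := by
  have hχ := (integrable_cutoff hR).1
  obtain ⟨B, hB0, hB⟩ := Profile.exists_abs_velocity_le N hα hα1
  have hlip : ∀ s ∈ Set.Icc 0 T, ∀ x, |f s x - f t x| ≤ B * |s - t| := fun s hs x =>
    (convex_Icc 0 T).norm_image_sub_le_of_norm_hasDerivWithin_le
      (fun r hr => (hV r hr x).2) (fun r hr => hB _ (h.profile r hr) x _ (hV r hr x).1) ht hs
  rw [hasDerivWithinAt_iff_tendsto_slope]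
  have hslope : Tendsto (fun s => ∫ x, cutoff R x * slope (fun r => f r x) t s)
      (𝓝[Set.Icc 0 T \ {t}] t) (𝓝 (∫ x, cutoff R x * V t x)) := by
    refine tendsto_integral_filter_of_dominated_convergence (fun x => cutoff R x * B) ?_ ?_
      (hχ.mul_const B) ?_
    · filter_upwards [self_mem_nhdsWithin] with s hs
      have h1 := (h.profile s hs.1).continuous
      have h2 := (h.profile t ht).continuous
      have h3 := continuous_cutoff R
      simp only [slope_def_field]
      exact Continuous.aestronglyMeasurable (by fun_prop)
    · filter_upwards [self_mem_nhdsWithin] with s hs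
      refine .of_forall fun x => ?_
      have hne : 0 < |s - t| := abs_pos.2 (sub_ne_zero.2 hs.2)
      rw [Real.norm_eq_abs, abs_mul, abs_of_nonneg (cutoff_nonneg R x), slope_def_field, abs_div]
      refine mul_le_mul_of_nonneg_left ?_ (cutoff_nonneg R x)
      rw [div_le_iff₀ hne]
      exact hlip s hs.1 x
    · exact .of_forall fun x =>
        ((hasDerivWithinAt_iff_tendsto_slope.1 (hV t ht x).2)).const_mul _
  refine hslope.congr' ?_
  filter_upwards [self_mem_nhdsWithin] with s hs
  rw [slope_def_field, ← integral_sub ((h.profile s hs.1).integrable_cutoff_mul hR)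
    ((h.profile t ht).integrable_cutoff_mul hR), div_eq_inv_mul, ← integral_const_mul]
  refine integral_congr_ae (.of_forall fun x => ?_)
  simp only [slope_def_field]
  ring

theorem weighted_mass_le (h : Flow α N T f) (hα : 0 ≤ α) (hα1 : α < 1)
    (hf : ∀ t ∈ Set.Icc 0 T, ∀ x, 0 ≤ f t x) {K : ℝ} (hK : 1 ≤ K) {t : ℝ}
    (ht : t ∈ Set.Icc 0 T) :
    ∫ x, cutoff (K ^ 6) x * f t x ≤ Real.exp (fluxRate α / K * t) *
      ((∫ x, cutoff (K ^ 6) x * f 0 x) + fluxError N α / K * t) := by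
  have hR : 0 < K ^ 6 := by positivity
  have hT : 0 ≤ T := ht.1.trans ht.2
  choose! V hV using h.equation
  set m : ℝ → ℝ := fun s => ∫ x, cutoff (K ^ 6) x * f s x with hm
  set a := fluxRate α / K with ha
  set b := fluxError N α / K with hb
  have ha0 : 0 ≤ a := div_nonneg (fluxRate_nonneg hα1) (by linarith)
  have hb0 : 0 ≤ b := div_nonneg (fluxError_nonneg (h.profile t ht).const_nonneg α) (by linarith)
  have hmd := fun s hs => h.hasDerivWithinAt_weighted_mass hα hα1 hR hV (t := s) hs
  have hmb : ∀ s ∈ Set.Icc 0 T, ∫ x, cutoff (K ^ 6) x * V s x ≤ a * m s + b := fun s hs =>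
    ((h.profile s hs).weighted_velocity_le (hf s hs) hα hα1 hK fun x => (hV s hs x).1).2
  have hFd : ∀ s ∈ Set.Icc 0 T, HasDerivWithinAt (fun s => Real.exp (-a * s) * m s - b * s)
      ((Real.exp (-a * s) * (-a)) * m s +
        Real.exp (-a * s) * (∫ x, cutoff (K ^ 6) x * V s x) - b) (Set.Icc 0 T) s := fun s hs => by
    have h1 : HasDerivAt (fun s => Real.exp (-a * s)) (Real.exp (-a * s) * (-a)) s := by
      simpa using ((hasDerivAt_id s).const_mul (-a)).exp
    have h2 : HasDerivAt (fun s => b * s) b s := by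
      simpa using (hasDerivAt_id s).const_mul b
    exact (h1.hasDerivWithinAt.fun_mul (hmd s hs)).fun_sub h2.hasDerivWithinAt
  have hanti := antitoneOn_of_hasDerivWithinAt_nonpos (convex_Icc 0 T)
    (fun s hs => (hFd s hs).continuousWithinAt)
    (fun s hs => (hFd s (interior_subset hs)).mono interior_subset) (fun s hs => by
      have hs' := interior_subset hs
      have h1 := hmb s hs'
      have h2 : Real.exp (-a * s) ≤ 1 := Real.exp_le_one_iff.2 (by nlinarith [hs'.1])
      have h3 : 0 < Real.exp (-a * s) := Real.exp_pos _
      have h4 := mul_le_mul_of_nonneg_left h1 h3.le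
      have h5 := mul_le_mul_of_nonneg_right h2 hb0
      linarith)
  have h0 := hanti (Set.left_mem_Icc.2 hT) ht ht.1
  simp only [mul_zero, Real.exp_zero, one_mul, sub_zero] at h0
  have e : Real.exp (a * t) * Real.exp (-a * t) = 1 := by
    rw [← Real.exp_add]; simp
  calc m t = Real.exp (a * t) * (Real.exp (-a * t) * m t) := by rw [← mul_assoc, e, one_mul]
    _ ≤ Real.exp (a * t) * (m 0 + b * t) := by gcongr; linarith

/-- A nonnegative flow does not gain mass. -/
theorem integral_le (h : Flow α N T f) (hα : 0 ≤ α) (hα1 : α < 1)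
    (hf : ∀ t ∈ Set.Icc 0 T, ∀ x, 0 ≤ f t x) (h0 : Integrable (f 0)) {t : ℝ}
    (ht : t ∈ Set.Icc 0 T) : Integrable (f t) ∧ ∫ x, f t x ≤ ∫ x, f 0 x := by
  have hT : 0 ≤ T := ht.1.trans ht.2
  have hf0 := hf 0 (Set.left_mem_Icc.2 hT)
  have hP := h.profile t ht
  set A := ∫ x, f 0 x with hA
  have hA0 : 0 ≤ A := integral_nonneg hf0
  have hK : ∀ n : ℕ, (1:ℝ) ≤ (n:ℝ) + 1 := fun n => by
    have : (0:ℝ) ≤ n := n.cast_nonneg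
    linarith
  set bound : ℕ → ℝ := fun n => Real.exp (fluxRate α / ((n:ℝ) + 1) * t) *
      (A + fluxError N α / ((n:ℝ) + 1) * t) with hbound
  have hm : ∀ n : ℕ, ∫ x, cutoff (((n:ℝ) + 1) ^ 6) x * f t x ≤ bound n := fun n => by
    refine (h.weighted_mass_le hα hα1 hf (hK n) ht).trans ?_
    have hR : (0:ℝ) < ((n:ℝ) + 1) ^ 6 := by positivity
    simp only [hbound]
    gcongr
    refine integral_mono ((h.profile 0 (Set.left_mem_Icc.2 hT)).integrable_cutoff_mul hR) h0
      fun x => ?_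
    exact mul_le_of_le_one_left (hf0 x) (cutoff_le_one _ x)
  have hn : Tendsto (fun n : ℕ => (n : ℝ) + 1) atTop atTop :=
    tendsto_atTop_add_const_right _ _ tendsto_natCast_atTop_atTop
  have hlim : Tendsto bound atTop (𝓝 A) := by
    have h1 : Tendsto (fun n : ℕ => Real.exp (fluxRate α / ((n:ℝ) + 1) * t)) atTop
        (𝓝 (Real.exp (0 * t))) :=
      (Real.continuous_exp.tendsto _).comp ((hn.const_div_atTop _).mul_const t)
    have h2 : Tendsto (fun n : ℕ => A + fluxError N α / ((n:ℝ) + 1) * t) atTop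
        (𝓝 (A + 0 * t)) := ((hn.const_div_atTop _).mul_const t).const_add A
    simpa using h1.mul h2
  have hχ : ∀ x, Tendsto (fun n : ℕ => ENNReal.ofReal (cutoff (((n:ℝ) + 1) ^ 6) x * f t x)) atTop
      (𝓝 (ENNReal.ofReal (f t x))) := fun x => by
    refine ENNReal.tendsto_ofReal ?_
    have h1 : Tendsto (fun n : ℕ => (((n:ℝ) + 1) ^ 6) ^ 2) atTop atTop :=
      (tendsto_pow_atTop two_ne_zero).comp ((tendsto_pow_atTop (by norm_num)).comp hn)
    have h2 : Tendsto (fun n : ℕ => cutoff (((n:ℝ) + 1) ^ 6) x) atTop (𝓝 ((1 + 0) ^ 2)⁻¹) :=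
      (((h1.const_div_atTop (‖x‖ ^ 2)).const_add 1).pow 2).inv₀ (by norm_num)
    simpa using h2.mul_const (f t x)
  have hlint : ∫⁻ x, ENNReal.ofReal (f t x) ≤ ENNReal.ofReal A := by
    calc ∫⁻ x, ENNReal.ofReal (f t x)
        = ∫⁻ x, liminf (fun n : ℕ => ENNReal.ofReal (cutoff (((n:ℝ) + 1) ^ 6) x * f t x)) atTop :=
          lintegral_congr fun x => (hχ x).liminf_eq.symm
      _ ≤ liminf (fun n : ℕ => ∫⁻ x, ENNReal.ofReal (cutoff (((n:ℝ) + 1) ^ 6) x * f t x)) atTop :=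
          lintegral_liminf_le fun n =>
            (((continuous_cutoff _).mul hP.continuous).measurable).ennreal_ofReal
      _ ≤ liminf (fun n : ℕ => ENNReal.ofReal (bound n)) atTop := by
          refine liminf_le_liminf (.of_forall fun n => ?_)
          have hR : (0:ℝ) < ((n:ℝ) + 1) ^ 6 := by positivity
          rw [← ofReal_integral_eq_lintegral_ofReal (hP.integrable_cutoff_mul hR)
            (.of_forall fun x => mul_nonneg (cutoff_nonneg _ x) (hf t ht x))]
          exact ENNReal.ofReal_le_ofReal (hm n)
      _ = ENNReal.ofReal A := (ENNReal.tendsto_ofReal hlim).liminf_eq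
  have hi : Integrable (f t) := by
    refine (lintegral_ofReal_ne_top_iff_integrable hP.continuous.aestronglyMeasurable
      (.of_forall (hf t ht))).1 (hlint.trans_lt ENNReal.ofReal_lt_top).ne
  refine ⟨hi, ?_⟩
  rw [← ofReal_integral_eq_lintegral_ofReal hi (.of_forall (hf t ht))] at hlint
  exact (ENNReal.ofReal_le_ofReal_iff hA0).1 hlint

end Flow

/-- The decay rate in terms of the initial supremum `a` and mass `b`. -/
def decayRate (a b α : ℝ) : ℝ :=
  open Classical in
  if 0 < a ∧ 0 < b then
    b * (b + 8 * a ^ 3) ^ (-((3 + α) / 2)) / 4 * a ^ ((3 + α) / 2 - 1)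
  else 1

theorem decayRate_pos (a b α : ℝ) : 0 < decayRate a b α := by
  unfold decayRate
  split_ifs with h
  · obtain ⟨ha, hb⟩ := h
    positivity
  · exact one_pos

/-- At a maximum the velocity of a nonnegative profile is bounded by a power of the height. -/
theorem Profile.pv_le_neg_rpow {N α : ℝ} {u : Plane → ℝ} (h : Profile N u) (hα : 0 ≤ α)
    (hα1 : α < 1) (hu : ∀ z, 0 ≤ u z) (hi : Integrable u) {A M : ℝ} (hA : 0 < A)
    (hiA : ∫ z, u z ≤ A) (hM : 0 < M) {x : Plane} (hx : u x = M) (hmax : ∀ z, u z ≤ u x)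
    {v : ℝ} (hv : HasPrincipalValue (contourKernel α u x) v) :
    v ≤ -(A * (A + M ^ 3) ^ (-((3 + α) / 2)) * M ^ ((3 + α) / 2)) := by
  obtain ⟨hint, hle⟩ := h.pv_le_of_max hα hα1 hmax hv
  refine hle.trans (neg_le_neg ?_)
  set p := (3 + α) / 2 with hp
  have hp0 : 0 ≤ p := by rw [hp]; linarith
  set r := √(2 * A / (Real.pi * M)) with hr
  have hpi := Real.pi_pos
  have hr2 : r ^ 2 = 2 * A / (Real.pi * M) := Real.sq_sqrt (by positivity)
  have hr0 : 0 ≤ r := Real.sqrt_nonneg _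
  set B : Set Plane := Metric.ball 0 r with hB
  have hvol : volume.real B = 2 * A / M := by
    rw [hB, Measure.real, EuclideanSpace.volume_ball_fin_two, ENNReal.toReal_mul,
      ENNReal.toReal_pow, ENNReal.toReal_ofReal hr0, hr2]
    rw [ENNReal.toReal_ofReal hpi.le]
    field_simp
  have hBfin : volume B ≠ ⊤ := measure_ball_lt_top.ne
  have hBm : MeasurableSet B := measurableSet_ball
  set F : Plane → ℝ := fun y => (u x - u (x - y)) *
    (‖y‖ ^ 2 + (u x - u (x - y)) ^ 2) ^ (-p) with hF
  have hF0 : ∀ y, 0 ≤ F y := fun y => mul_nonneg (sub_nonneg.2 (hmax _)) (by positivity)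
  have hshift : Integrable fun y => u (x - y) := hi.comp_sub_left x
  have hci : IntegrableOn (fun _ : Plane => u x) B := integrableOn_const hBfin
  have hδi : IntegrableOn (fun y => u x - u (x - y)) B := hci.sub hshift.integrableOn
  have hκ : 0 < A / M + M ^ 2 := by positivity
  have hδ : A ≤ ∫ y in B, (u x - u (x - y)) := by
    rw [integral_sub hci hshift.integrableOn, setIntegral_const, hvol, hx,
      smul_eq_mul]
    have h1 : ∫ y in B, u (x - y) ≤ A :=
      (setIntegral_le_integral hshift (.of_forall fun y => hu _)).trans (by
        rwa [integral_sub_left_eq_self u volume x])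
    have h2 : 2 * A / M * M = 2 * A := by field_simp
    linarith
  have hmono : ∫ y in B, (u x - u (x - y)) * (A / M + M ^ 2) ^ (-p) ≤ ∫ y, F y := by
    refine le_trans ?_ (setIntegral_le_integral hint (.of_forall hF0) : ∫ y in B, F y ≤ _)
    refine setIntegral_mono_on (hδi.mul_const _) hint.integrableOn hBm fun y hy => ?_
    rcases (sub_nonneg.2 (hmax (x - y))).eq_or_lt with h0 | h0
    · simp [hF, ← h0]
    refine mul_le_mul_of_nonneg_left ?_ h0.le
    have hy' : ‖y‖ < r := by simpa [hB] using hy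
    refine Real.rpow_le_rpow_of_nonpos (by positivity) (add_le_add ?_ ?_) (by linarith)
    · calc ‖y‖ ^ 2 ≤ r ^ 2 := by gcongr
        _ = A / M * (2 / Real.pi) := by rw [hr2]; field_simp
        _ ≤ A / M * 1 := by
            gcongr
            rw [div_le_one hpi]; linarith [Real.pi_gt_three]
        _ = A / M := mul_one _
    · have := hu (x - y)
      gcongr
      linarith
  rw [integral_mul_const] at hmono
  refine le_trans (le_of_eq ?_) ((mul_le_mul_of_nonneg_right hδ (by positivity)).trans hmono)
  rw [show A / M + M ^ 2 = (A + M ^ 3) / M by field_simp,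
    Real.div_rpow (by positivity) hM.le, Real.rpow_neg hM.le]
  field_simp

namespace Flow

variable {α N T : ℝ} {f : ℝ → Plane → ℝ}

theorem nonneg (h : Flow α N T f) (hα : 0 ≤ α) (hα1 : α < 1) (h0 : ∀ x, 0 ≤ f 0 x) :
    ∀ t ∈ Set.Icc 0 T, ∀ x, 0 ≤ f t x := fun t ht x =>
  neg_nonpos.1 (h.neg.nonpos hα hα1 (fun z => neg_nonpos.2 (h0 z)) t ht x)

theorem le_decay (h : Flow α N T f) (hα : 0 ≤ α) (hα1 : α < 1) (h0 : ∀ x, 0 ≤ f 0 x)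
    (hi : Integrable (f 0)) {M A : ℝ} (hM : 0 < M) (hA : 0 < A) (hfM : ∀ x, f 0 x ≤ M)
    (hfA : ∫ x, f 0 x ≤ A) {t : ℝ} (ht : t ∈ Set.Icc 0 T) (x : Plane) :
    f t x ≤ M * (1 + decayRate M A α * t) ^ (-(2 / (1 + α))) := by
  have hf := h.nonneg hα hα1 h0
  set C := decayRate M A α with hC
  have hC0 : 0 < C := decayRate_pos M A α
  set q := 2 / (1 + α) with hq
  have hq0 : 0 < q := by positivity
  have hq2 : q ≤ 2 := by rw [hq, div_le_iff₀ (by linarith)]; linarith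
  set p := (3 + α) / 2 with hp
  have hqp : -q * p = -q - 1 := by
    rw [hq, hp]
    have : (1 + α) ≠ 0 := by linarith
    field_simp
    ring
  have hbase : ∀ s ∈ Set.Icc 0 T, 1 ≤ 1 + C * s := fun s hs => by
    have := mul_nonneg hC0.le hs.1
    linarith
  have key : ∀ ε ∈ Set.Ioc 0 M, f t x < (M + ε) * (1 + C * t) ^ (-q) := by
    intro ε hε
    have hMε : 0 < M + ε := by linarith [hε.1]
    refine h.lt_of_barrier (φ := fun s => (M + ε) * (1 + C * s) ^ (-q))
      (φ' := fun s => (M + ε) * (C * (-q) * (1 + C * s) ^ (-q - 1)))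
      (fun s hs => ?_) (fun s hs => ?_) (fun z => ?_) (fun s hs z v hmax hz hv => ?_) t ht x
    · have := hbase s hs
      positivity
    · have h1 : HasDerivAt (fun s => 1 + C * s) C s := by
        simpa using ((hasDerivAt_id s).const_mul C).const_add 1
      have h2 := h1.rpow_const (p := -q) (Or.inl (by have := hbase s hs; linarith))
      exact (h2.const_mul (M + ε)).hasDerivWithinAt
    · simp only [mul_zero, add_zero, Real.one_rpow, mul_one]
      linarith [hfM z, hε.1]
    · have hb := hbase s hs
      have hb0 : 0 < 1 + C * s := by linarith
      have hb1 : (1 + C * s) ^ (-q) ≤ 1 := Real.rpow_le_one_of_one_le_of_nonpos hb (by linarith)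
      set m := (M + ε) * (1 + C * s) ^ (-q) with hm
      have hm0 : 0 < m := by positivity
      have hm2 : m ≤ 2 * M := by
        calc m ≤ (M + ε) * 1 := by rw [hm]; gcongr
          _ ≤ 2 * M := by linarith [hε.2]
      obtain ⟨hmi, hmA⟩ := h.integral_le hα hα1 hf hi hs
      have hv1 := (h.profile s hs).pv_le_neg_rpow hα hα1 (hf s hs) hmi hA (hmA.trans hfA) hm0
        hz hmax hv
      rw [← hp] at hv1
      set c := A * (A + 8 * M ^ 3) ^ (-p) with hc
      have hc0 : 0 < c := by positivity
      have hcle : c ≤ A * (A + m ^ 3) ^ (-p) := by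
        rw [hc]
        refine mul_le_mul_of_nonneg_left ?_ hA.le
        refine Real.rpow_le_rpow_of_nonpos (by positivity) ?_ (by rw [hp]; linarith)
        have : m ^ 3 ≤ (2 * M) ^ 3 := by gcongr
        nlinarith
      have hCc : C = c / 4 * M ^ (p - 1) := by
        rw [hC, decayRate, if_pos ⟨hM, hA⟩]
      have hmp : m ^ p = (M + ε) * ((M + ε) ^ (p - 1) * (1 + C * s) ^ (-q - 1)) := by
        rw [hm, Real.mul_rpow hMε.le (by positivity), ← Real.rpow_mul hb0.le, hqp,
          Real.rpow_sub_one hMε.ne']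
        field_simp
      have hlt : C * q < c * (M + ε) ^ (p - 1) := by
        have h1 : M ^ (p - 1) ≤ (M + ε) ^ (p - 1) :=
          Real.rpow_le_rpow hM.le (by linarith [hε.1]) (by rw [hp]; linarith)
        have h2 : 0 < M ^ (p - 1) := by positivity
        calc C * q ≤ C * 2 := by gcongr
          _ = c * M ^ (p - 1) / 2 := by rw [hCc]; ring
          _ < c * M ^ (p - 1) := by
              have : 0 < c * M ^ (p - 1) := by positivity
              linarith
          _ ≤ _ := by gcongr
      have hw : 0 < (M + ε) * (1 + C * s) ^ (-q - 1) := by positivity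
      have h3 : c * m ^ p ≤ A * (A + m ^ 3) ^ (-p) * m ^ p := by gcongr
      have h4 := mul_lt_mul_of_pos_right hlt hw
      calc v ≤ -(c * m ^ p) := hv1.trans (neg_le_neg h3)
        _ = -(c * (M + ε) ^ (p - 1) * ((M + ε) * (1 + C * s) ^ (-q - 1))) := by rw [hmp]; ring
        _ < -(C * q * ((M + ε) * (1 + C * s) ^ (-q - 1))) := neg_lt_neg h4
        _ = _ := by ring
  have hlim : Tendsto (fun ε : ℝ => (M + ε) * (1 + C * t) ^ (-q)) (𝓝[>] 0)
      (𝓝 ((M + 0) * (1 + C * t) ^ (-q))) :=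
    ((tendsto_id.mono_left nhdsWithin_le_nhds).const_add M).mul_const _
  rw [add_zero] at hlim
  refine ge_of_tendsto hlim ?_
  filter_upwards [Ioc_mem_nhdsGT hM] with ε hε
  exact (key ε hε).le

theorem eLpNorm_top_le (h : Flow α N T f) (hα : 0 ≤ α) (hα1 : α < 1) (h0 : ∀ x, 0 ≤ f 0 x)
    (hi : Integrable (f 0)) {t : ℝ} (ht : t ∈ Set.Icc 0 T) :
    eLpNorm (f t) ∞ volume ≤ eLpNorm (f 0) ∞ volume /
      ENNReal.ofReal ((1 + decayRate (eLpNorm (f 0) ∞ volume).toReal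
        (eLpNorm (f 0) 1 volume).toReal α * t) ^ (2 / (1 + α))) := by
  have h0I : (0:ℝ) ∈ Set.Icc 0 T := Set.left_mem_Icc.2 (ht.1.trans ht.2)
  have hP := h.profile 0 h0I
  have hf := h.nonneg hα hα1 h0 t ht
  have hfin : eLpNorm (f 0) ∞ volume ≠ ⊤ := by
    rw [eLpNorm_exponent_top]
    exact ((eLpNormEssSup_le_of_ae_bound (.of_forall hP.abs_le)).trans_lt
      ENNReal.ofReal_lt_top).ne
  set M := (eLpNorm (f 0) ∞ volume).toReal with hM
  set A := (eLpNorm (f 0) 1 volume).toReal with hA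
  have hMeq : eLpNorm (f 0) ∞ volume = ENNReal.ofReal M := (ENNReal.ofReal_toReal hfin).symm
  have hM0 : 0 ≤ M := ENNReal.toReal_nonneg
  have hle : ∀ x, f 0 x ≤ M := by
    have hopen : IsOpen {x | M < f 0 x} := isOpen_lt continuous_const hP.continuous
    have hae : ∀ᵐ x, f 0 x ≤ M := by
      filter_upwards [ae_le_eLpNormEssSup (f := f 0) (μ := volume)] with x hx
      rw [← eLpNorm_exponent_top, hMeq, Real.enorm_eq_ofReal (h0 x)] at hx
      exact (ENNReal.ofReal_le_ofReal_iff hM0).1 hx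
    have hempty := hopen.eq_empty_of_measure_zero (μ := volume) (by
      rw [ae_iff] at hae
      simpa using hae)
    intro x
    by_contra hx
    have : x ∈ {x | M < f 0 x} := not_le.1 hx
    rw [hempty] at this
    exact this
  have hAeq : ∫ x, f 0 x = A := by
    rw [hA, eLpNorm_one_eq_lintegral_enorm, ← integral_norm_eq_lintegral_enorm hi.1]
    exact integral_congr_ae (.of_forall fun x => (Real.norm_of_nonneg (h0 x)).symm)
  have hD := decayRate_pos M A α
  have hb : 0 < (1 + decayRate M A α * t) ^ (2 / (1 + α)) := by
    have := ht.1
    positivity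
  rw [hMeq, ← ENNReal.ofReal_div_of_pos hb, eLpNorm_exponent_top]
  refine eLpNormEssSup_le_of_ae_bound (.of_forall fun x => ?_)
  rw [Real.norm_of_nonneg (hf x)]
  rcases hM0.eq_or_lt with hz | hpos
  · rw [← hz, zero_div]
    exact h.nonpos hα hα1 (fun z => (hle z).trans hz.ge) t ht x
  · have hApos : 0 < A := by
      refine lt_of_le_of_ne ENNReal.toReal_nonneg fun hA0 => hpos.ne' ?_
      rw [← hA0] at hAeq
      have hz := (integral_eq_zero_iff_of_nonneg h0 hi).1 hAeq
      rw [hM, eLpNorm_congr_ae hz]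
      simp
    have := h.le_decay hα hα1 h0 hi hpos hApos hle hAeq.le ht x
    rwa [Real.rpow_neg (by have := ht.1; positivity), ← div_eq_mul_inv] at this

end Flow

end Muskat

end

theorem mainTheorem4 :
    ∃ C : ℝ → ℝ → ℝ → ℝ, (∀ a b α : ℝ, 0 < C a b α) ∧
      ∀ (α : ℝ), 0 ≤ α → α < 1 →
      ∀ (k : ℕ), 4 ≤ k →
      ∀ (f₀ : Muskat.Plane → ℝ), Muskat.MemHk k f₀ → Integrable f₀ volume →
        ((∀ x, f₀ x ≤ 0) ∨ (∀ x, 0 ≤ f₀ x)) →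
      ∀ (T : ℝ), 0 < T →
      ∀ (f : ℝ → Muskat.Plane → ℝ), Muskat.IsSolution α k T f₀ f →
      ∀ t ∈ Set.Icc 0 T,
        eLpNorm (f t) ∞ volume ≤
          eLpNorm f₀ ∞ volume /
            ENNReal.ofReal ((1 + C (eLpNorm f₀ ∞ volume).toReal (eLpNorm f₀ 1 volume).toReal α * t)
              ^ (2 / (1 + α))) := by
  refine ⟨Muskat.decayRate, Muskat.decayRate_pos, ?_⟩
  intro α hα hα1 k hk f₀ _ hi hsign T _ f hf t ht
  obtain ⟨N, hN⟩ := hf.exists_flow hk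
  have h0 := hf.initial
  subst h0
  rcases hsign with hs | hs
  · have hneg : ∀ s p, eLpNorm (fun x => -f s x) p volume = eLpNorm (f s) p volume :=
      fun s p => eLpNorm_neg (f s) p volume
    have h := hN.neg.eLpNorm_top_le hα hα1 (fun x => neg_nonneg.2 (hs x)) hi.neg ht
    simpa only [hneg] using h
  · exact hN.eLpNorm_top_le hα hα1 hs hi ht
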